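/- **Theorem 1.** Let $a,b,c,p,q,r$ be holomorphic functions of a complex variable $u$ on an open set $D\subset\mathbb C$, and consider the PDE for $u(x,y,t)$ $$(a(u))_{xx}+(b(u))_{yy}+(c(u))_{tt}+2(p(u))_{xy}+2(q(u))_{xt}+2(r(u))_{yt}=0.\qquad(1)$$ Put $$V(u)=\begin{pmatrix}a'&p'&q'\\p'&b'&r'\\q'&r'&c'\end{pmatrix}$$ and assume $\det V(u)\neq0$ for all $u\in D$. *Definitions.* An $N$-component hydrodynamic reduction of (1) consists of holomorphic functions $u,\lambda^i,\mu^i$ ($1\le i\le N$) of $R=(R^1,\dots,R^N)$ on an open set, with $u$ taking values in $D$, such that the systems $R^i_t=\lambda^i(R)R^i_x$, $R^i_y=\mu^i(R)R^i_x$ are compatible, i.e. $\partial_{R^j}\lambda^i\,(\mu^j-\mu^i)=\partial_{R^j}\mu^i\,(\lambda^j-\lambda^i)$ for $i\ne j$, and $u(R(x,y,t))$ solves (1) for every holomorphic solution $R(x,y,t)$ of both systems. Equation (1) is *integrable by the method of hydrodynamic reductions* if for every $N$ it has $N$-component reductions parametrised by $N$ arbitrary functions of one variable (up to reparametrisations $R^i\to\psi^i(R^i)$),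 in the following sense: for all holomorphic functions $f^i(s),l^i(s),m^i(s)$ near $s=0$, $1\le i\le N$, with $f^1(0)=\dots=f^N(0)=u_0\in D$, $(f^i)'(0)\ne0$, the points $(l^i(0),m^i(0))$ pairwise distinct, and satisfying the dispersion relation $$a'+b'(m^i)^2+c'(l^i)^2+2(p'm^i+q'l^i+r'l^im^i)=0\quad\text{at } u=f^i(s),$$ there is an $N$-component reduction defined near $R=0$ with $u=f^i$, $\lambda^i=l^i$, $\mu^i=m^i$ on the $R^i$-axis near $0$, for each $i$ (for $N=0$, given any $u_0\in D$). The equation is *nonlinear* if $V(u)$ is not of the form $f(u)V_0$ with a scalar function $f$ and a constant matrix $V_0$. Two equations (1), near the values $u_0$ and $w_0$ of their unknowns, are *equivalent* if an invertible complex linear change of $x,y,t$ and a local biholomorphic change $u=\varphi(w)$, $\varphi(w_0)=u_0$, carry one to the other (up to additive constants in the coefficient functions). *Statement.* (i) Equation (1) is integrable by the method of hydrodynamic reductions if and only if $$V''=(\ln\det V)'\,V'+kV\quad\text{on } D$$ for some scalar function $k$ of $u$. (ii) If $D$ is connected and (1) is integrable and nonlinear, then there is one equation among the following five to which (1) is equivalent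 near every $u_0\in D$: 1. $u_{xx}+u_{yy}-g(u)_{yy}-g(u)_{tt}=0$, $\;g(u)=\ln(1-e^u)$; 2. $u_{xx}+u_{yy}+(e^u)_{tt}=0$ (Boyer–Finley); 3. $(e^u-u)_{xx}+2u_{xy}+(e^u)_{tt}=0$; 4. $u_{xt}-(uu_x)_x-u_{yy}=0$ (dKP); 5. $(u^2)_{xy}+u_{yy}+2u_{xt}=0$. (iii) Each of these five equations (the first on the domain where the principal branch of $\ln(1-e^u)$ is holomorphic, the others on $\mathbb C$; these domains are open and connected) has holomorphic coefficients and $\det V\ne0$, and is nonlinear and integrable; no two different ones are equivalent, near any values of their unknowns. -/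

import Mathlib

open Filter Topology

/-- The partial derivative `∂f/∂zᵢ` of a function of `n` complex variables. -/
noncomputable def pd {n : ℕ} (i : Fin n) (f : (Fin n → ℂ) → ℂ) (z : Fin n → ℂ) : ℂ :=
  fderiv ℂ f z (Pi.single i 1)

/-- The entrywise derivative of a matrix-valued function of one complex variable. -/
noncomputable def matDeriv (M : ℂ → Matrix (Fin 3) (Fin 3) ℂ) (u : ℂ) :
    Matrix (Fin 3) (Fin 3) ℂ :=
  Matrix.of fun i j => deriv (fun s => M s i j) u

/-- The six coefficient functions of the equation
`(a(u))_xx + (b(u))_yy + (c(u))_tt + 2 (p(u))_xy + 2 (q(u))_xt + 2 (r(u))_yt = 0`. -/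
structure QuadPDE where
  a : ℂ → ℂ
  b : ℂ → ℂ
  c : ℂ → ℂ
  p : ℂ → ℂ
  q : ℂ → ℂ
  r : ℂ → ℂ

namespace QuadPDE

/-- The coefficient functions are holomorphic on `D`. -/
def Holomorphic (E : QuadPDE) (D : Set ℂ) : Prop :=
  AnalyticOnNhd ℂ E.a D ∧ AnalyticOnNhd ℂ E.b D ∧ AnalyticOnNhd ℂ E.c D ∧
    AnalyticOnNhd ℂ E.p D ∧ AnalyticOnNhd ℂ E.q D ∧ AnalyticOnNhd ℂ E.r D

/-- The equation holds for `u` at every point of `W ⊆ ℂ³`; the coordinates `0, 1, 2` of `ℂ³` are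
`x, y, t`. -/
def Holds (E : QuadPDE) (W : Set (Fin 3 → ℂ)) (u : (Fin 3 → ℂ) → ℂ) : Prop :=
  ∀ z ∈ W,
    pd 0 (pd 0 fun w => E.a (u w)) z + pd 1 (pd 1 fun w => E.b (u w)) z
      + pd 2 (pd 2 fun w => E.c (u w)) z + 2 * pd 1 (pd 0 fun w => E.p (u w)) z
      + 2 * pd 2 (pd 0 fun w => E.q (u w)) z + 2 * pd 2 (pd 1 fun w => E.r (u w)) z = 0

/-- The symmetric matrix of the coefficient functions. -/
def coeffMatrix (E : QuadPDE) (u : ℂ) : Matrix (Fin 3) (Fin 3) ℂ :=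
  !![E.a u, E.p u, E.q u;
     E.p u, E.b u, E.r u;
     E.q u, E.r u, E.c u]

/-- The matrix `V(u)`. -/
noncomputable def V (E : QuadPDE) (u : ℂ) : Matrix (Fin 3) (Fin 3) ℂ :=
  !![deriv E.a u, deriv E.p u, deriv E.q u;
     deriv E.p u, deriv E.b u, deriv E.r u;
     deriv E.q u, deriv E.r u, deriv E.c u]

/-- `V` is nondegenerate on `D`. -/
def Nondegenerate (E : QuadPDE) (D : Set ℂ) : Prop :=
  ∀ u ∈ D, (E.V u).det ≠ 0

/-- Up to a change `u → φ(u)` the equation is linear with constant coefficients: the curve `V(u)`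
lies on a line through the origin. -/
def IsLinearizable (E : QuadPDE) (D : Set ℂ) : Prop :=
  ∃ (V₀ : Matrix (Fin 3) (Fin 3) ℂ) (f : ℂ → ℂ), ∀ u ∈ D, E.V u = f u • V₀

/-- The left-hand side of the dispersion relation
`a' + b' μ² + c' λ² + 2 (p' μ + q' λ + r' λ μ) = 0`, where `l`, `m` stand for `λ`, `μ`. -/
noncomputable def dispersion (E : QuadPDE) (u l m : ℂ) : ℂ :=
  deriv E.a u + deriv E.b u * m ^ 2 + deriv E.c u * l ^ 2
    + 2 * (deriv E.p u * m + deriv E.q u * l + deriv E.r u * (l * m))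

/-- The functions `R¹, …, Rᴺ` of `(x, y, t) ∈ W` satisfy the pair of systems of hydrodynamic type
`Rⁱ_t = λⁱ(R) Rⁱ_x`, `Rⁱ_y = μⁱ(R) Rⁱ_x`. -/
def SolvesHydro {N : ℕ} (lam mu : Fin N → (Fin N → ℂ) → ℂ) (W : Set (Fin 3 → ℂ))
    (R : (Fin 3 → ℂ) → (Fin N → ℂ)) : Prop :=
  ∀ z ∈ W, ∀ i,
    pd 2 (fun w => R w i) z = lam i (R z) * pd 0 (fun w => R w i) z ∧
    pd 1 (fun w => R w i) z = mu i (R z) * pd 0 (fun w => R w i) z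

/-- `u(R)`, `λⁱ(R)`, `μⁱ(R)`, holomorphic on the open set `U` of phase values, form an
`N`-component hydrodynamic reduction of the equation: the two systems of hydrodynamic type are
compatible (they commute), and for all their solutions `R(x, y, t)` the function `u(R(x, y, t))`
solves the equation. -/
structure IsReduction (E : QuadPDE) (D : Set ℂ) {N : ℕ} (U : Set (Fin N → ℂ))
    (u : (Fin N → ℂ) → ℂ) (lam mu : Fin N → (Fin N → ℂ) → ℂ) : Prop where
  isOpen : IsOpen U
  analytic_u : AnalyticOnNhd ℂ u U
  analytic_lam : ∀ i, AnalyticOnNhd ℂ (lam i) U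
  analytic_mu : ∀ i, AnalyticOnNhd ℂ (mu i) U
  mapsTo : Set.MapsTo u U D
  compatible : ∀ R ∈ U, ∀ i j, i ≠ j →
    pd j (lam i) R * (mu j R - mu i R) = pd j (mu i) R * (lam j R - lam i R)
  solves : ∀ (W : Set (Fin 3 → ℂ)) (R : (Fin 3 → ℂ) → (Fin N → ℂ)), IsOpen W →
    AnalyticOnNhd ℂ R W → Set.MapsTo R W U → SolvesHydro lam mu W R →
    E.Holds W fun z => u (R z)

/-- Initial data at `R = 0` for an `N`-component reduction: on the `i`-th coordinate axis of the
space of phases, functions of the one variable `s = Rⁱ`, namely the value `f i s` of `u` and the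
characteristic speeds `λⁱ = l i s`, `μⁱ = m i s`, which are restricted only by the dispersion
relation. The phases enter effectively (`∂u/∂Rⁱ ≠ 0`) and have distinct characteristic
velocities. Up to the reparametrisations `Rⁱ → ψⁱ(Rⁱ)`, which can be used to fix the functions
`f i`, these data amount to `N` arbitrary functions of one variable. -/
structure IsInitialData (E : QuadPDE) (D : Set ℂ) {N : ℕ} (u₀ : ℂ) (f l m : Fin N → ℂ → ℂ) :
    Prop where
  mem : u₀ ∈ D
  analytic_f : ∀ i, AnalyticAt ℂ (f i) 0
  analytic_l : ∀ i, AnalyticAt ℂ (l i) 0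
  analytic_m : ∀ i, AnalyticAt ℂ (m i) 0
  value : ∀ i, f i 0 = u₀
  effective : ∀ i, deriv (f i) 0 ≠ 0
  dispersion_eq : ∀ i, ∀ᶠ s in 𝓝 0, E.dispersion (f i s) (l i s) (m i s) = 0
  distinct : ∀ i j, i ≠ j → (l i 0, m i 0) ≠ (l j 0, m j 0)

/-- Integrability by the method of hydrodynamic reductions: for every number `N` of phases the
equation has `N`-component reductions parametrised by `N` arbitrary functions of one variable, that
is, every system of initial data extends to a reduction near `R = 0`. -/
def Integrable (E : QuadPDE) (D : Set ℂ) : Prop :=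
  ∀ (N : ℕ) (u₀ : ℂ) (f l m : Fin N → ℂ → ℂ), E.IsInitialData D u₀ f l m →
    ∃ (U : Set (Fin N → ℂ)) (u : (Fin N → ℂ) → ℂ) (lam mu : Fin N → (Fin N → ℂ) → ℂ),
      0 ∈ U ∧ E.IsReduction D U u lam mu ∧
      ∀ i, ∀ᶠ s in 𝓝 (0 : ℂ), u (Pi.single i s) = f i s ∧
        lam i (Pi.single i s) = l i s ∧ mu i (Pi.single i s) = m i s

/-- Near the value `u₀` of `u`, the equation `E` is carried to the equation `F`, near some value
`w₀ ∈ D'`, by an invertible complex linear change of `x, y, t` with matrix `S` and a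
(locally biholomorphic) change `u = φ(w)`. The linear change acts on the coefficient matrix by
congruence; additive constants `C` in the coefficient functions do not affect an equation, and
multiplication of an equation by a nonzero constant is included as a scaling of `S`. -/
def LocallyEquivalent (E : QuadPDE) (u₀ : ℂ) (F : QuadPDE) (D' : Set ℂ) : Prop :=
  ∃ (S C : Matrix (Fin 3) (Fin 3) ℂ) (φ : ℂ → ℂ) (w₀ : ℂ),
    S.det ≠ 0 ∧ w₀ ∈ D' ∧ AnalyticAt ℂ φ w₀ ∧ φ w₀ = u₀ ∧ deriv φ w₀ ≠ 0 ∧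
    ∀ᶠ w in 𝓝 w₀, F.coeffMatrix w = S * E.coeffMatrix (φ w) * S.transpose + C

/-- `u_xx + u_yy - g(u)_yy - g(u)_tt = 0`, `g(u) = ln (1 - eᵘ)`. -/
noncomputable def form₁ : QuadPDE where
  a u := u
  b u := u - Complex.log (1 - Complex.exp u)
  c u := -Complex.log (1 - Complex.exp u)
  p _ := 0
  q _ := 0
  r _ := 0

/-- `u_xx + u_yy + (eᵘ)_tt = 0` (Boyer–Finley). -/
noncomputable def form₂ : QuadPDE where
  a u := u
  b u := u
  c u := Complex.exp u
  p _ := 0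
  q _ := 0
  r _ := 0

/-- `(eᵘ - u)_xx + 2 u_xy + (eᵘ)_tt = 0`. -/
noncomputable def form₃ : QuadPDE where
  a u := Complex.exp u - u
  b _ := 0
  c u := Complex.exp u
  p u := u
  q _ := 0
  r _ := 0

/-- `u_xt - (u u_x)_x - u_yy = 0` (dKP). -/
noncomputable def form₄ : QuadPDE where
  a u := -(u ^ 2 / 2)
  b u := -u
  c _ := 0
  p _ := 0
  q u := u / 2
  r _ := 0

/-- `(u²)_xy + u_yy + 2 u_xt = 0`. -/
noncomputable def form₅ : QuadPDE where
  a _ := 0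
  b u := u
  c _ := 0
  p u := u ^ 2 / 2
  q u := u
  r _ := 0

/-- The five canonical forms. -/
noncomputable def canonicalForm : Fin 5 → QuadPDE := ![form₁, form₂, form₃, form₄, form₅]

/-- The domains of the canonical forms: for the first one, where the principal branch of
`ln (1 - eᵘ)` is holomorphic; for the others, the whole plane. -/
def canonicalDomain : Fin 5 → Set ℂ :=
  ![{u | 1 - Complex.exp u ∈ Complex.slitPlane}, Set.univ, Set.univ, Set.univ, Set.univ]

end QuadPDE

/-! Write `X_i = (1, μⁱ, λⁱ)` and `v_i = ∂u/∂Rⁱ`. On a solution of the hydrodynamic systems the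
left-hand side of the equation is the sum of the terms `V(X_i, X_i) v_i Rⁱ_xx` and a quadratic form
in the `Rⁱ_x` (`lhs_hydro`). Its vanishing amounts to the dispersion relation `V(X_i, X_i) = 0`
together with the Gibbons–Tsarev system: for `i ≠ j`, `∂_j X_i = -v_j V'(X_i, X_i) / (2 V(X_i, X_j))
(X_j - X_i)` and `∂_j v_i = -V'(X_i, X_j) / V(X_i, X_j) v_i v_j`.

Let `ω = (ln det V)'`. Jacobi's formula, read in the Gram matrices of three null vectors, is what
brings `ω` into the mixed derivatives (`rate_sub_tripleRate`). Their equality says that `(V'' - ω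
V')(X_i, X_i) = 0` and that `(V'' - ω V')(X_i, X_j) / V(X_i, X_j)` is the same for all pairs. Three
distinct null vectors form a basis, so this is `V'' = ω V' + k V` (`ode_of_solution`).

For necessity, three phases suffice. Simple waves of a reduction force the dispersion relation,
double waves force the equation for `∂_j v_i`, and the remaining equations come from commutativity
and from differentiating the dispersion relation (`ode_of_integrable`). For sufficiency, the
Gibbons–Tsarev system must be solved with data on the coordinate axes, although it is in involution
only modulo the dispersion relation. The system is contracted with the Euler field, which leaves a
determined integral equation along rays; the implicit function theorem in a space of continuous
functions solves it analytically (`exists_euler_solution`). The defects of the full system and of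
the constraints then satisfy a linear radial problem that halves any bound on a small ball, hence
they vanish (`involutive_of_radial`).

For the classification, the criterion makes every Wronskian of two entries of `V` a constant
multiple of `det V` (Abel). Hence the curve `V` lies in a plane, with coordinates whose Wronskian is
again a multiple of `det V` (`exists_pencil`). Such a curve is determined, up to congruence and
reparametrisation, by the pencil it spans (`locallyEquivalent_of_pencil`), and regular pencils of
ternary quadratic forms have five normal forms (`exists_hasNormalForm`). These are told apart by the
roots of the determinant and by the presence of an element of rank one. -/

/-! ### Superposition operators on spaces of continuous maps -/

/-- Superposition with an analytic function is analytic on the space of continuous maps of a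
compact space, near the constants. -/
theorem exists_analyticAt_superposition {K G H : Type*} [TopologicalSpace K] [CompactSpace K]
    [NormedAddCommGroup G] [NormedSpace ℂ G] [NormedAddCommGroup H] [NormedSpace ℂ H]
    [CompleteSpace H] {F : G → H} {y₀ : G} (hF : AnalyticAt ℂ F y₀) :
    ∃ Φ : C(K, G) → C(K, H), AnalyticAt ℂ Φ (ContinuousMap.const K y₀) ∧
      ∀ᶠ Z in 𝓝 (ContinuousMap.const K y₀), ∀ s, Φ Z s = F (Z s) := by
  obtain ⟨p, r, hp⟩ := hF
  -- The Taylor series of `F`, applied pointwise. Its coefficients are no larger in norm than those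
  -- of `p`, so the radius of convergence does not shrink.
  let q : FormalMultilinearSeries ℂ C(K, G) C(K, H) := fun n =>
    MultilinearMap.mkContinuous
      { toFun := fun z => ⟨fun s => p n fun i => z i s, by
          have := (p n).cont
          fun_prop⟩
        map_update_add' := by
          intro _ z i x y
          ext s
          have key : ∀ x : C(K, G), (fun j => Function.update z i x j s)
              = Function.update (fun j => z j s) i (x s) := by
            intro x; funext j
            by_cases h : j = i
            · subst h; simp
            · simp [h]
          simp [key]
        map_update_smul' := by
          intro _ z i c x
          ext s
          have key : ∀ x : C(K, G), (fun j => Function.update z i x j s)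
              = Function.update (fun j => z j s) i (x s) := by
            intro x; funext j
            by_cases h : j = i
            · subst h; simp
            · simp [h]
          simp [key] }
      ‖p n‖ (by
        intro z
        refine (ContinuousMap.norm_le _ (by positivity)).2 fun s => ?_
        refine ((p n).le_opNorm _).trans ?_
        gcongr with i
        exact (z i).norm_coe_le_norm s)
  have hq : ∀ n, ‖q n‖ ≤ ‖p n‖ := fun n => MultilinearMap.mkContinuous_norm_le _ (norm_nonneg _) _
  have hrad : p.radius ≤ q.radius := FormalMultilinearSeries.radius_le_of_le (fun {n} => hq n)
  have hpos : 0 < q.radius := lt_of_lt_of_le (lt_of_lt_of_le hp.r_pos hp.r_le) hrad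
  have hqs := q.hasFPowerSeriesOnBall hpos
  refine ⟨fun Z => q.sum (Z - ContinuousMap.const K y₀), ?_, ?_⟩
  · have h0 : AnalyticAt ℂ q.sum (ContinuousMap.const K y₀ - ContinuousMap.const K y₀) := by
      rw [sub_self]; exact hqs.analyticAt
    exact h0.comp (f := fun Z => Z - ContinuousMap.const K y₀) (by fun_prop)
  · have hmem : Metric.eball (ContinuousMap.const K y₀) (min r q.radius) ∈
        𝓝 (ContinuousMap.const K y₀) :=
      Metric.eball_mem_nhds _ (lt_min hp.r_pos hpos)
    filter_upwards [hmem] with Z hZ s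
    have hZ1 : Z - ContinuousMap.const K y₀ ∈ Metric.eball (0 : C(K, G)) q.radius := by
      have := lt_of_lt_of_le (Metric.mem_eball.1 hZ) (min_le_right _ _)
      simpa [edist_eq_enorm_sub] using this
    have hs : Z s - y₀ ∈ Metric.eball (0 : G) r := by
      have h1 := lt_of_lt_of_le (Metric.mem_eball.1 hZ) (min_le_left _ _)
      rw [Metric.mem_eball, edist_eq_enorm_sub, sub_zero]
      rw [edist_eq_enorm_sub] at h1
      refine lt_of_le_of_lt ?_ h1
      rw [enorm_le_iff_norm_le]
      exact (Z - ContinuousMap.const K y₀).norm_coe_le_norm s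
    -- Evaluation at `s` is continuous and linear, so it carries the series of `q` term by term to
    -- that of `p`.
    have e1 := (hqs.hasSum hZ1).mapL (ContinuousMap.evalCLM ℂ s)
    have e2 := hp.hasSum hs
    simp only [zero_add] at e1
    rw [add_sub_cancel] at e2
    exact e1.unique e2

/-! ### Rays in the unit cube and integration along them -/

/-- Multiply by `σ` the coordinates of `R` outside `S`. -/
def partScale {N : ℕ} (S : Finset (Fin N)) (σ : ℂ) (R : Fin N → ℂ) : Fin N → ℂ :=
  fun j => if j ∈ S then R j else σ * R j

namespace RadialGoursat

variable {A : Type*} [Fintype A] {N : ℕ}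

/-- `partScale` on the unit cube. -/
def cubeScale (S : Finset (Fin N)) (σ : unitInterval) (s : Fin N → unitInterval) : Fin N → unitInterval :=
  fun j => if j ∈ S then s j else σ * s j

theorem continuous_cubeScale (S : Finset (Fin N)) :
    Continuous fun x : (Fin N → unitInterval) × ℝ => cubeScale S (Set.projIcc 0 1 zero_le_one x.2) x.1 := by
  refine continuous_pi fun j => ?_
  unfold cubeScale
  by_cases h : j ∈ S
  · simp only [h, if_true]; fun_prop
  · simp only [h, if_false]
    exact (continuous_projIcc.comp continuous_snd).mul (by fun_prop)

/-- The coordinatewise product of a point of the cube and a vector. -/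
def cubeMul (s : Fin N → unitInterval) (R : Fin N → ℂ) : Fin N → ℂ := fun j => ((s j : ℝ) : ℂ) * R j

/-- Integration of the `j`-th component along the rays of `cubeScale`. -/
noncomputable def integrateRay (S : A → Finset (Fin N)) (j : Fin N) :
    C(Fin N → unitInterval, A → Fin N → ℂ) →L[ℂ] C(Fin N → unitInterval, A → ℂ) :=
  LinearMap.mkContinuous
    { toFun := fun Φ => ⟨fun s a => if j ∈ S a then 0 else ((s j : ℝ) : ℂ) *
          ∫ τ in (0 : ℝ)..1, Φ (cubeScale (S a) (Set.projIcc 0 1 zero_le_one τ) s) a j, by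
        refine continuous_pi fun a => ?_
        by_cases h : j ∈ S a
        · simp only [h, if_true]; fun_prop
        · simp only [h, if_false]
          refine Continuous.mul (by fun_prop) ?_
          refine intervalIntegral.continuous_parametric_intervalIntegral_of_continuous' ?_ _ _
          have h1 := Φ.continuous.comp (continuous_cubeScale (S a))
          exact (continuous_apply j).comp ((continuous_apply a).comp h1)⟩
      map_add' := by
        intro Φ Ψ
        ext s a
        have hi : ∀ Φ : C(Fin N → unitInterval, A → Fin N → ℂ), IntervalIntegrable
            (fun τ => Φ (cubeScale (S a) (Set.projIcc 0 1 zero_le_one τ) s) a j)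
            MeasureTheory.volume 0 1 := by
          intro Φ
          refine Continuous.intervalIntegrable ?_ _ _
          have h1 := Φ.continuous.comp ((continuous_cubeScale (S a)).comp (by fun_prop :
            Continuous fun τ : ℝ => (s, τ)))
          exact (continuous_apply j).comp ((continuous_apply a).comp h1)
        by_cases h : j ∈ S a
        · simp [h]
        · simp [h, intervalIntegral.integral_add (hi Φ) (hi Ψ), mul_add]
      map_smul' := by
        intro c Φ
        ext s a
        by_cases h : j ∈ S a
        · simp [h]
        · simp [h]; ring }
    1 (by
      intro Φ
      refine (ContinuousMap.norm_le _ (by positivity)).2 fun s => ?_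
      refine (pi_norm_le_iff_of_nonneg (by positivity)).2 fun a => ?_
      by_cases h : j ∈ S a
      · simp [h]
      · simp only [LinearMap.coe_mk, AddHom.coe_mk, ContinuousMap.coe_mk, h, if_false, norm_mul,
          one_mul]
        have h1 : ‖((s j : ℝ) : ℂ)‖ ≤ 1 := by
          rw [Complex.norm_real, Real.norm_of_nonneg (s j).2.1]; exact (s j).2.2
        have h2 : ‖∫ τ in (0 : ℝ)..1,
            Φ (cubeScale (S a) (Set.projIcc 0 1 zero_le_one τ) s) a j‖ ≤ ‖Φ‖ := by
          have := intervalIntegral.norm_integral_le_of_norm_le_const (a := (0 : ℝ)) (b := 1)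
            (C := ‖Φ‖)
            (f := fun τ => Φ (cubeScale (S a) (Set.projIcc 0 1 zero_le_one τ) s) a j) (by
              intro τ _
              exact ((norm_le_pi_norm _ j).trans (norm_le_pi_norm _ a)).trans
                (Φ.norm_coe_le_norm _))
          simpa using this
        calc _ ≤ 1 * ‖Φ‖ := by gcongr
          _ = _ := one_mul _)

theorem integrateRay_apply (S : A → Finset (Fin N)) (j : Fin N)
    (Φ : C(Fin N → unitInterval, A → Fin N → ℂ)) (s : Fin N → unitInterval) (a : A) :
    integrateRay S j Φ s a = if j ∈ S a then 0 else ((s j : ℝ) : ℂ) *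
      ∫ τ in (0 : ℝ)..1, Φ (cubeScale (S a) (Set.projIcc 0 1 zero_le_one τ) s) a j := rfl

/-- The linear map `R ↦ (s ↦ s R)`. -/
noncomputable def cubeMulL : (Fin N → ℂ) →L[ℂ] C(Fin N → unitInterval, Fin N → ℂ) :=
  LinearMap.toContinuousLinearMap
    { toFun := fun R => ⟨fun s => cubeMul s R, by unfold cubeMul; fun_prop⟩
      map_add' := by intro R R'; ext s j; simp [cubeMul, mul_add]
      map_smul' := by intro c R; ext s j; simp [cubeMul]; ring }

theorem cubeMulL_apply (R : Fin N → ℂ) (s : Fin N → unitInterval) : cubeMulL R s = cubeMul s R := rfl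

theorem norm_cubeMul_le (s : Fin N → unitInterval) (R : Fin N → ℂ) : ‖cubeMul s R‖ ≤ ‖R‖ := by
  refine (pi_norm_le_iff_of_nonneg (norm_nonneg _)).2 fun j => ?_
  have h1 : ‖((s j : ℝ) : ℂ)‖ ≤ 1 := by
    rw [Complex.norm_real, Real.norm_of_nonneg (s j).2.1]; exact (s j).2.2
  rw [cubeMul, norm_mul]
  calc _ ≤ 1 * ‖R‖ := by gcongr; exact norm_le_pi_norm R j
    _ = _ := one_mul _

theorem cubeMul_mul (s t : Fin N → unitInterval) (R : Fin N → ℂ) :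
    cubeMul (s * t) R = cubeMul s (cubeMul t R) := by
  ext j; simp [cubeMul, mul_assoc]

theorem cubeScale_mul (S : Finset (Fin N)) (σ : unitInterval) (s t : Fin N → unitInterval) :
    cubeScale S σ (s * t) = cubeScale S σ s * t := by
  ext j; by_cases h : j ∈ S <;> simp [cubeScale, h, mul_assoc]

theorem cubeMul_cubeScale_one (S : Finset (Fin N)) (σ : unitInterval) (R : Fin N → ℂ) :
    cubeMul (cubeScale S σ 1) R = partScale S ((σ : ℝ) : ℂ) R := by
  ext j; by_cases h : j ∈ S <;> simp [cubeMul, cubeScale, partScale, h]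

theorem cubeScale_cubeScale_one (S : Finset (Fin N)) (σ τ : unitInterval) :
    cubeScale S σ (cubeScale S τ 1) = cubeScale S (σ * τ) 1 := by
  ext j; by_cases h : j ∈ S <;> simp [cubeScale, h]

end RadialGoursat

/-! ### Analytic solution of the radial integral equation -/

/-- Implicit function theorem for a fixed-point equation `Z = P(R) + ∑ j, R_j Q_j(Φ(Z))`. -/
theorem exists_fixedPoint_family {E W : Type*} [NormedAddCommGroup E] [NormedSpace ℂ E]
    [CompleteSpace E] [NormedAddCommGroup W] [NormedSpace ℂ W] {N : ℕ} {P : (Fin N → ℂ) → E}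
    {Φ : E → W} (Q : Fin N → W →L[ℂ] E) (hP : AnalyticAt ℂ P 0) (hΦ : AnalyticAt ℂ Φ (P 0)) :
    ∃ ζ : (Fin N → ℂ) → E, AnalyticAt ℂ ζ 0 ∧ ζ 0 = P 0 ∧
      (∀ᶠ R in 𝓝 0, ζ R = P R + ∑ j, R j • Q j (Φ (ζ R))) ∧
      ∀ᶠ v in 𝓝 ((0 : Fin N → ℂ), P 0), v.2 = P v.1 + ∑ j, v.1 j • Q j (Φ v.2) →
        ζ v.1 = v.2 := by
  set c := P 0 with hc
  set f : (Fin N → ℂ) × E → E := fun v => v.2 - (P v.1 + ∑ j, v.1 j • Q j (Φ v.2)) with hf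
  have hfan : AnalyticAt ℂ f ((0 : Fin N → ℂ), c) := by
    have h1 : AnalyticAt ℂ (fun v : (Fin N → ℂ) × E => Φ v.2) ((0 : Fin N → ℂ), c) :=
      AnalyticAt.comp (g := Φ) (f := Prod.snd) hΦ analyticAt_snd
    have h2 : AnalyticAt ℂ (fun v : (Fin N → ℂ) × E => P v.1) ((0 : Fin N → ℂ), c) :=
      AnalyticAt.comp (g := P) (f := Prod.fst) hP analyticAt_fst
    refine analyticAt_snd.sub (h2.add ?_)
    refine Finset.analyticAt_fun_sum _ fun j _ => ?_
    refine AnalyticAt.fun_smul ?_ (((Q j).analyticAt _).comp h1)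
    exact ((ContinuousLinearMap.proj (R := ℂ) (φ := fun _ : Fin N => ℂ) j).analyticAt _).comp
      analyticAt_fst
  have hfz : ∀ Z, f ((0 : Fin N → ℂ), Z) = Z - c := by
    intro Z; simp [hf, hc]
  have hf0 : f ((0 : Fin N → ℂ), c) = 0 := by rw [hfz, sub_self]
  -- At `R = 0` the integral terms carry the factor `R j = 0`, so the partial derivative in `Z` is
  -- the identity.
  have hder : fderiv ℂ f ((0 : Fin N → ℂ), c) ∘L
      ContinuousLinearMap.inr ℂ (Fin N → ℂ) E = ContinuousLinearMap.id ℂ _ := by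
    have h1 := hfan.differentiableAt.hasFDerivAt.comp c
      (hasFDerivAt_prodMk_right (𝕜 := ℂ) (0 : Fin N → ℂ) c)
    have h2 : HasFDerivAt (f ∘ fun Z => ((0 : Fin N → ℂ), Z)) (ContinuousLinearMap.id ℂ _) c := by
      have : (f ∘ fun Z => ((0 : Fin N → ℂ), Z)) = fun Z => Z - c := funext hfz
      rw [this]; exact (hasFDerivAt_id c).sub_const c
    exact h1.unique h2
  have hinv : (fderiv ℂ f ((0 : Fin N → ℂ), c) ∘L
      ContinuousLinearMap.inr ℂ (Fin N → ℂ) E).IsInvertible := by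
    rw [hder]; exact ⟨ContinuousLinearEquiv.refl ℂ _, rfl⟩
  have hcd : ContDiffAt ℂ ⊤ f ((0 : Fin N → ℂ), c) := hfan.contDiffAt
  have hne : (⊤ : WithTop ℕ∞) ≠ 0 := by simp
  refine ⟨hcd.implicitFunction hne hinv, (hcd.contDiffAt_implicitFunction hne hinv).analyticAt,
    hcd.implicitFunction_apply_self hne hinv, ?_, ?_⟩
  · filter_upwards [hcd.eventually_apply_implicitFunction hne hinv] with R hR
    rw [hf0] at hR
    exact sub_eq_zero.1 hR
  · filter_upwards [hcd.eventually_apply_eq_iff_implicitFunction hne hinv] with v hv h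
    rw [hf0] at hv
    exact hv.1 (sub_eq_zero.2 h)

namespace RadialGoursat

variable {A : Type*} [Fintype A] {N : ℕ}

/-- The right-hand side of the radial integral equation. -/
noncomputable def radialStep (S : A → Finset (Fin N))
    (ΦF : C(Fin N → unitInterval, A → ℂ) → C(Fin N → unitInterval, A → Fin N → ℂ))
    (Φg : C(Fin N → unitInterval, Fin N → ℂ) → C(Fin N → unitInterval, A → ℂ))
    (v : (Fin N → ℂ) × C(Fin N → unitInterval, A → ℂ)) : C(Fin N → unitInterval, A → ℂ) :=
  Φg (cubeMulL v.1) + ∑ j, v.1 j • integrateRay S j (ΦF v.2)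

theorem radialStep_apply (S : A → Finset (Fin N))
    (ΦF : C(Fin N → unitInterval, A → ℂ) → C(Fin N → unitInterval, A → Fin N → ℂ))
    (Φg : C(Fin N → unitInterval, Fin N → ℂ) → C(Fin N → unitInterval, A → ℂ))
    (v : (Fin N → ℂ) × C(Fin N → unitInterval, A → ℂ)) (s : Fin N → unitInterval) (a : A) :
    radialStep S ΦF Φg v s a = Φg (cubeMulL v.1) s a + ∑ j, v.1 j *
      if j ∈ S a then 0 else ((s j : ℝ) : ℂ) *
      ∫ τ in (0 : ℝ)..1, ΦF v.2 (cubeScale (S a) (Set.projIcc 0 1 zero_le_one τ) s) a j := by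
  simp [radialStep, ← integrateRay_apply]

end RadialGoursat

open RadialGoursat in
/-- Existence for the integral equations along rays which express a system
`∂Y_a/∂R_j = F_aj(Y)` (`j ∉ S a`) with data on the coordinate planes `R_j = 0` (`j ∉ S a`). -/
theorem exists_radial_solution {A : Type*} [Fintype A] {N : ℕ} (S : A → Finset (Fin N))
    {F : (A → ℂ) → A → Fin N → ℂ} {g : (Fin N → ℂ) → A → ℂ}
    (hF : AnalyticAt ℂ F (g 0)) (hg : AnalyticAt ℂ g 0)
    (hgS : ∀ a R R', (∀ j ∈ S a, R j = R' j) → g R a = g R' a) :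
    ∃ Y : (Fin N → ℂ) → A → ℂ, AnalyticAt ℂ Y 0 ∧ ∃ ε > 0, ∀ R, ‖R‖ < ε →
      ∀ a, ∀ s ∈ Set.Icc (0 : ℝ) 1, Y (partScale (S a) s R) a = g R a +
        ∑ j ∈ (S a)ᶜ, R j * ∫ τ in (0 : ℝ)..s, F (Y (partScale (S a) τ R)) a j := by
  -- For fixed `R` the unknown is the whole function `s ↦ Y (s R)` on the cube. A single interval
  -- would not do: the ray for the component `a` scales only the coordinates outside `S a`, so
  -- different components are integrated in different directions.
  obtain ⟨ΦF, hΦF, hΦF'⟩ := exists_analyticAt_superposition (K := Fin N → unitInterval) hF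
  obtain ⟨Φg, hΦg, hΦg'⟩ := exists_analyticAt_superposition (K := Fin N → unitInterval) hg
  set c := ContinuousMap.const (Fin N → unitInterval) (g 0) with hc
  have hc0 : ContinuousMap.const (Fin N → unitInterval) (0 : Fin N → ℂ) = cubeMulL 0 := by
    rw [map_zero]; rfl
  rw [hc0] at hΦg hΦg'
  have hΦg0 : Φg (cubeMulL 0) = c := by
    ext s a
    rw [hΦg'.self_of_nhds s]; simp [hc]
  have hPan : AnalyticAt ℂ (fun R => Φg (cubeMulL R)) 0 :=
    AnalyticAt.comp (g := Φg) (f := fun R : Fin N → ℂ => cubeMulL R) hΦg (cubeMulL.analyticAt _)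
  obtain ⟨ζ, hζan, hζ0, hev1, hev2⟩ := exists_fixedPoint_family (P := fun R => Φg (cubeMulL R))
    (Φ := ΦF) (integrateRay S) hPan (by simpa only [hΦg0] using hΦF)
  simp only [hΦg0] at hζ0 hev2
  obtain ⟨δ₁, hδ₁, H1⟩ := Metric.eventually_nhds_iff.1 hev1
  obtain ⟨δ₂, hδ₂, H2⟩ := Metric.eventually_nhds_iff.1 hev2
  obtain ⟨δ₃, hδ₃, H3⟩ := Metric.eventually_nhds_iff.1 hΦF'
  obtain ⟨δ₄, hδ₄, H4⟩ := Metric.eventually_nhds_iff.1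
    (cubeMulL.continuous.continuousAt.eventually hΦg')
  have hζc : ∀ᶠ R in 𝓝 (0 : Fin N → ℂ), dist (ζ R) c < min δ₂ δ₃ := by
    have h1 := hζan.continuousAt.eventually (Metric.ball_mem_nhds _ (lt_min hδ₂ hδ₃))
    rw [hζ0] at h1; exact h1
  obtain ⟨δ₅, hδ₅, H5⟩ := Metric.eventually_nhds_iff.1 hζc
  obtain ⟨δ₆, hδ₆, H6⟩ := Metric.eventually_nhds_iff.1 hζan.eventually_analyticAt
  set ε := min (min δ₁ δ₂) (min δ₄ (min δ₅ δ₆)) with hε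
  have hεpos : 0 < ε := by positivity
  have hsol : ∀ R, ‖R‖ < ε → ∀ (s : Fin N → unitInterval) a, ζ R s a = g (cubeMul s R) a +
      ∑ j, R j * if j ∈ S a then 0 else ((s j : ℝ) : ℂ) *
      ∫ τ in (0 : ℝ)..1, F (ζ R (cubeScale (S a) (Set.projIcc 0 1 zero_le_one τ) s)) a j := by
    intro R hR s a
    simp only [hε, lt_min_iff] at hR
    obtain ⟨⟨r1, r2⟩, r4, r5, r6⟩ := hR
    have e := congrArg (fun Z : C(Fin N → unitInterval, A → ℂ) => Z s a)
      (H1 (y := R) (by simpa using r1))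
    change _ = radialStep S ΦF Φg (R, ζ R) s a at e
    simp only [radialStep_apply] at e
    rw [e, H4 (y := R) (by simpa using r4) s, cubeMulL_apply]
    simp only [H3 ((H5 (y := R) (by simpa using r5)).trans_le (min_le_right _ _))]
  -- The map `s ↦ ζ R (s * t)` solves the fixed-point equation with parameter `cubeMul t R`, and
  -- local uniqueness identifies it with `ζ (cubeMul t R)`. So the family comes from one function of
  -- `R`, its value at the corner `1` of the cube.
  have hscale : ∀ R, ‖R‖ < ε → ∀ t : Fin N → unitInterval, ζ R t = ζ (cubeMul t R) 1 := by
    intro R hR t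
    have hR' : ‖cubeMul t R‖ < ε := (norm_cubeMul_le t R).trans_lt hR
    have hs := hsol R hR
    simp only [hε, lt_min_iff] at hR hR'
    obtain ⟨⟨r1, r2⟩, r4, r5, r6⟩ := hR
    obtain ⟨⟨r1', r2'⟩, r4', r5', r6'⟩ := hR'
    set Z' : C(Fin N → unitInterval, A → ℂ) := ⟨fun s => ζ R (s * t), by fun_prop⟩ with hZ'
    have hdist : dist Z' c < min δ₂ δ₃ := by
      refine lt_of_le_of_lt ?_ (H5 (y := R) (by simpa using r5))
      refine (ContinuousMap.dist_le dist_nonneg).2 fun s => ?_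
      exact ContinuousMap.dist_apply_le_dist (f := ζ R) (g := c) (s * t)
    have hz : Z' = radialStep S ΦF Φg (cubeMul t R, Z') := by
      ext s a
      rw [radialStep_apply, H4 (y := cubeMul t R) (by simpa using r4') s, cubeMulL_apply]
      simp only [H3 (hdist.trans_le (min_le_right _ _))]
      simp only [hZ', ContinuousMap.coe_mk]
      rw [hs (s * t) a, cubeMul_mul]
      congr 1
      refine Finset.sum_congr rfl fun j _ => ?_
      by_cases h : j ∈ S a
      · simp [h]
      · simp only [h, if_false, cubeScale_mul, Pi.mul_apply, Set.Icc.coe_mul, Complex.ofReal_mul,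
          cubeMul]
        ring
    have h2 := (H2 (y := (cubeMul t R, Z')) (by
      rw [Prod.dist_eq, max_lt_iff]
      exact ⟨by simpa using r2', hdist.trans_le (min_le_left _ _)⟩)) hz
    have h3 := congrArg (fun Z : C(Fin N → unitInterval, A → ℂ) => Z 1) h2
    simp only [hZ', ContinuousMap.coe_mk, one_mul] at h3
    exact h3.symm
  refine ⟨fun R => ζ R 1, ?_, ε, hεpos, ?_⟩
  · exact ((ContinuousMap.evalCLM ℂ (1 : Fin N → unitInterval)).analyticAt _).comp hζan
  · intro R hR a s hs
    have hpart : ∀ τ ∈ Set.Icc (0 : ℝ) 1, ζ (partScale (S a) τ R) 1 =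
        ζ R (cubeScale (S a) (Set.projIcc 0 1 zero_le_one τ) 1) := by
      intro τ hτ
      rw [hscale R hR, cubeMul_cubeScale_one, Set.projIcc_of_mem _ hτ]
    have e := hsol R hR (cubeScale (S a) (Set.projIcc 0 1 zero_le_one s) 1) a
    simp only [hpart s hs, e]
    congr 1
    · apply hgS
      intro j hj
      simp [cubeMul, cubeScale, hj]
    · rw [← Finset.sum_subset (Finset.subset_univ (S a)ᶜ) (by
        intro j _ hj
        rw [Finset.mem_compl, not_not] at hj
        simp [hj])]
      refine Finset.sum_congr rfl fun j hj => ?_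
      rw [Finset.mem_compl] at hj
      simp only [hj, if_false, cubeScale_cubeScale_one]
      congr 1
      -- The substitution `τ ↦ s τ` turns the integral over the whole ray of the scaled point into
      -- an integral over `[0, s]`.
      have h1 := intervalIntegral.smul_integral_comp_mul_left (a := 0) (b := 1)
        (fun τ => F (ζ R (cubeScale (S a) (Set.projIcc 0 1 zero_le_one τ) 1)) a j) s
      simp only [mul_zero, mul_one] at h1
      have h2 : ∫ τ in (0 : ℝ)..s, F (ζ (partScale (S a) τ R) 1) a j =
          ∫ τ in (0 : ℝ)..s, F (ζ R (cubeScale (S a) (Set.projIcc 0 1 zero_le_one τ) 1)) a j := by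
        refine intervalIntegral.integral_congr fun τ hτ => ?_
        rw [Set.uIcc_of_le hs.1] at hτ
        simp only [hpart τ ⟨hτ.1, hτ.2.trans hs.2⟩]
      rw [h2, ← h1, Complex.real_smul]
      congr 1
      · simp [cubeScale, hj, Set.projIcc_of_mem _ hs]
      · refine intervalIntegral.integral_congr fun τ hτ => ?_
        rw [Set.uIcc_of_le zero_le_one] at hτ
        have hm : s * τ ∈ Set.Icc (0 : ℝ) 1 :=
          ⟨mul_nonneg hs.1 hτ.1, mul_le_one₀ hs.2 hτ.1 hτ.2⟩
        have : (Set.projIcc 0 1 zero_le_one τ : unitInterval) * Set.projIcc 0 1 zero_le_one s =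
            Set.projIcc 0 1 zero_le_one (s * τ) := by
          rw [Set.projIcc_of_mem _ hs, Set.projIcc_of_mem _ hτ, Set.projIcc_of_mem _ hm]
          ext; simp [mul_comm]
        simp only [this]

/-! ### Estimates along rays and rules for partial derivatives -/

theorem partScale_one {N : ℕ} (S : Finset (Fin N)) (R : Fin N → ℂ) : partScale S 1 R = R := by
  ext j; simp [partScale]

theorem norm_partScale_le {N : ℕ} (S : Finset (Fin N)) {σ : ℂ} (hσ : ‖σ‖ ≤ 1) (R : Fin N → ℂ) :
    ‖partScale S σ R‖ ≤ ‖R‖ := by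
  refine (pi_norm_le_iff_of_nonneg (norm_nonneg _)).2 fun j => ?_
  unfold partScale
  split_ifs
  · exact norm_le_pi_norm R j
  · rw [norm_mul]
    calc _ ≤ 1 * ‖R‖ := by gcongr; exact norm_le_pi_norm R j
      _ = _ := one_mul _

theorem fderiv_apply_eq_sum_pd {N : ℕ} (f : (Fin N → ℂ) → ℂ) (R v : Fin N → ℂ) :
    fderiv ℂ f R v = ∑ j, v j * pd j f R := by
  conv_lhs => rw [pi_eq_sum_univ' v]
  simp [map_sum, pd]

theorem hasDerivAt_partScale {N : ℕ} (S : Finset (Fin N)) {e : (Fin N → ℂ) → ℂ} {R : Fin N → ℂ}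
    {s : ℝ} (he : DifferentiableAt ℂ e (partScale S s R)) :
    HasDerivAt (fun s : ℝ => e (partScale S s R))
      (∑ j ∈ Sᶜ, R j * pd j e (partScale S s R)) s := by
  have h1 : HasDerivAt (fun s : ℝ => partScale S s R) (fun j => if j ∈ S then 0 else R j) s := by
    refine hasDerivAt_pi.2 fun j => ?_
    by_cases h : j ∈ S
    · simpa [partScale, h] using hasDerivAt_const s (R j)
    · simpa [partScale, h] using (Complex.ofRealCLM.hasDerivAt (x := s)).mul_const (R j)
  have h2 := (he.hasFDerivAt.restrictScalars ℝ).comp_hasDerivAt s h1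
  refine h2.congr_deriv ?_
  simp only [ContinuousLinearMap.coe_restrictScalars', fderiv_apply_eq_sum_pd]
  rw [← Finset.sum_subset (Finset.subset_univ Sᶜ) (by
    intro j _ hj
    rw [Finset.mem_compl, not_not] at hj
    simp [hj])]
  refine Finset.sum_congr rfl fun j hj => ?_
  rw [Finset.mem_compl] at hj
  simp [hj]

/-- Integration along the rays of `partScale`: bound for the solution of a first-order equation
for the Euler operator. -/
theorem norm_le_of_euler_eq {N : ℕ} (S : Finset (Fin N)) {κ : ℕ} {e : (Fin N → ℂ) → ℂ}
    {m : Fin N → (Fin N → ℂ) → ℂ} {r K : ℝ} (hK : 0 ≤ K)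
    (he : ∀ R, ‖R‖ < r → DifferentiableAt ℂ e R)
    (h : ∀ R, ‖R‖ < r → κ * e R + ∑ j ∈ Sᶜ, R j * pd j e R = ∑ j ∈ Sᶜ, R j * m j R)
    (hm : ∀ j ∉ S, ∀ R, ‖R‖ < r → ‖m j R‖ ≤ K)
    (h0 : κ = 0 → ∀ R, ‖R‖ < r → (∀ j ∉ S, R j = 0) → e R = 0) :
    ∀ R, ‖R‖ < r → ‖e R‖ ≤ N * r * K := by
  intro R hR
  have hr : 0 < r := (norm_nonneg _).trans_lt hR
  have hin : ∀ s ∈ Set.Icc (0 : ℝ) 1, ‖partScale S s R‖ < r := fun s hs =>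
    (norm_partScale_le S (by rw [Complex.norm_real, Real.norm_of_nonneg hs.1]; exact hs.2)
      R).trans_lt hR
  -- The factor `s ^ κ` is integrating: along the ray the derivative of `f` becomes `s ^ κ` times
  -- the right-hand side with `R j` frozen.
  set f : ℝ → ℂ := fun s => (s : ℂ) ^ κ * e (partScale S s R) with hf
  have hder : ∀ s ∈ Set.Icc (0 : ℝ) 1, HasDerivAt f (κ * (s : ℂ) ^ (κ - 1) * e (partScale S s R) +
      (s : ℂ) ^ κ * ∑ j ∈ Sᶜ, R j * pd j e (partScale S s R)) s := by
    intro s hs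
    have h1 : HasDerivAt (fun s : ℝ => (s : ℂ) ^ κ) (κ * (s : ℂ) ^ (κ - 1)) s := by
      simpa using (Complex.ofRealCLM.hasDerivAt (x := s)).fun_pow κ
    exact h1.mul (hasDerivAt_partScale S (he _ (hin s hs)))
  have hbound : ∀ s ∈ Set.Ioc (0 : ℝ) 1, ‖κ * (s : ℂ) ^ (κ - 1) * e (partScale S s R) +
      (s : ℂ) ^ κ * ∑ j ∈ Sᶜ, R j * pd j e (partScale S s R)‖ ≤ N * r * K := by
    intro s hs
    have hsI : s ∈ Set.Icc (0 : ℝ) 1 := ⟨hs.1.le, hs.2⟩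
    have hs0 : (s : ℂ) ≠ 0 := by exact_mod_cast hs.1.ne'
    have e1 := h _ (hin s hsI)
    have e2 : ∀ G : Fin N → ℂ, ∑ j ∈ Sᶜ, partScale S s R j * G j = s * ∑ j ∈ Sᶜ, R j * G j := by
      intro G
      rw [Finset.mul_sum]
      refine Finset.sum_congr rfl fun j hj => ?_
      rw [Finset.mem_compl] at hj
      simp [partScale, hj, mul_assoc]
    rw [e2, e2] at e1
    have e3 : κ * (s : ℂ) ^ (κ - 1) * e (partScale S s R) +
        (s : ℂ) ^ κ * ∑ j ∈ Sᶜ, R j * pd j e (partScale S s R) =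
        (s : ℂ) ^ κ * ∑ j ∈ Sᶜ, R j * m j (partScale S s R) := by
      apply mul_left_cancel₀ hs0
      have : (s : ℂ) * (κ * (s : ℂ) ^ (κ - 1)) = κ * (s : ℂ) ^ κ := by
        rcases κ with _ | κ
        · simp
        · simp [pow_succ]; ring
      linear_combination (e (partScale S s R)) * this + (s : ℂ) ^ κ * e1
    rw [e3, norm_mul, norm_pow, Complex.norm_real, Real.norm_of_nonneg hs.1.le]
    have h4 : ‖∑ j ∈ Sᶜ, R j * m j (partScale S s R)‖ ≤ N * (r * K) := by
      refine (norm_sum_le _ _).trans ?_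
      calc _ ≤ ∑ j ∈ Sᶜ, r * K := by
            refine Finset.sum_le_sum fun j hj => ?_
            rw [norm_mul]
            gcongr
            · exact (norm_le_pi_norm R j).trans hR.le
            · exact hm j (Finset.mem_compl.1 hj) _ (hin s hsI)
        _ = (Sᶜ : Finset (Fin N)).card * (r * K) := by rw [Finset.sum_const, nsmul_eq_mul]
        _ ≤ _ := by
            gcongr
            exact (Finset.card_le_univ _).trans_eq (Fintype.card_fin N)
    calc s ^ κ * _ ≤ 1 * (N * (r * K)) := by
          gcongr
          exact pow_le_one₀ hs.1.le hs.2
      _ = _ := by ring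
  have hf1 : f 1 = e R := by simp [hf, partScale_one]
  have hf0 : f 0 = 0 := by
    rcases Nat.eq_zero_or_pos κ with hκ | hκ
    · have := h0 hκ (partScale S (0 : ℝ) R) (hin 0 (by simp)) (fun j hj => by simp [partScale, hj])
      simp only [hf, this, mul_zero]
    · simp [hf, hκ.ne']
  -- The derivative bound needs a division by `s`, so the mean value inequality is used on `(0, 1]`
  -- and the value at `0` is reached by continuity.
  have hmv : ∀ x ∈ Set.Ioc (0 : ℝ) 1, ‖f 1 - f x‖ ≤ N * r * K := by
    intro x hx
    have h1 := Convex.norm_image_sub_le_of_norm_hasDerivWithin_le (s := Set.Ioc (0 : ℝ) 1)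
      (fun s hs => (hder s ⟨hs.1.le, hs.2⟩).hasDerivWithinAt) hbound (convex_Ioc 0 1) hx
      (by simp : (1 : ℝ) ∈ Set.Ioc (0 : ℝ) 1)
    refine h1.trans ?_
    have h2 : ‖1 - x‖ ≤ 1 := by
      rw [Real.norm_eq_abs, abs_le]; constructor <;> linarith [hx.1, hx.2]
    calc _ ≤ N * r * K * 1 := by gcongr
      _ = _ := mul_one _
  have hlim : Tendsto (fun x => ‖f 1 - f x‖) (𝓝[>] 0) (𝓝 ‖f 1 - f 0‖) := by
    have hc : ContinuousAt f 0 := (hder 0 (by simp)).continuousAt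
    exact ((continuousAt_const.sub hc).norm).tendsto.mono_left nhdsWithin_le_nhds
  rw [hf1, hf0, sub_zero] at hlim
  refine le_of_tendsto hlim ?_
  filter_upwards [Ioc_mem_nhdsGT (zero_lt_one' ℝ)] with x hx
  rw [← hf1]; exact hmv x hx

theorem exists_norm_le_of_continuousAt {X ι : Type*} [TopologicalSpace X] [Finite ι] {x : X}
    {f : ι → X → ℂ} (hf : ∀ i, ContinuousAt (f i) x) :
    ∃ K, 0 ≤ K ∧ ∀ᶠ y in 𝓝 x, ∀ i, ‖f i y‖ ≤ K := by
  cases nonempty_fintype ι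
  refine ⟨∑ i, (‖f i x‖ + 1), Finset.sum_nonneg fun i _ => by positivity, ?_⟩
  refine eventually_all.2 fun i => ?_
  have h1 : ∀ᶠ y in 𝓝 x, ‖f i y‖ < ‖f i x‖ + 1 :=
    (hf i).norm.eventually (gt_mem_nhds (by simp))
  filter_upwards [h1] with y hy
  exact hy.le.trans (Finset.single_le_sum (f := fun i => ‖f i x‖ + 1)
    (fun i _ => by positivity) (Finset.mem_univ i))

theorem AnalyticAt.pd {N : ℕ} {f : (Fin N → ℂ) → ℂ} {R : Fin N → ℂ} (hf : AnalyticAt ℂ f R)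
    (j : Fin N) : AnalyticAt ℂ (pd j f) R :=
  ((ContinuousLinearMap.apply ℂ ℂ (Pi.single j (1 : ℂ) : Fin N → ℂ)).analyticAt _).comp hf.fderiv

theorem pd_comm {N : ℕ} {f : (Fin N → ℂ) → ℂ} {R : Fin N → ℂ} (hf : AnalyticAt ℂ f R)
    (j k : Fin N) : pd j (pd k f) R = pd k (pd j f) R := by
  have h1 : ∀ i l : Fin N, pd i (pd l f) R =
      fderiv ℂ (fderiv ℂ f) R (Pi.single i 1) (Pi.single l 1) := by
    intro i l
    have h := (ContinuousLinearMap.apply ℂ ℂ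
      (Pi.single l (1 : ℂ) : Fin N → ℂ)).hasFDerivAt.comp R hf.fderiv.differentiableAt.hasFDerivAt
    exact congrArg (fun L => L (Pi.single i 1)) h.fderiv
  rw [h1, h1]
  refine (ContDiffAt.isSymmSndFDerivAt (n := ⊤) hf.contDiffAt ?_) _ _
  simp

theorem pd_congr {N : ℕ} {f g : (Fin N → ℂ) → ℂ} {R : Fin N → ℂ} (h : f =ᶠ[𝓝 R] g) (j : Fin N) :
    pd j f R = pd j g R := by
  unfold pd; rw [h.fderiv_eq]

theorem pd_comp {N : ℕ} {A : Type*} [Fintype A] {G : (A → ℂ) → ℂ} {Y : (Fin N → ℂ) → A → ℂ}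
    {R : Fin N → ℂ} (hG : DifferentiableAt ℂ G (Y R)) (hY : DifferentiableAt ℂ Y R) (j : Fin N) :
    pd j (fun R => G (Y R)) R = fderiv ℂ G (Y R) (fun a => pd j (fun R => Y R a) R) := by
  have h := hG.hasFDerivAt.comp R hY.hasFDerivAt
  have h2 : (fun a => pd j (fun R => Y R a) R) = fderiv ℂ Y R (Pi.single j 1) := by
    funext a
    have := (hasFDerivAt_pi'.1 hY.hasFDerivAt a).fderiv
    unfold pd
    rw [this]; rfl
  rw [h2]
  exact congrArg (fun L => L (Pi.single j 1)) h.fderiv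

theorem fderiv_apply_eq_add_sum {A : Type*} [Fintype A] [DecidableEq A] (L : (A → ℂ) →L[ℂ] ℂ)
    (v w : A → ℂ) : L v = L w + ∑ b, (v b - w b) * L (Pi.single b 1) := by
  have h : v = w + ∑ b, (v b - w b) • (Pi.single b 1 : A → ℂ) := by
    have := pi_eq_sum_univ' (v - w)
    simp only [Pi.sub_apply] at this
    rw [← this, add_sub_cancel]
  conv_lhs => rw [h]
  simp [map_add, map_sum]

/-! ### From the radial equation to the full system -/

/-- A solution of the equations along rays of a system `∂Y_a/∂R_j = F_aj(Y)`, `j ∉ S a`, in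
involution modulo constraints `c_b(Y) = 0`, satisfies the full system and the constraints. -/
theorem involutive_of_radial {A B : Type*} [Fintype A] [DecidableEq A] [Fintype B] {N : ℕ}
    (S : A → Finset (Fin N)) (T : B → Finset (Fin N)) {F : (A → ℂ) → A → Fin N → ℂ}
    {c : B → (A → ℂ) → ℂ} {Y : (Fin N → ℂ) → A → ℂ} (hY : AnalyticAt ℂ Y 0)
    (hF : AnalyticAt ℂ F (Y 0)) (hc : ∀ b, AnalyticAt ℂ (c b) (Y 0))
    (hrad : ∀ᶠ R in 𝓝 0, ∀ a,
      ∑ j ∈ (S a)ᶜ, R j * (pd j (fun R => Y R a) R - F (Y R) a j) = 0)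
    (hdep : ∀ᶠ y in 𝓝 (Y 0), ∀ a b j k, j ∉ S a → k ∉ S a → j ≠ k → k ∈ S b →
      fderiv ℂ (fun y => F y a j) y (Pi.single b 1) = 0)
    (hcomp : ∃ K, ∀ᶠ y in 𝓝 (Y 0), ∀ a j k, j ∉ S a → k ∉ S a → j ≠ k →
      ‖fderiv ℂ (fun y => F y a k) y (fun b => F y b j) -
        fderiv ℂ (fun y => F y a j) y (fun b => F y b k)‖ ≤ K * ∑ b, ‖c b y‖)
    (hdepc : ∀ᶠ y in 𝓝 (Y 0), ∀ b a j, j ∉ T b → j ∈ S a →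
      fderiv ℂ (c b) y (Pi.single a 1) = 0)
    (hinv : ∃ K, ∀ᶠ y in 𝓝 (Y 0), ∀ b j, j ∉ T b →
      ‖fderiv ℂ (c b) y (fun a => F y a j)‖ ≤ K * ∑ b, ‖c b y‖)
    (hinit : ∀ᶠ R in 𝓝 0, ∀ b, (∀ j ∉ T b, R j = 0) → c b (Y R) = 0) :
    ∀ᶠ R in 𝓝 0, (∀ a, ∀ j ∉ S a, pd j (fun R => Y R a) R = F (Y R) a j) ∧
      ∀ b, c b (Y R) = 0 := by
  obtain ⟨K₁, hK₁⟩ := hcomp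
  obtain ⟨K₂, hK₂⟩ := hinv
  have hFa : ∀ a j, AnalyticAt ℂ (fun y => F y a j) (Y 0) := fun a j =>
    ((ContinuousLinearMap.proj (R := ℂ) (φ := fun _ : Fin N => ℂ) j).analyticAt _).comp
      (((ContinuousLinearMap.proj (R := ℂ) (φ := fun _ : A => Fin N → ℂ) a).analyticAt _).comp hF)
  have hYa : ∀ a, AnalyticAt ℂ (fun R => Y R a) 0 := fun a =>
    ((ContinuousLinearMap.proj (R := ℂ) (φ := fun _ : A => ℂ) a).analyticAt _).comp hY
  have hder : ∀ {G : (A → ℂ) → ℂ} (b : A), AnalyticAt ℂ G (Y 0) →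
      ContinuousAt (fun y => fderiv ℂ G y (Pi.single b 1)) (Y 0) := fun {G} b hG =>
    ((ContinuousLinearMap.apply ℂ ℂ (Pi.single b (1 : ℂ) : A → ℂ)).continuous.continuousAt).comp
      hG.fderiv.continuousAt
  obtain ⟨K₃, hK₃0, hK₃⟩ := exists_norm_le_of_continuousAt
    (f := fun (i : A × Fin N × A) y => fderiv ℂ (fun y => F y i.1 i.2.1) y (Pi.single i.2.2 1))
    (fun i => hder _ (hFa _ _))
  obtain ⟨K₄, hK₄0, hK₄⟩ := exists_norm_le_of_continuousAt
    (f := fun (i : B × A) y => fderiv ℂ (c i.1) y (Pi.single i.2 1))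
    (fun i => hder _ (hc _))
  set E : A → Fin N → (Fin N → ℂ) → ℂ := fun a j R => pd j (fun R => Y R a) R - F (Y R) a j with hE
  have hEan : ∀ a j, AnalyticAt ℂ (E a j) 0 := fun a j => by
    refine ((hYa a).pd j).sub ?_
    exact AnalyticAt.comp (g := fun y => F y a j) (hFa a j) hY
  have hCan : ∀ b, AnalyticAt ℂ (fun R => c b (Y R)) 0 := fun b =>
    AnalyticAt.comp (g := c b) (hc b) hY
  obtain ⟨M₁, hM₁0, hM₁⟩ := exists_norm_le_of_continuousAt (f := fun (i : A × Fin N) => E i.1 i.2)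
    (fun i => (hEan _ _).continuousAt)
  obtain ⟨M₂, hM₂0, hM₂⟩ := exists_norm_le_of_continuousAt (f := fun b R => c b (Y R))
    (fun i => (hCan _).continuousAt)
  have hev := (hrad.eventually_nhds.and ((eventually_all.2 fun a => (hYa a).eventually_analyticAt).and
    ((eventually_all.2 fun a => eventually_all.2 fun j => (hEan a j).eventually_analyticAt).and
    ((eventually_all.2 fun b => (hCan b).eventually_analyticAt).and
    (hinit.and (hM₁.and hM₂)))))).and
    ((hY.eventually_analyticAt).and (hY.continuousAt.eventually
    ((eventually_all.2 fun a => eventually_all.2 fun j => (hFa a j).eventually_analyticAt).and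
    ((eventually_all.2 fun b => (hc b).eventually_analyticAt).and
    (hdep.and (hK₁.and (hdepc.and (hK₂.and (hK₃.and hK₄)))))))))
  obtain ⟨r₀, hr₀, H⟩ := Metric.eventually_nhds_iff.1 hev
  clear hev hrad hinit hM₁ hM₂ hdep hK₁ hdepc hK₂ hK₃ hK₄
  set nA : ℝ := (Fintype.card A : ℝ) with hnA
  set nB : ℝ := (Fintype.card B : ℝ) with hnB
  set K : ℝ := |K₁| * nB + 2 * (nA * K₃) + |K₂| * nB + nA * K₄ with hK
  have hK0 : 0 ≤ K := by positivity
  -- The radius is chosen so that one radial integration, which costs the factor `N r K`, halves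
  -- every bound.
  set r : ℝ := min r₀ (1 / (2 * (N * K + 1))) with hr
  have hrpos : 0 < r := by positivity
  have hNK : N * r * K ≤ 1 / 2 := by
    have h1 : r ≤ 1 / (2 * (N * K + 1)) := min_le_right _ _
    have h2 : 0 < N * K + 1 := by positivity
    have h3 : r * (2 * (N * K + 1)) ≤ 1 := (le_div_iff₀ (by positivity)).1 h1
    nlinarith [hrpos.le]
  have hstep : ∀ M, 0 ≤ M → (∀ R, ‖R‖ < r → (∀ a, ∀ j ∉ S a, ‖E a j R‖ ≤ M) ∧
      ∀ b, ‖c b (Y R)‖ ≤ M) → ∀ R, ‖R‖ < r → (∀ a, ∀ j ∉ S a, ‖E a j R‖ ≤ M / 2) ∧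
      ∀ b, ‖c b (Y R)‖ ≤ M / 2 := by
    intro M hM hMb
    have hsumC : ∀ R, ‖R‖ < r → ∑ b, ‖c b (Y R)‖ ≤ nB * M := by
      intro R hR
      calc _ ≤ ∑ b : B, M := Finset.sum_le_sum fun b _ => (hMb R hR).2 b
        _ = _ := by rw [Finset.sum_const, nsmul_eq_mul, hnB, Finset.card_univ]
    have hlt : ∀ R : Fin N → ℂ, ‖R‖ < r → dist R 0 < r₀ := fun R hR => by
      rw [dist_zero_right]; exact hR.trans_le (min_le_left _ _)
    -- The defects `E b j` with `j ∈ S b` belong to no equation and are not controlled. They must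
    -- meet a vanishing coefficient, which is what `hdep` and `hdepc` provide.
    have hsumE : ∀ R, ‖R‖ < r → ∀ (j : Fin N) (w : A → ℂ) (κ : ℝ), 0 ≤ κ → (∀ b, ‖w b‖ ≤ κ) →
        (∀ b, j ∈ S b → w b = 0) → ‖∑ b, E b j R * w b‖ ≤ nA * κ * M := by
      intro R hR j w κ hκ hw hw0
      refine (norm_sum_le _ _).trans ?_
      calc _ ≤ ∑ b : A, M * κ := by
            refine Finset.sum_le_sum fun b _ => ?_
            by_cases hb : j ∈ S b
            · rw [hw0 b hb, mul_zero, norm_zero]; positivity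
            · rw [norm_mul]
              gcongr
              · exact (hMb R hR).1 b j hb
              · exact hw b
        _ = _ := by rw [Finset.sum_const, nsmul_eq_mul, hnA, Finset.card_univ]; ring
    have hNKM : N * r * (K * M) ≤ M / 2 := by
      have := mul_le_mul_of_nonneg_right hNK hM
      linarith
    intro R hR
    refine ⟨fun a k hk => ?_, fun b => ?_⟩
    -- Differentiating `∑ R_j E_aj = 0` in `R_k` gives `E_ak + ∑ R_j ∂_k E_aj = 0`. Adding `∑ R_j
    -- (∂_j E_ak - ∂_k E_aj)` to both sides leaves an Euler equation for `E_ak` with `κ = 1` and the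
    -- curl of `E` as source.
    · refine (norm_le_of_euler_eq (S a) (κ := 1) (e := E a k) (r := r) (K := K * M)
        (m := fun j R => pd j (E a k) R - pd k (E a j) R) (by positivity) ?_ ?_ ?_ (by simp) R
        hR).trans hNKM
      · intro R hR
        exact ((H (hlt R hR)).1.2.2.1 a k).differentiableAt
      · intro R hR
        have hH := H (hlt R hR)
        have e1 : pd k (fun R => ∑ j ∈ (S a)ᶜ, R j * E a j R) R = 0 := by
          have h0 : (fun R => ∑ j ∈ (S a)ᶜ, R j * E a j R) =ᶠ[𝓝 R] fun _ => 0 := by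
            filter_upwards [hH.1.1] with R' hR'
            exact hR' a
          rw [pd_congr h0]; simp [pd]
        have e2 : pd k (fun R => ∑ j ∈ (S a)ᶜ, R j * E a j R) R =
            ∑ j ∈ (S a)ᶜ, ((if j = k then 1 else 0) * E a j R + R j * pd k (E a j) R) := by
          have h1 : HasFDerivAt (fun R => ∑ j ∈ (S a)ᶜ, R j * E a j R)
              (∑ j ∈ (S a)ᶜ, (R j • fderiv ℂ (E a j) R + E a j R •
                ContinuousLinearMap.proj (R := ℂ) (φ := fun _ : Fin N => ℂ) j)) R :=
            HasFDerivAt.fun_sum fun j _ => (hasFDerivAt_apply j R).mul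
              ((hH.1.2.2.1 a j).differentiableAt.hasFDerivAt)
          unfold pd
          rw [h1.fderiv]
          simp only [_root_.sum_apply]
          refine Finset.sum_congr rfl fun j _ => ?_
          by_cases hjk : j = k
          · subst hjk; simp; ring
          · simp [hjk]
        rw [e1, Finset.sum_add_distrib, Finset.sum_eq_single_of_mem k (Finset.mem_compl.2 hk)
          (by intro j _ hj; simp [hj])] at e2
        simp only [mul_sub, Finset.sum_sub_distrib]
        simp only [if_true, one_mul] at e2
        push_cast
        linear_combination -e2
      · intro j hj R hR
        have hH := H (hlt R hR)
        by_cases hjk : j = k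
        · subst hjk; simp only [sub_self, norm_zero]; positivity
        obtain ⟨⟨-, hHY, hHE, hHC, -, -, -⟩, hHY', hHF, hHc, h1, h2, h3, h4, h5, h6⟩ := hH
        have e0 : ∀ i l, pd i (E a l) R = pd i (pd l fun R => Y R a) R -
            fderiv ℂ (fun y => F y a l) (Y R) (fun b => pd i (fun R => Y R b) R) := by
          intro i l
          rw [← pd_comp (hHF a l).differentiableAt hHY'.differentiableAt]
          have h7 := ((hHY a).pd l).differentiableAt.hasFDerivAt.sub
            ((AnalyticAt.comp (g := fun y => F y a l) (hHF a l) hHY').differentiableAt.hasFDerivAt)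
          exact congrArg (fun L => L (Pi.single i 1)) h7.fderiv
        have e1 : ∀ i l, fderiv ℂ (fun y => F y a l) (Y R) (fun b => pd i (fun R => Y R b) R) =
            fderiv ℂ (fun y => F y a l) (Y R) (fun b => F (Y R) b i) +
            ∑ b, E b i R * fderiv ℂ (fun y => F y a l) (Y R) (Pi.single b 1) := fun i l =>
          fderiv_apply_eq_add_sum _ _ _
        -- The second derivatives of `Y` cancel in the curl. What remains is the compatibility
        -- defect of `F`, bounded by the constraints, and terms linear in the defects `E`.
        have e2 : pd j (E a k) R - pd k (E a j) R =
            (fderiv ℂ (fun y => F y a j) (Y R) (fun b => F (Y R) b k) -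
            fderiv ℂ (fun y => F y a k) (Y R) (fun b => F (Y R) b j)) +
            ∑ b, E b k R * fderiv ℂ (fun y => F y a j) (Y R) (Pi.single b 1) -
            ∑ b, E b j R * fderiv ℂ (fun y => F y a k) (Y R) (Pi.single b 1) := by
          rw [e0, e0, e1, e1, pd_comm (hHY a)]; ring
        rw [e2]
        have b1 := h2 a k j hk hj (Ne.symm hjk)
        have b2 := hsumE R hR k (fun b => fderiv ℂ (fun y => F y a j) (Y R) (Pi.single b 1)) K₃ hK₃0
          (fun b => h5 (a, j, b)) (fun b hb => h1 a b j k hj hk hjk hb)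
        have b3 := hsumE R hR j (fun b => fderiv ℂ (fun y => F y a k) (Y R) (Pi.single b 1)) K₃ hK₃0
          (fun b => h5 (a, k, b)) (fun b hb => h1 a b k j hk hj (Ne.symm hjk) hb)
        have b4 : K₁ * ∑ b, ‖c b (Y R)‖ ≤ |K₁| * (nB * M) := by
          refine mul_le_mul (le_abs_self _) (hsumC R hR) (Finset.sum_nonneg fun b _ => norm_nonneg _)
            (abs_nonneg _)
        refine (norm_sub_le _ _).trans ?_
        refine (add_le_add_left (norm_add_le _ _) _).trans ?_
        have p1 : 0 ≤ |K₂| * nB * M := by positivity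
        have p2 : 0 ≤ nA * K₄ * M := by positivity
        rw [hK]
        linarith
    -- For a constraint `κ = 0`: it is integrated from the plane `R_j = 0`, `j ∉ T b`, where it
    -- vanishes by `hinit`.
    · refine (norm_le_of_euler_eq (T b) (κ := 0) (e := fun R => c b (Y R)) (r := r) (K := K * M)
        (m := fun j R => pd j (fun R => c b (Y R)) R) (by positivity) ?_ ?_ ?_ ?_ R hR).trans hNKM
      · intro R hR
        exact ((H (hlt R hR)).1.2.2.2.1 b).differentiableAt
      · intro R hR; simp
      · intro j hj R hR
        obtain ⟨⟨-, hHY, hHE, hHC, -, -, -⟩, hHY', hHF, hHc, h1, h2, h3, h4, h5, h6⟩ := H (hlt R hR)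
        rw [pd_comp (hHc b).differentiableAt hHY'.differentiableAt,
          fderiv_apply_eq_add_sum _ _ (fun a => F (Y R) a j)]
        have b1 := h4 b j hj
        have b2 := hsumE R hR j (fun a => fderiv ℂ (c b) (Y R) (Pi.single a 1)) K₄ hK₄0
          (fun a => h6 (b, a)) (fun a ha => h3 b a j hj ha)
        have b4 : K₂ * ∑ b, ‖c b (Y R)‖ ≤ |K₂| * (nB * M) := by
          refine mul_le_mul (le_abs_self _) (hsumC R hR) (Finset.sum_nonneg fun b _ => norm_nonneg _)
            (abs_nonneg _)
        refine (norm_add_le _ _).trans ?_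
        have p1 : 0 ≤ |K₁| * nB * M := by positivity
        have p2 : 0 ≤ nA * K₃ * M := by positivity
        have b5 : ‖∑ a, (pd j (fun R => Y R a) R - F (Y R) a j) *
          fderiv ℂ (c b) (Y R) (Pi.single a 1)‖ ≤ nA * K₄ * M := b2
        rw [hK]
        linarith
      · intro _ R hR hz
        exact (H (hlt R hR)).1.2.2.2.2.1 b hz
  -- Repeated halving of a crude initial bound on the same ball.
  have hpow : ∀ n : ℕ, ∀ R, ‖R‖ < r → (∀ a, ∀ j ∉ S a, ‖E a j R‖ ≤ (M₁ + M₂) / 2 ^ n) ∧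
      ∀ b, ‖c b (Y R)‖ ≤ (M₁ + M₂) / 2 ^ n := by
    intro n
    induction n with
    | zero =>
      intro R hR
      have hH := H (y := R) (by rw [dist_zero_right]; exact hR.trans_le (min_le_left _ _))
      refine ⟨fun a j _ => ?_, fun b => ?_⟩
      · have := hH.1.2.2.2.2.2.1 (a, j)
        simp only [pow_zero, div_one]; linarith
      · have := hH.1.2.2.2.2.2.2 b
        simp only [pow_zero, div_one]; linarith
    | succ n ih =>
      have := hstep ((M₁ + M₂) / 2 ^ n) (by positivity) ih
      simpa only [pow_succ, div_div] using this
  have hlim : Tendsto (fun n : ℕ => (M₁ + M₂) / 2 ^ n) atTop (𝓝 0) := by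
    have := (tendsto_pow_atTop_nhds_zero_of_lt_one (r := (1 / 2 : ℝ)) (by norm_num)
      (by norm_num)).const_mul (M₁ + M₂)
    simpa [div_eq_mul_inv] using this
  have hzero : ∀ x : ℂ, (∀ n : ℕ, ‖x‖ ≤ (M₁ + M₂) / 2 ^ n) → x = 0 := fun x hx =>
    norm_le_zero_iff.1 (ge_of_tendsto' hlim hx)
  filter_upwards [Metric.ball_mem_nhds (0 : Fin N → ℂ) hrpos] with R hR
  rw [Metric.mem_ball, dist_zero_right] at hR
  refine ⟨fun a j hj => sub_eq_zero.1 (hzero _ fun n => (hpow n R hR).1 a j hj), fun b =>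
    hzero _ fun n => (hpow n R hR).2 b⟩

/-- Differentiation of the integral equation along its ray gives the system contracted with the
Euler field, and its value at `s = 0` gives the Goursat data. No compatibility is needed for this
determined problem. -/
theorem exists_euler_solution {A : Type*} [Fintype A] {N : ℕ} (S : A → Finset (Fin N))
    {F : (A → ℂ) → A → Fin N → ℂ} {g : (Fin N → ℂ) → A → ℂ}
    (hF : AnalyticAt ℂ F (g 0)) (hg : AnalyticAt ℂ g 0)
    (hgS : ∀ a R R', (∀ j ∈ S a, R j = R' j) → g R a = g R' a) :
    ∃ Y : (Fin N → ℂ) → A → ℂ, AnalyticAt ℂ Y 0 ∧ Y 0 = g 0 ∧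
      (∀ᶠ R in 𝓝 0, ∀ a,
        ∑ j ∈ (S a)ᶜ, R j * (pd j (fun R => Y R a) R - F (Y R) a j) = 0) ∧
      ∀ᶠ R in 𝓝 0, ∀ a, (∀ j ∉ S a, R j = 0) → Y R a = g R a := by
  obtain ⟨Y, hY, ε, hε, H⟩ := exists_radial_solution S hF hg hgS
  have haxis : ∀ R, ‖R‖ < ε → ∀ a, (∀ j ∉ S a, R j = 0) → Y R a = g R a := by
    intro R hR a hz
    have h := H R hR a 0 (by simp)
    have hp : partScale (S a) (0 : ℝ) R = R := by
      ext j; by_cases hj : j ∈ S a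
      · simp [partScale, hj]
      · simp [partScale, hj, hz j hj]
    rw [hp] at h; simpa using h
  have hY0 : Y 0 = g 0 := by
    funext a; exact haxis 0 (by simpa using hε) a (by simp)
  refine ⟨Y, hY, hY0, ?_, ?_⟩
  · have hFY : AnalyticAt ℂ (fun R => F (Y R)) 0 :=
      AnalyticAt.comp (g := F) (f := Y) (by rwa [hY0]) hY
    obtain ⟨δ, hδ, Hδ⟩ := Metric.eventually_nhds_iff.1
      (hY.eventually_analyticAt.and hFY.eventually_analyticAt)
    filter_upwards [Metric.ball_mem_nhds (0 : Fin N → ℂ)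
      (show 0 < min (ε / 2) (δ / 2) by positivity)] with R hR a
    rw [Metric.mem_ball, dist_zero_right, lt_min_iff] at hR
    -- Doubling places `R` at the midpoint `s = 1/2` of the ray of `R'`, an interior point, so that
    -- two-sided derivatives in `s` are available.
    set R' : Fin N → ℂ := partScale (S a) 2 R with hR'
    have hRR' : partScale (S a) ((1 / 2 : ℝ) : ℂ) R' = R := by
      ext j; by_cases hj : j ∈ S a <;> simp [hR', partScale, hj]
    have hnorm : ‖R'‖ ≤ 2 * ‖R‖ := by
      refine (pi_norm_le_iff_of_nonneg (by positivity)).2 fun j => ?_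
      have := norm_le_pi_norm R j
      by_cases hj : j ∈ S a
      · simp only [hR', partScale, hj, if_true]; linarith [norm_nonneg R]
      · simp only [hR', partScale, hj, if_false, norm_mul, Complex.norm_ofNat]; linarith
    have hR'ε : ‖R'‖ < ε := by linarith
    have hin : ∀ s ∈ Set.Icc (0 : ℝ) 1, ‖partScale (S a) s R'‖ < δ := fun s hs =>
      (norm_partScale_le _ (by
        rw [Complex.norm_real, Real.norm_of_nonneg hs.1]; exact hs.2) R').trans_lt (by linarith)
    have hcont : ∀ j, ∀ s ∈ Set.Icc (0 : ℝ) 1,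
        ContinuousAt (fun τ : ℝ => F (Y (partScale (S a) τ R')) a j) s := by
      intro j s hs
      have h1 := (Hδ (y := partScale (S a) s R') (by rw [dist_zero_right]; exact hin s hs)).2
      have h2 : ContinuousAt (fun τ : ℝ => partScale (S a) (τ : ℂ) R') s := by
        refine (continuous_pi fun i => ?_).continuousAt
        unfold partScale
        split_ifs <;> fun_prop
      have h3 := ContinuousAt.comp (g := fun R => F (Y R)) (f := fun τ : ℝ => partScale (S a) (τ : ℂ) R') h1.continuousAt h2
      exact continuousAt_pi.1 (continuousAt_pi.1 h3 a) j
    have hhalf : (1 / 2 : ℝ) ∈ Set.Icc (0 : ℝ) 1 := by norm_num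
    have hd1 : HasDerivAt (fun s : ℝ => g R' a +
        ∑ j ∈ (S a)ᶜ, R' j * ∫ τ in (0 : ℝ)..s, F (Y (partScale (S a) τ R')) a j)
        (∑ j ∈ (S a)ᶜ, R' j * F (Y R) a j) (1 / 2) := by
      refine HasDerivAt.const_add _ (HasDerivAt.fun_sum fun j _ => HasDerivAt.const_mul _ ?_)
      have hco : ContinuousOn (fun τ : ℝ => F (Y (partScale (S a) τ R')) a j) (Set.Icc 0 1) :=
        fun s hs => (hcont j s hs).continuousWithinAt
      have := intervalIntegral.integral_hasDerivAt_right (a := 0) (b := 1 / 2)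
        (f := fun τ : ℝ => F (Y (partScale (S a) τ R')) a j)
        (ContinuousOn.intervalIntegrable (hco.mono (by
          rw [Set.uIcc_of_le (by norm_num)]; exact Set.Icc_subset_Icc le_rfl (by norm_num))))
        (hco.stronglyMeasurableAtFilter_nhdsWithin measurableSet_Icc _ |>.filter_mono (by
          rw [nhdsWithin_eq_nhds.2 (Icc_mem_nhds (show (0 : ℝ) < 1 / 2 by norm_num)
            (show (1 / 2 : ℝ) < 1 by norm_num))]))
        (hcont j _ hhalf)
      rwa [hRR'] at this
    have hd2 : HasDerivAt (fun s : ℝ => Y (partScale (S a) s R') a)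
        (∑ j ∈ (S a)ᶜ, R' j * pd j (fun R => Y R a) R) (1 / 2) := by
      have h1 := (Hδ (y := partScale (S a) ((1 / 2 : ℝ) : ℂ) R') (by
        rw [dist_zero_right]; exact hin _ hhalf)).1
      have h2 : DifferentiableAt ℂ (fun R => Y R a) (partScale (S a) ((1 / 2 : ℝ) : ℂ) R') :=
        differentiableAt_pi.1 h1.differentiableAt a
      have h3 := hasDerivAt_partScale (S a) h2
      rwa [hRR'] at h3
    have heq : (fun s : ℝ => Y (partScale (S a) s R') a) =ᶠ[𝓝 (1 / 2)] fun s : ℝ => g R' a +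
        ∑ j ∈ (S a)ᶜ, R' j * ∫ τ in (0 : ℝ)..s, F (Y (partScale (S a) τ R')) a j := by
      filter_upwards [Icc_mem_nhds (show (0 : ℝ) < 1 / 2 by norm_num)
        (show (1 / 2 : ℝ) < 1 by norm_num)] with s hs
      exact H R' hR'ε a s hs
    have e := (hd1.congr_of_eventuallyEq heq).unique hd2
    have e2 : ∀ G : Fin N → ℂ, ∑ j ∈ (S a)ᶜ, R' j * G j = 2 * ∑ j ∈ (S a)ᶜ, R j * G j := by
      intro G
      rw [Finset.mul_sum]
      refine Finset.sum_congr rfl fun j hj => ?_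
      rw [Finset.mem_compl] at hj
      simp [hR', partScale, hj, mul_assoc]
    rw [e2, e2] at e
    simp only [mul_sub, Finset.sum_sub_distrib]
    linear_combination -(1 / 2 : ℂ) * e
  · filter_upwards [Metric.ball_mem_nhds (0 : Fin N → ℂ) hε] with R hR a hz
    exact haxis R (by simpa using hR) a hz

/-! ### Bilinear forms and entrywise derivatives -/

/-- The bilinear form with matrix `M`. -/
def bil (M : Matrix (Fin 3) (Fin 3) ℂ) (x y : Fin 3 → ℂ) : ℂ := ∑ a, ∑ b, M a b * x a * y b

section bil

variable (M : Matrix (Fin 3) (Fin 3) ℂ) (x y z : Fin 3 → ℂ) (c : ℂ)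

theorem bil_smul_left : bil M (c • x) y = c * bil M x y := by
  simp only [bil, Finset.mul_sum, Pi.smul_apply, smul_eq_mul]
  exact Finset.sum_congr rfl fun a _ => Finset.sum_congr rfl fun b _ => by ring

theorem bil_smul_right : bil M x (c • y) = c * bil M x y := by
  simp only [bil, Finset.mul_sum, Pi.smul_apply, smul_eq_mul]
  exact Finset.sum_congr rfl fun a _ => Finset.sum_congr rfl fun b _ => by ring

theorem bil_sub_left : bil M (x - y) z = bil M x z - bil M y z := by
  simp only [bil, ← Finset.sum_sub_distrib, Pi.sub_apply]
  exact Finset.sum_congr rfl fun a _ => Finset.sum_congr rfl fun b _ => by ring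

theorem bil_sub_right : bil M x (y - z) = bil M x y - bil M x z := by
  simp only [bil, ← Finset.sum_sub_distrib, Pi.sub_apply]
  exact Finset.sum_congr rfl fun a _ => Finset.sum_congr rfl fun b _ => by ring

theorem bil_add_left : bil M (x + y) z = bil M x z + bil M y z := by
  simp only [bil, ← Finset.sum_add_distrib, Pi.add_apply]
  exact Finset.sum_congr rfl fun a _ => Finset.sum_congr rfl fun b _ => by ring

theorem bil_add_right : bil M x (y + z) = bil M x y + bil M x z := by
  simp only [bil, ← Finset.sum_add_distrib, Pi.add_apply]
  exact Finset.sum_congr rfl fun a _ => Finset.sum_congr rfl fun b _ => by ring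

variable {M} in
theorem bil_comm (hM : M.IsSymm) : bil M x y = bil M y x := by
  unfold bil
  rw [Finset.sum_comm]
  exact Finset.sum_congr rfl fun a _ => Finset.sum_congr rfl fun b _ => by
    rw [hM.apply]; ring

theorem bil_add_smul_matrix (M' : Matrix (Fin 3) (Fin 3) ℂ) (c' : ℂ) :
    bil (c • M + c' • M') x y = c * bil M x y + c' * bil M' x y := by
  simp only [bil, Finset.mul_sum, ← Finset.sum_add_distrib, Matrix.add_apply, Matrix.smul_apply,
    smul_eq_mul]
  exact Finset.sum_congr rfl fun a _ => Finset.sum_congr rfl fun b _ => by ring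

theorem bil_eq_mul_transpose {ι : Type*} (X : ι → Fin 3 → ℂ) (i j : ι) :
    (Matrix.of X * M * (Matrix.of X).transpose) i j = bil M (X i) (X j) := by
  simp only [bil, Matrix.mul_apply, Matrix.transpose_apply, Matrix.of_apply, Finset.sum_mul]
  rw [Finset.sum_comm]
  exact Finset.sum_congr rfl fun a _ => Finset.sum_congr rfl fun b _ => by ring

end bil

theorem hasDerivAt_bil {M : ℂ → Matrix (Fin 3) (Fin 3) ℂ} {u : ℂ → ℂ} {x y : ℂ → Fin 3 → ℂ}
    {u' t : ℂ} {x' y' : Fin 3 → ℂ} (hM : ∀ a b, DifferentiableAt ℂ (fun s => M s a b) (u t))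
    (hu : HasDerivAt u u' t) (hx : HasDerivAt x x' t) (hy : HasDerivAt y y' t) :
    HasDerivAt (fun t => bil (M (u t)) (x t) (y t))
      (u' * bil (matDeriv M (u t)) (x t) (y t) + bil (M (u t)) x' (y t) +
        bil (M (u t)) (x t) y') t := by
  have h : ∀ a b, HasDerivAt (fun t => M (u t) a b * x t a * y t b)
      (deriv (fun s => M s a b) (u t) * u' * x t a * y t b + M (u t) a b * x' a * y t b +
        M (u t) a b * x t a * y' b) t := by
    intro a b
    have h1 := ((hM a b).hasDerivAt.comp t hu).mul (hasDerivAt_pi.1 hx a)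
    refine (h1.mul (hasDerivAt_pi.1 hy b)).congr_deriv ?_
    simp only [Pi.mul_apply, Function.comp_apply]
    ring
  refine (HasDerivAt.fun_sum fun a _ => HasDerivAt.fun_sum fun b _ => h a b).congr_deriv ?_
  simp only [bil, Finset.mul_sum, ← Finset.sum_add_distrib, matDeriv, Matrix.of_apply]
  exact Finset.sum_congr rfl fun a _ => Finset.sum_congr rfl fun b _ => by ring

theorem matDeriv_isSymm {M : ℂ → Matrix (Fin 3) (Fin 3) ℂ} (hM : ∀ u, (M u).IsSymm) (u : ℂ) :
    (matDeriv M u).IsSymm := by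
  ext a b
  simp only [Matrix.transpose_apply, matDeriv, Matrix.of_apply]
  congr 1; funext s; exact (hM s).apply a b

theorem analyticAt_matDeriv {M : ℂ → Matrix (Fin 3) (Fin 3) ℂ} {u : ℂ}
    (hM : ∀ a b, AnalyticAt ℂ (fun s => M s a b) u) (a b : Fin 3) :
    AnalyticAt ℂ (fun s => matDeriv M s a b) u := (hM a b).deriv

/-! ### The Gibbons–Tsarev system -/

namespace Reduction

variable {N : ℕ}

/-- The vector `(1, μⁱ, λⁱ)` of a state. The coordinates of a state are `u` and, for each phase,
`(∂u/∂Rⁱ, μⁱ, λⁱ)`. -/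
def speed (y : Option (Fin N × Fin 3) → ℂ) (i : Fin N) : Fin 3 → ℂ :=
  fun a => if a = 0 then 1 else y (some (i, a))

/-- The frozen variables of the Goursat problem. -/
def frozen : Option (Fin N × Fin 3) → Finset (Fin N)
  | none => ∅
  | some (i, _) => {i}

/-- The Gibbons–Tsarev system. -/
noncomputable def rhs (V : ℂ → Matrix (Fin 3) (Fin 3) ℂ) (y : Option (Fin N × Fin 3) → ℂ) :
    Option (Fin N × Fin 3) → Fin N → ℂ
  | none, j => y (some (j, 0))
  | some (i, c), j => if j = i then 0 else if c = 0 then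
      -(bil (matDeriv V (y none)) (speed y i) (speed y j) /
        bil (V (y none)) (speed y i) (speed y j)) * y (some (i, 0)) * y (some (j, 0))
      else -(bil (matDeriv V (y none)) (speed y i) (speed y i) /
        (2 * bil (V (y none)) (speed y i) (speed y j))) * y (some (j, 0)) *
        (speed y j c - speed y i c)

/-- The dispersion relation. -/
noncomputable def disp (V : ℂ → Matrix (Fin 3) (Fin 3) ℂ) (i : Fin N)
    (y : Option (Fin N × Fin 3) → ℂ) : ℂ :=
  bil (V (y none)) (speed y i) (speed y i)

/-- States at which the Gibbons–Tsarev system is regular. -/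
structure Regular (V : ℂ → Matrix (Fin 3) (Fin 3) ℂ) (y : Option (Fin N × Fin 3) → ℂ) : Prop where
  analytic : ∀ a b, AnalyticAt ℂ (fun s => V s a b) (y none)
  ne_zero : ∀ i j, i ≠ j → bil (V (y none)) (speed y i) (speed y j) ≠ 0

variable {V : ℂ → Matrix (Fin 3) (Fin 3) ℂ} {y : Option (Fin N × Fin 3) → ℂ}

theorem analyticAt_coord (b : Option (Fin N × Fin 3)) :
    AnalyticAt ℂ (fun y : Option (Fin N × Fin 3) → ℂ => y b) y :=
  (ContinuousLinearMap.proj (R := ℂ) (φ := fun _ : Option (Fin N × Fin 3) => ℂ) b).analyticAt _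

theorem analyticAt_speed (i : Fin N) (a : Fin 3) :
    AnalyticAt ℂ (fun y : Option (Fin N × Fin 3) → ℂ => speed y i a) y := by
  unfold speed
  split_ifs
  · exact analyticAt_const
  · exact analyticAt_coord _

theorem analyticAt_bil {M : ℂ → Matrix (Fin 3) (Fin 3) ℂ}
    (hM : ∀ a b, AnalyticAt ℂ (fun s => M s a b) (y none)) (i j : Fin N) :
    AnalyticAt ℂ (fun y : Option (Fin N × Fin 3) → ℂ =>
      bil (M (y none)) (speed y i) (speed y j)) y := by
  unfold bil
  refine Finset.analyticAt_fun_sum _ fun a _ => Finset.analyticAt_fun_sum _ fun b _ => ?_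
  exact ((AnalyticAt.comp (g := fun s => M s a b)
    (f := fun y : Option (Fin N × Fin 3) → ℂ => y none) (hM a b) (analyticAt_coord none)).mul
    (analyticAt_speed i a)).mul (analyticAt_speed j b)

theorem Regular.analyticAt_disp (hy : Regular V y) (i : Fin N) : AnalyticAt ℂ (disp V i) y :=
  analyticAt_bil hy.analytic i i

theorem Regular.analyticAt_rhs_apply (hy : Regular V y) (a : Option (Fin N × Fin 3)) (j : Fin N) :
    AnalyticAt ℂ (fun y => rhs V y a j) y := by
  rcases a with _ | ⟨i, c⟩
  · exact analyticAt_coord _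
  · by_cases hij : j = i
    · simp only [rhs, hij, if_true]; exact analyticAt_const
    · have hb := analyticAt_bil hy.analytic i j
      have h0 := hy.ne_zero i j (Ne.symm hij)
      by_cases hc : c = 0
      · simp only [rhs, hij, hc, if_true, if_false]
        exact ((((analyticAt_bil (analyticAt_matDeriv hy.analytic) i j).div hb h0).neg.mul
          (analyticAt_coord _)).mul (analyticAt_coord _))
      · simp only [rhs, hij, hc, if_false]
        exact ((((analyticAt_bil (analyticAt_matDeriv hy.analytic) i i).div
          (analyticAt_const.mul hb) (mul_ne_zero two_ne_zero h0)).neg.mul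
          (analyticAt_coord _)).mul ((analyticAt_speed _ _).sub (analyticAt_speed _ _)))

theorem Regular.analyticAt_rhs (hy : Regular V y) : AnalyticAt ℂ (rhs V) y :=
  analyticAt_pi_iff.2 fun a => analyticAt_pi_iff.2 fun j => hy.analyticAt_rhs_apply a j

theorem Regular.eventually (hy : Regular V y) : ∀ᶠ y in 𝓝 y, Regular V y := by
  have h1 : ∀ᶠ z in 𝓝 y, ∀ a b, AnalyticAt ℂ (fun s => V s a b) (z none) :=
    eventually_all.2 fun a => eventually_all.2 fun b =>
      (continuous_apply none).continuousAt.eventually (hy.analytic a b).eventually_analyticAt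
  have h2 : ∀ᶠ z in 𝓝 y, ∀ i j, i ≠ j → bil (V (z none)) (speed z i) (speed z j) ≠ 0 :=
    eventually_all.2 fun i => eventually_all.2 fun j => by
      by_cases hij : i = j
      · simp [hij]
      · filter_upwards [(analyticAt_bil hy.analytic i j).continuousAt.eventually_ne
          (hy.ne_zero i j hij)] with z hz _ using hz
  filter_upwards [h1, h2] with z hz1 hz2 using ⟨hz1, hz2⟩

/-- A derivative in the direction `d` computed along the line. -/
theorem fderiv_eq_of_hasDerivAt_line {A : Type*} [Fintype A] {G : (A → ℂ) → ℂ} {y d : A → ℂ}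
    {g' : ℂ} (hG : DifferentiableAt ℂ G y) (h : HasDerivAt (fun t : ℂ => G (y + t • d)) g' 0) :
    fderiv ℂ G y d = g' := by
  have hl : HasDerivAt (fun t : ℂ => y + t • d) d 0 := by
    simpa using ((hasDerivAt_id (0 : ℂ)).smul_const d).const_add y
  have h1 := HasFDerivAt.comp_hasDerivAt (0 : ℂ) (f := fun t : ℂ => y + t • d) (l := G)
    (l' := fderiv ℂ G y) (by simpa using hG.hasFDerivAt) hl
  exact h1.unique h

/-- The `j`-th equation for a coordinate involves only `u`, the phase of that coordinate and phase
`j`. This sparsity keeps the unprescribed derivatives of the data of phase `k` along `R_k` out of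
the compatibility conditions. -/
theorem fderiv_rhs_eq_zero (hy : Regular V y) {a b : Option (Fin N × Fin 3)} {j k : Fin N}
    (_ : j ∉ frozen a) (hk : k ∉ frozen a) (hjk : j ≠ k) (hb : k ∈ frozen b) :
    fderiv ℂ (fun y => rhs V y a j) y (Pi.single b 1) = 0 := by
  refine fderiv_eq_of_hasDerivAt_line (hy.analyticAt_rhs_apply a j).differentiableAt ?_
  rcases b with _ | ⟨k', c'⟩
  · simp [frozen] at hb
  obtain rfl : k = k' := by simpa [frozen] using hb
  have hs : ∀ i, i ≠ k → ∀ t : ℂ, speed (y + t • Pi.single (some (k, c')) 1) i = speed y i := by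
    intro i hi t; funext a; simp [speed, hi]
  have hconst : (fun t : ℂ => rhs V (y + t • Pi.single (some (k, c')) 1) a j) =
      fun _ => rhs V y a j := by
    funext t
    rcases a with _ | ⟨i, c⟩
    · simp [rhs, hjk]
    · have hik : i ≠ k := fun h => hk (by simp [frozen, h])
      simp [rhs, hs i hik, hs j hjk, hik, hjk]
  rw [hconst]; exact hasDerivAt_const _ _

theorem fderiv_disp_eq_zero (hy : Regular V y) {i j : Fin N} {b : Option (Fin N × Fin 3)}
    (hij : j ≠ i) (hb : j ∈ frozen b) : fderiv ℂ (disp V i) y (Pi.single b 1) = 0 := by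
  refine fderiv_eq_of_hasDerivAt_line (hy.analyticAt_disp i).differentiableAt ?_
  rcases b with _ | ⟨k', c'⟩
  · simp [frozen] at hb
  obtain rfl : j = k' := by simpa [frozen] using hb
  have hs : ∀ t : ℂ, speed (y + t • Pi.single (some (j, c')) 1) i = speed y i := by
    intro t; funext a; simp [speed, hij.symm]
  have hconst : (fun t : ℂ => disp V i (y + t • Pi.single (some (j, c')) 1)) =
      fun _ => disp V i y := by
    funext t; simp [disp, hs]
  rw [hconst]; exact hasDerivAt_const _ _

/-- The motion of the speeds along the `k`-th flow. -/
theorem hasDerivAt_speed_line (i k : Fin N) (hik : i ≠ k) :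
    HasDerivAt (fun t : ℂ => speed (y + t • fun b => rhs V y b k) i)
      ((-(bil (matDeriv V (y none)) (speed y i) (speed y i) /
        (2 * bil (V (y none)) (speed y i) (speed y k))) * y (some (k, 0))) •
        (speed y k - speed y i)) 0 := by
  refine hasDerivAt_pi.2 fun a => ?_
  by_cases ha : a = 0
  · subst ha; simpa [speed] using hasDerivAt_const (0 : ℂ) (1 : ℂ)
  · have h := ((hasDerivAt_id (0 : ℂ)).mul_const (rhs V y (some (i, a)) k)).const_add
      (y (some (i, a)))
    have e : (fun t : ℂ => speed (y + t • fun b => rhs V y b k) i a) =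
        fun t => y (some (i, a)) + id t * rhs V y (some (i, a)) k := by
      funext t; simp [speed, ha]
    rw [e]
    refine h.congr_deriv ?_
    simp [rhs, hik.symm, ha, speed]

theorem hasDerivAt_coord_line (b : Option (Fin N × Fin 3)) (k : Fin N) :
    HasDerivAt (fun t : ℂ => (y + t • fun b => rhs V y b k) b) (rhs V y b k) 0 := by
  simpa using ((hasDerivAt_id (0 : ℂ)).mul_const (rhs V y b k)).const_add (y b)

/-- The product rule combined with the fact that each speed moves towards `X_k` along the `k`-th
flow. Used with `M = V` and with `M = matDeriv V`, it supplies the Gram derivatives needed for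
compatibility. -/
theorem hasDerivAt_bil_line {M : ℂ → Matrix (Fin 3) (Fin 3) ℂ}
    (hMs : ∀ u, (M u).IsSymm) (hM : ∀ a b, DifferentiableAt ℂ (fun s => M s a b) (y none))
    (i j k : Fin N) (hik : i ≠ k) (hjk : j ≠ k) :
    HasDerivAt (fun t : ℂ => bil (M ((y + t • fun b => rhs V y b k) none))
      (speed (y + t • fun b => rhs V y b k) i) (speed (y + t • fun b => rhs V y b k) j))
      (y (some (k, 0)) * (bil (matDeriv M (y none)) (speed y i) (speed y j) -
        bil (matDeriv V (y none)) (speed y i) (speed y i) /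
          (2 * bil (V (y none)) (speed y i) (speed y k)) *
          (bil (M (y none)) (speed y j) (speed y k) - bil (M (y none)) (speed y i) (speed y j)) -
        bil (matDeriv V (y none)) (speed y j) (speed y j) /
          (2 * bil (V (y none)) (speed y j) (speed y k)) *
          (bil (M (y none)) (speed y i) (speed y k) -
            bil (M (y none)) (speed y i) (speed y j)))) 0 := by
  have h := hasDerivAt_bil (M := M) (t := 0) (by simpa using hM)
    (hasDerivAt_coord_line (V := V) (y := y) none k)
    (hasDerivAt_speed_line (V := V) (y := y) i k hik)
    (hasDerivAt_speed_line (V := V) (y := y) j k hjk)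
  refine h.congr_deriv ?_
  simp only [zero_smul, add_zero, rhs, bil_smul_left, bil_smul_right, bil_sub_left, bil_sub_right,
    bil_comm (speed y k) (speed y j) (hMs _)]
  ring

end Reduction

/-! ### Mixed derivatives of the Gibbons–Tsarev system -/

namespace Reduction

variable {N : ℕ} {V : ℂ → Matrix (Fin 3) (Fin 3) ℂ} {y : Option (Fin N × Fin 3) → ℂ}

/-- The Gram matrix of the vectors `(1, μⁱ, λⁱ)`. -/
noncomputable def gram (M : ℂ → Matrix (Fin 3) (Fin 3) ℂ) (y : Option (Fin N × Fin 3) → ℂ)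
    (i j : Fin N) : ℂ :=
  bil (M (y none)) (speed y i) (speed y j)

theorem gram_comm {M : ℂ → Matrix (Fin 3) (Fin 3) ℂ} (hM : ∀ u, (M u).IsSymm)
    (i j : Fin N) : gram M y i j = gram M y j i := bil_comm _ _ (hM _)

/-- The value of `(ln det V)'` expressed through the Gram matrices of three null vectors. -/
noncomputable def tripleRate (V : ℂ → Matrix (Fin 3) (Fin 3) ℂ) (y : Option (Fin N × Fin 3) → ℂ)
    (i j k : Fin N) : ℂ :=
  gram (matDeriv V) y i j / gram V y i j + gram (matDeriv V) y i k / gram V y i k +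
    gram (matDeriv V) y j k / gram V y j k -
    gram (matDeriv V) y i i * gram V y j k / (2 * gram V y i j * gram V y i k) -
    gram (matDeriv V) y j j * gram V y i k / (2 * gram V y i j * gram V y j k) -
    gram (matDeriv V) y k k * gram V y i j / (2 * gram V y i k * gram V y j k)

theorem rhs_velocity (y : Option (Fin N × Fin 3) → ℂ) {i j : Fin N} (hij : j ≠ i) :
    rhs V y (some (i, 0)) j = -(bil (matDeriv V (y none)) (speed y i) (speed y j) /
      bil (V (y none)) (speed y i) (speed y j)) * y (some (i, 0)) * y (some (j, 0)) := by
  simp only [rhs, hij, if_true, if_false]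

theorem rhs_speed (y : Option (Fin N × Fin 3) → ℂ) {i j : Fin N} {c : Fin 3} (hc : c ≠ 0)
    (hij : j ≠ i) :
    rhs V y (some (i, c)) j = -(bil (matDeriv V (y none)) (speed y i) (speed y i) /
      (2 * bil (V (y none)) (speed y i) (speed y j))) * y (some (j, 0)) *
      (speed y j c - speed y i c) := by
  simp only [rhs, hij, hc, if_false]

theorem fderiv_eq_of_line {A : Type*} [Fintype A] {G : (A → ℂ) → ℂ} {y d : A → ℂ} {φ : ℂ → ℂ}
    {g' : ℂ} (hG : DifferentiableAt ℂ G y) (h : HasDerivAt φ g' 0)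
    (hφ : ∀ t : ℂ, G (y + t • d) = φ t) : fderiv ℂ G y d = g' :=
  fderiv_eq_of_hasDerivAt_line hG (by simpa only [hφ] using h)

/-- The equation for the speeds is the one forced by differentiating the dispersion relation. Off
the relation a term with factor `V(X_i, X_i)` is left over, so the relation is propagated by the
flow. -/
theorem fderiv_disp (hVs : ∀ u, (V u).IsSymm) (hy : Regular V y) {i k : Fin N} (hik : i ≠ k) :
    fderiv ℂ (disp V i) y (fun b => rhs V y b k) =
      y (some (k, 0)) * gram (matDeriv V) y i i / gram V y i k * disp V i y := by
  refine fderiv_eq_of_hasDerivAt_line (hy.analyticAt_disp i).differentiableAt ?_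
  refine (hasDerivAt_bil_line (V := V) (M := V) hVs (fun a b => (hy.analytic a b).differentiableAt)
    i i k hik hik).congr_deriv ?_
  have h := hy.ne_zero i k hik
  simp only [gram, disp]
  field_simp
  ring

/-- The terms quadratic in `V'` collect into one coefficient `tripleRate`, the same next to both
quotients. The dispersion relation is not used, so the identity can be differentiated and estimated
off it. -/
theorem fderiv_rhs_velocity (hVs : ∀ u, (V u).IsSymm) (hy : Regular V y) {i j k : Fin N}
    (hij : i ≠ j) (hik : i ≠ k) (hjk : j ≠ k) :
    fderiv ℂ (fun y => rhs V y (some (i, 0)) j) y (fun b => rhs V y b k) -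
      fderiv ℂ (fun y => rhs V y (some (i, 0)) k) y (fun b => rhs V y b j) =
    -(y (some (i, 0)) * y (some (j, 0)) * y (some (k, 0))) *
      ((gram (matDeriv (matDeriv V)) y i j - tripleRate V y i j k * gram (matDeriv V) y i j) /
          gram V y i j -
        (gram (matDeriv (matDeriv V)) y i k - tripleRate V y i j k * gram (matDeriv V) y i k) /
          gram V y i k) := by
  have hV1 := matDeriv_isSymm hVs
  have key := fun (j k : Fin N) (hij : i ≠ j) (hik : i ≠ k) (hjk : j ≠ k) =>
    have hv := hasDerivAt_bil_line (V := V) (M := V) hVs (fun a b => (hy.analytic a b).differentiableAt)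
      i j k hik hjk
    have hw := hasDerivAt_bil_line (V := V) (M := matDeriv V) hV1
      (fun a b => (analyticAt_matDeriv hy.analytic a b).differentiableAt) i j k hik hjk
    fderiv_eq_of_line (G := fun y => rhs V y (some (i, 0)) j) (y := y)
      (d := fun b => rhs V y b k) (hy.analyticAt_rhs_apply _ _).differentiableAt
      (((hw.fun_div hv (by simpa using hy.ne_zero i j hij)).fun_neg.fun_mul
      (hasDerivAt_coord_line (V := V) (y := y) (some (i, 0)) k)).fun_mul
      (hasDerivAt_coord_line (V := V) (y := y) (some (j, 0)) k))
      (fun t => rhs_velocity _ hij.symm)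
  rw [key j k hij hik hjk, key k j hik hij hjk.symm]
  have h1 := hy.ne_zero i j hij
  have h2 := hy.ne_zero i k hik
  have h3 := hy.ne_zero j k hjk
  simp only [zero_smul, add_zero, rhs, if_true, hik.symm, hij.symm, hjk, hjk.symm, if_false,
    tripleRate, gram]
  rw [bil_comm (speed y k) (speed y j) (hVs _), bil_comm (speed y k) (speed y j) (hV1 _)]
  generalize bil (V (y none)) (speed y i) (speed y j) = v12 at *
  generalize bil (V (y none)) (speed y i) (speed y k) = v13 at *
  generalize bil (V (y none)) (speed y j) (speed y k) = v23 at *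
  field_simp
  ring

/-- For the speeds only the diagonal value `(V'' - tripleRate V')(X_i, X_i)` obstructs
compatibility, multiplied by the difference of two normalised chords. -/
theorem fderiv_rhs_speed (hVs : ∀ u, (V u).IsSymm) (hy : Regular V y) {i j k : Fin N} {c : Fin 3}
    (hc : c ≠ 0) (hij : i ≠ j) (hik : i ≠ k) (hjk : j ≠ k) :
    fderiv ℂ (fun y => rhs V y (some (i, c)) j) y (fun b => rhs V y b k) -
      fderiv ℂ (fun y => rhs V y (some (i, c)) k) y (fun b => rhs V y b j) =
    -(1 / 2) * (y (some (j, 0)) * y (some (k, 0))) *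
      (gram (matDeriv (matDeriv V)) y i i - tripleRate V y i j k * gram (matDeriv V) y i i) *
      ((speed y j c - speed y i c) / gram V y i j - (speed y k c - speed y i c) / gram V y i k) := by
  have hV1 := matDeriv_isSymm hVs
  have key := fun (j k : Fin N) (hij : i ≠ j) (hik : i ≠ k) (hjk : j ≠ k) =>
    have hv := hasDerivAt_bil_line (V := V) (M := V) hVs (fun a b => (hy.analytic a b).differentiableAt)
      i j k hik hjk
    have hw := hasDerivAt_bil_line (V := V) (M := matDeriv V) hV1
      (fun a b => (analyticAt_matDeriv hy.analytic a b).differentiableAt) i i k hik hik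
    have hs := hasDerivAt_pi.1 (hasDerivAt_speed_line (V := V) (y := y) j k hjk) c
    have hs' := hasDerivAt_pi.1 (hasDerivAt_speed_line (V := V) (y := y) i k hik) c
    fderiv_eq_of_line (G := fun y => rhs V y (some (i, c)) j) (y := y)
      (d := fun b => rhs V y b k) (hy.analyticAt_rhs_apply _ _).differentiableAt
      (((hw.fun_div (hv.const_mul 2) (by simpa using hy.ne_zero i j hij)).fun_neg.fun_mul
      (hasDerivAt_coord_line (V := V) (y := y) (some (j, 0)) k)).fun_mul (hs.fun_sub hs'))
      (fun t => rhs_speed _ hc hij.symm)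
  rw [key j k hij hik hjk, key k j hik hij hjk.symm]
  have h1 := hy.ne_zero i j hij
  have h2 := hy.ne_zero i k hik
  have h3 := hy.ne_zero j k hjk
  simp only [zero_smul, add_zero, rhs, if_true, hjk, hjk.symm, if_false,
    tripleRate, gram, Pi.smul_apply, Pi.sub_apply, smul_eq_mul]
  rw [bil_comm (speed y k) (speed y j) (hVs _), bil_comm (speed y k) (speed y j) (hV1 _)]
  generalize bil (V (y none)) (speed y i) (speed y j) = v12 at *
  generalize bil (V (y none)) (speed y i) (speed y k) = v13 at *
  generalize bil (V (y none)) (speed y j) (speed y k) = v23 at *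
  field_simp
  ring

end Reduction

/-! ### Jacobi's formula and the logarithmic derivative of the determinant -/

/-- The derivative of the determinant at `V` in the direction `W`. -/
noncomputable def polarDet (V W : Matrix (Fin 3) (Fin 3) ℂ) : ℂ := (V.adjugate * W).trace

/-- The adjugate reverses products, `adj X · X = det X`, and the trace is cyclic. This carries
Jacobi's formula over to Gram matrices. -/
theorem polarDet_mul_transpose (V W X : Matrix (Fin 3) (Fin 3) ℂ) :
    polarDet (X * V * X.transpose) (X * W * X.transpose) = X.det ^ 2 * polarDet V W := by
  unfold polarDet
  rw [Matrix.adjugate_mul_distrib, Matrix.adjugate_mul_distrib]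
  have h1 : X.transpose.adjugate * (V.adjugate * X.adjugate) * (X * W * X.transpose) =
      X.transpose.adjugate * (V.adjugate * (X.adjugate * X) * W * X.transpose) := by
    simp only [Matrix.mul_assoc]
  rw [h1, Matrix.trace_mul_comm, Matrix.mul_assoc _ _ X.transpose.adjugate, Matrix.adjugate_mul,
    Matrix.mul_adjugate, Matrix.det_transpose]
  simp only [Matrix.mul_smul, Matrix.smul_mul, Matrix.mul_one, Matrix.trace_smul, smul_eq_mul]
  ring

theorem polarDet_eq (V W : Matrix (Fin 3) (Fin 3) ℂ) : polarDet V W =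
    W 0 0 * (V 1 1 * V 2 2 - V 1 2 * V 2 1) + W 1 1 * (V 0 0 * V 2 2 - V 0 2 * V 2 0) +
    W 2 2 * (V 0 0 * V 1 1 - V 0 1 * V 1 0) +
    W 0 1 * (V 1 2 * V 2 0 - V 1 0 * V 2 2) + W 1 0 * (V 0 2 * V 2 1 - V 0 1 * V 2 2) +
    W 0 2 * (V 1 0 * V 2 1 - V 1 1 * V 2 0) + W 2 0 * (V 0 1 * V 1 2 - V 0 2 * V 1 1) +
    W 1 2 * (V 0 1 * V 2 0 - V 0 0 * V 2 1) + W 2 1 * (V 0 2 * V 1 0 - V 0 0 * V 1 2) := by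
  simp only [polarDet, Matrix.trace_fin_three, Matrix.adjugate_fin_three, Matrix.mul_apply,
    Fin.sum_univ_three, Matrix.of_apply, Matrix.cons_val',
    Matrix.cons_val]
  ring

theorem hasDerivAt_det {V : ℂ → Matrix (Fin 3) (Fin 3) ℂ} {u : ℂ}
    (hV : ∀ a b, DifferentiableAt ℂ (fun s => V s a b) u) :
    HasDerivAt (fun s => (V s).det) (polarDet (V u) (matDeriv V u)) u := by
  have h := fun a b => (hV a b).hasDerivAt
  have e : (fun s => (V s).det) = fun s =>
      V s 0 0 * V s 1 1 * V s 2 2 - V s 0 0 * V s 1 2 * V s 2 1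
        - V s 0 1 * V s 1 0 * V s 2 2 + V s 0 1 * V s 1 2 * V s 2 0
        + V s 0 2 * V s 1 0 * V s 2 1 - V s 0 2 * V s 1 1 * V s 2 0 := by
    funext s; rw [Matrix.det_fin_three]
  rw [e]
  refine ((((((((h 0 0).fun_mul (h 1 1)).fun_mul (h 2 2)).fun_sub
    (((h 0 0).fun_mul (h 1 2)).fun_mul (h 2 1))).fun_sub
    (((h 0 1).fun_mul (h 1 0)).fun_mul (h 2 2))).fun_add
    (((h 0 1).fun_mul (h 1 2)).fun_mul (h 2 0))).fun_add
    (((h 0 2).fun_mul (h 1 0)).fun_mul (h 2 1))).fun_sub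
    (((h 0 2).fun_mul (h 1 1)).fun_mul (h 2 0))).congr_deriv ?_
  simp only [polarDet_eq, matDeriv, Matrix.of_apply]
  ring

theorem logDeriv_det_mul {V : ℂ → Matrix (Fin 3) (Fin 3) ℂ} {u : ℂ}
    (hV : ∀ a b, DifferentiableAt ℂ (fun s => V s a b) u) (hdet : (V u).det ≠ 0) :
    polarDet (V u) (matDeriv V u) = logDeriv (fun s => (V s).det) u * (V u).det := by
  rw [logDeriv_apply, (hasDerivAt_det hV).deriv]
  field_simp

namespace Reduction

variable {N : ℕ} {V : ℂ → Matrix (Fin 3) (Fin 3) ℂ} {y : Option (Fin N × Fin 3) → ℂ}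

theorem gram_eq_mul_transpose (M : ℂ → Matrix (Fin 3) (Fin 3) ℂ)
    (y : Option (Fin N × Fin 3) → ℂ) (f : Fin 3 → Fin N) (a b : Fin 3) :
    (Matrix.of (fun a => speed y (f a)) * M (y none) *
      (Matrix.of fun a => speed y (f a)).transpose) a b = gram M y (f a) (f b) :=
  bil_eq_mul_transpose _ _ _ _

/-- Jacobi's formula for the Gram matrices of `X_i, X_j, X_k`. When the diagonal of the Gram matrix
of `V` vanishes, its determinant is twice the product of the three off-diagonal entries and the
formula becomes `ω = tripleRate`. The right-hand side collects what the diagonal entries, that is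
the dispersion expressions, contribute otherwise. -/
theorem rate_sub_tripleRate (hVs : ∀ u, (V u).IsSymm) (hy : Regular V y) {ω : ℂ}
    (hω : polarDet (V (y none)) (matDeriv V (y none)) = ω * (V (y none)).det)
    {i j k : Fin N} (hij : i ≠ j) (hik : i ≠ k) (hjk : j ≠ k) :
    (ω - tripleRate V y i j k) * (2 * gram V y i j * gram V y i k * gram V y j k) =
      disp V i y * (gram (matDeriv V) y j j * gram V y k k + gram (matDeriv V) y k k * gram V y j j
        - 2 * gram (matDeriv V) y j k * gram V y j k
        - ω * (gram V y j j * gram V y k k - gram V y j k ^ 2)) +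
      disp V j y * (gram (matDeriv V) y i i * gram V y k k
        - 2 * gram (matDeriv V) y i k * gram V y i k + ω * gram V y i k ^ 2) +
      disp V k y * (ω * gram V y i j ^ 2 - 2 * gram (matDeriv V) y i j * gram V y i j) := by
  set X : Matrix (Fin 3) (Fin 3) ℂ := Matrix.of fun a => speed y (![i, j, k] a) with hX
  have h1 := polarDet_mul_transpose (V (y none)) (matDeriv V (y none)) X
  have h2 : (X * V (y none) * X.transpose).det = X.det ^ 2 * (V (y none)).det := by
    rw [Matrix.det_mul, Matrix.det_mul, Matrix.det_transpose]; ring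
  have h3 : polarDet (X * V (y none) * X.transpose) (X * matDeriv V (y none) * X.transpose) =
      ω * (X * V (y none) * X.transpose).det := by
    rw [h1, h2, hω]; ring
  rw [polarDet_eq, Matrix.det_fin_three] at h3
  simp only [hX, gram_eq_mul_transpose] at h3
  simp only [Matrix.cons_val] at h3
  have hV1 := matDeriv_isSymm hVs
  rw [gram_comm hVs j i, gram_comm hVs k i, gram_comm hVs k j, gram_comm hV1 j i,
    gram_comm hV1 k i, gram_comm hV1 k j] at h3
  have n1 : gram V y i j ≠ 0 := hy.ne_zero i j hij
  have n2 : gram V y i k ≠ 0 := hy.ne_zero i k hik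
  have n3 : gram V y j k ≠ 0 := hy.ne_zero j k hjk
  have hd : ∀ i, disp V i y = gram V y i i := fun i => rfl
  simp only [hd]
  have h4 : tripleRate V y i j k * (2 * gram V y i j * gram V y i k * gram V y j k) =
      2 * (gram (matDeriv V) y i j * gram V y i k * gram V y j k +
        gram (matDeriv V) y i k * gram V y i j * gram V y j k +
        gram (matDeriv V) y j k * gram V y i j * gram V y i k) -
      gram (matDeriv V) y i i * gram V y j k ^ 2 - gram (matDeriv V) y j j * gram V y i k ^ 2 -
      gram (matDeriv V) y k k * gram V y i j ^ 2 := by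
    unfold tripleRate
    field_simp
  linear_combination -h3 - h4

end Reduction

/-! ### Null vectors and a regular singular equation on an axis -/

/-- A nondegenerate form in three variables has no totally isotropic plane, so orthogonal null
vectors are proportional; with first coordinate `1` they coincide. Dependence is detected by Gram
determinants after adjoining a third vector `e`. -/
theorem bil_ne_zero_of_null {M : Matrix (Fin 3) (Fin 3) ℂ} (hM : M.IsSymm) (hdet : M.det ≠ 0)
    {x y : Fin 3 → ℂ} (hx0 : x 0 = 1) (hy0 : y 0 = 1) (hxy : x ≠ y) (hx : bil M x x = 0)
    (hy : bil M y y = 0) : bil M x y ≠ 0 := by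
  intro h
  have key : ∀ e : Fin 3 → ℂ, (Matrix.of ![x, y, e]).det = 0 := by
    intro e
    set X : Matrix (Fin 3) (Fin 3) ℂ := Matrix.of ![x, y, e] with hX
    have h1 : (X * M * X.transpose).det = 0 := by
      rw [Matrix.det_fin_three]
      simp only [hX, bil_eq_mul_transpose, Matrix.cons_val, bil_comm y x hM, h, hx, hy]
      ring
    rw [Matrix.det_mul, Matrix.det_mul, Matrix.det_transpose] at h1
    have h2 : X.det ^ 2 * M.det = 0 := by rw [← h1]; ring
    exact pow_eq_zero_iff (two_ne_zero) |>.1 ((mul_eq_zero.1 h2).resolve_right hdet)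
  have h1 := key ![0, 1, 0]
  have h2 := key ![0, 0, 1]
  rw [Matrix.det_fin_three] at h1 h2
  simp only [Matrix.of_apply, Matrix.cons_val, hx0, hy0] at h1 h2
  apply hxy
  funext a
  fin_cases a
  · simp [hx0, hy0]
  · simp only [Fin.mk_one]; linear_combination -h2
  · simp only [Fin.reduceFinMk]; linear_combination h1

/-- On an axis the radial equation fixes a derivative only up to the factor `s`. Isolated zeros of
analytic functions remove that factor. -/
theorem eventually_eq_zero_of_mul_deriv {h : ℂ → ℂ} (hh : AnalyticAt ℂ h 0) (h0 : h 0 = 0)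
    (hd : ∀ᶠ s in 𝓝 0, s * deriv h s = 0) : ∀ᶠ s in 𝓝 0, h s = 0 := by
  have hz : ∀ᶠ s in 𝓝 0, deriv h s = 0 := by
    rcases hh.deriv.eventually_eq_zero_or_eventually_ne_zero with h1 | h1
    · exact h1
    · exfalso
      have h2 : ∀ᶠ s in 𝓝[≠] (0 : ℂ), False := by
        filter_upwards [h1, hd.filter_mono nhdsWithin_le_nhds, self_mem_nhdsWithin] with s a b c
        exact (mul_ne_zero c a) b
      exact h2.exists.choose_spec
  obtain ⟨r, hr, H⟩ := Metric.eventually_nhds_iff_ball.1 (hz.and hh.eventually_analyticAt)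
  filter_upwards [Metric.ball_mem_nhds (0 : ℂ) hr] with s hs
  rw [← h0]
  exact Metric.isOpen_ball.is_const_of_deriv_eq_zero (convex_ball _ _).isPreconnected
    (fun x hx => (H x hx).2.differentiableAt.differentiableWithinAt) (fun x hx => (H x hx).1) hs
    (Metric.mem_ball_self hr)

/-! ### Errors controlled by the dispersion relation -/

namespace Reduction

variable {N : ℕ} {V : ℂ → Matrix (Fin 3) (Fin 3) ℂ} {y : Option (Fin N × Fin 3) → ℂ}

theorem Regular.analyticAt_gram (_ : Regular V y) {M : ℂ → Matrix (Fin 3) (Fin 3) ℂ}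
    (hM : ∀ a b, AnalyticAt ℂ (fun s => M s a b) (y none)) (i j : Fin N) :
    AnalyticAt ℂ (fun y => gram M y i j) y := analyticAt_bil hM i j

/-- A function which vanishes on the dispersion relation. -/
def DispBounded (V : ℂ → Matrix (Fin 3) (Fin 3) ℂ) (y₀ : Option (Fin N × Fin 3) → ℂ)
    (f : (Option (Fin N × Fin 3) → ℂ) → ℂ) : Prop :=
  ∃ K, ∀ᶠ y in 𝓝 y₀, ‖f y‖ ≤ K * ∑ i, ‖disp V i y‖

theorem DispBounded.congr {y₀ : Option (Fin N × Fin 3) → ℂ}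
    {f g : (Option (Fin N × Fin 3) → ℂ) → ℂ} (hf : DispBounded V y₀ f)
    (h : ∀ᶠ y in 𝓝 y₀, g y = f y) : DispBounded V y₀ g := by
  obtain ⟨K, hK⟩ := hf
  exact ⟨K, by filter_upwards [hK, h] with y h1 h2; rwa [h2]⟩

theorem dispBounded_disp {y₀ : Option (Fin N × Fin 3) → ℂ} (i : Fin N) :
    DispBounded V y₀ (disp V i) :=
  ⟨1, Eventually.of_forall fun y => by
    rw [one_mul]
    exact Finset.single_le_sum (f := fun i => ‖disp V i y‖) (fun i _ => norm_nonneg _)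
      (Finset.mem_univ i)⟩

theorem DispBounded.add {y₀ : Option (Fin N × Fin 3) → ℂ}
    {f g : (Option (Fin N × Fin 3) → ℂ) → ℂ} (hf : DispBounded V y₀ f) (hg : DispBounded V y₀ g) :
    DispBounded V y₀ (fun y => f y + g y) := by
  obtain ⟨K, hK⟩ := hf
  obtain ⟨L, hL⟩ := hg
  refine ⟨K + L, ?_⟩
  filter_upwards [hK, hL] with y h1 h2
  rw [add_mul]
  exact (norm_add_le _ _).trans (add_le_add h1 h2)

theorem DispBounded.mul {y₀ : Option (Fin N × Fin 3) → ℂ}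
    {f g : (Option (Fin N × Fin 3) → ℂ) → ℂ} (hf : DispBounded V y₀ f) (hg : ContinuousAt g y₀) :
    DispBounded V y₀ (fun y => f y * g y) := by
  obtain ⟨K, hK⟩ := hf
  refine ⟨|K| * (‖g y₀‖ + 1), ?_⟩
  filter_upwards [hK, hg.norm.eventually (gt_mem_nhds (show ‖g y₀‖ < ‖g y₀‖ + 1 by simp))] with y h1 h2
  have hs : 0 ≤ ∑ i, ‖disp V i y‖ := Finset.sum_nonneg fun i _ => norm_nonneg _
  rw [norm_mul]
  calc _ ≤ (|K| * ∑ i, ‖disp V i y‖) * (‖g y₀‖ + 1) := by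
        gcongr
        exact h1.trans (mul_le_mul_of_nonneg_right (le_abs_self K) hs)
    _ = _ := by ring

/-- The integrability condition at a point, in the form used for the Goursat problem. -/
structure IntegrabilityAt (V : ℂ → Matrix (Fin 3) (Fin 3) ℂ) (u₀ : ℂ) : Prop where
  symm : ∀ u, (V u).IsSymm
  analytic : ∀ a b, AnalyticAt ℂ (fun s => V s a b) u₀
  det_ne_zero : (V u₀).det ≠ 0
  eq : ∃ k : ℂ → ℂ, ∀ᶠ u in 𝓝 u₀, matDeriv (matDeriv V) u =
    logDeriv (fun s => (V s).det) u • matDeriv V u + k u • V u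

/-- No regularity of `k` is assumed, but an entry of `V` that does not vanish at `u₀` determines `k`
nearby as a quotient of continuous functions. -/
theorem IntegrabilityAt.exists_continuousAt {u₀ : ℂ} (h : IntegrabilityAt V u₀) :
    ∃ k : ℂ → ℂ, ContinuousAt k u₀ ∧ ∀ᶠ u in 𝓝 u₀, matDeriv (matDeriv V) u =
      logDeriv (fun s => (V s).det) u • matDeriv V u + k u • V u := by
  obtain ⟨k, hk⟩ := h.eq
  have hne : ∃ a b, V u₀ a b ≠ 0 := by
    by_contra hcon
    push Not at hcon
    apply h.det_ne_zero
    rw [Matrix.det_fin_three]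
    simp [hcon]
  obtain ⟨a, b, hab⟩ := hne
  have hdet : AnalyticAt ℂ (fun s => (V s).det) u₀ := by
    have e : (fun s => (V s).det) = fun s => _ := funext fun s => Matrix.det_fin_three (V s)
    rw [e]
    have := h.analytic
    fun_prop
  have hlog : ContinuousAt (logDeriv (fun s => (V s).det)) u₀ :=
    hdet.deriv.continuousAt.div hdet.continuousAt h.det_ne_zero
  refine ⟨fun u => (matDeriv (matDeriv V) u a b - logDeriv (fun s => (V s).det) u *
    matDeriv V u a b) / V u a b, ?_, ?_⟩
  · have h1 := analyticAt_matDeriv h.analytic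
    exact (((analyticAt_matDeriv h1 a b).continuousAt.sub (hlog.mul (h1 a b).continuousAt))).div
      (h.analytic a b).continuousAt hab
  · filter_upwards [hk, (h.analytic a b).continuousAt.eventually_ne hab] with u hu hne
    have h2 := congrFun (congrFun hu a) b
    simp only [Matrix.add_apply, Matrix.smul_apply, smul_eq_mul] at h2
    have h3 : (matDeriv (matDeriv V) u a b - logDeriv (fun s => (V s).det) u *
        matDeriv V u a b) / V u a b = k u := by
      rw [h2]; field_simp; ring
    rw [h3]; exact hu

theorem IntegrabilityAt.continuousAt_rate {u₀ : ℂ} (h : IntegrabilityAt V u₀) :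
    ContinuousAt (logDeriv (fun s => (V s).det)) u₀ := by
  have hdet : AnalyticAt ℂ (fun s => (V s).det) u₀ := by
    have e : (fun s => (V s).det) = fun s => _ := funext fun s => Matrix.det_fin_three (V s)
    rw [e]
    have := h.analytic
    fun_prop
  exact hdet.deriv.continuousAt.div hdet.continuousAt h.det_ne_zero

theorem IntegrabilityAt.eventually_rate {u₀ : ℂ} (h : IntegrabilityAt V u₀) :
    ∀ᶠ u in 𝓝 u₀, polarDet (V u) (matDeriv V u) =
      logDeriv (fun s => (V s).det) u * (V u).det := by
  have hdet : AnalyticAt ℂ (fun s => (V s).det) u₀ := by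
    have e : (fun s => (V s).det) = fun s => _ := funext fun s => Matrix.det_fin_three (V s)
    rw [e]
    have := h.analytic
    fun_prop
  filter_upwards [eventually_all.2 fun a => eventually_all.2 fun b =>
    (h.analytic a b).eventually_analyticAt, hdet.continuousAt.eventually_ne h.det_ne_zero]
    with u h1 h2
  exact logDeriv_det_mul (fun a b => (h1 a b).differentiableAt) h2

/-- Division of `rate_sub_tripleRate` by the off-diagonal Gram entries, which do not vanish at a
regular state. -/
theorem dispBounded_rate (hint : IntegrabilityAt V (y none)) (hy : Regular V y) {i j k : Fin N}
    (hij : i ≠ j) (hik : i ≠ k) (hjk : j ≠ k) :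
    DispBounded V y (fun y => logDeriv (fun s => (V s).det) (y none) - tripleRate V y i j k) := by
  have a := fun i j => (hy.analyticAt_gram hy.analytic i j).continuousAt
  have b := fun i j => (hy.analyticAt_gram (analyticAt_matDeriv hy.analytic) i j).continuousAt
  have hc : ContinuousAt (fun y : Option (Fin N × Fin 3) → ℂ => y none) y :=
    (continuous_apply none).continuousAt
  have hω : ContinuousAt (fun y : Option (Fin N × Fin 3) → ℂ =>
      logDeriv (fun s => (V s).det) (y none)) y :=
    ContinuousAt.comp (g := logDeriv (fun s => (V s).det)) hint.continuousAt_rate hc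
  have n1 : gram V y i j ≠ 0 := hy.ne_zero i j hij
  have n2 : gram V y i k ≠ 0 := hy.ne_zero i k hik
  have n3 : gram V y j k ≠ 0 := hy.ne_zero j k hjk
  have c2 : ContinuousAt (fun _ : Option (Fin N × Fin 3) → ℂ => (2 : ℂ)) y := continuousAt_const
  have h1 := (((dispBounded_disp (V := V) (y₀ := y) i).mul
    (((((b j j).fun_mul (a k k)).fun_add ((b k k).fun_mul (a j j))).fun_sub
      ((c2.fun_mul (b j k)).fun_mul (a j k))).fun_sub
      (hω.fun_mul (((a j j).fun_mul (a k k)).fun_sub ((a j k).fun_pow 2))))).add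
    ((dispBounded_disp (V := V) (y₀ := y) j).mul
    ((((b i i).fun_mul (a k k)).fun_sub ((c2.fun_mul (b i k)).fun_mul (a i k))).fun_add
      (hω.fun_mul ((a i k).fun_pow 2))))).add
    ((dispBounded_disp (V := V) (y₀ := y) k).mul
    ((hω.fun_mul ((a i j).fun_pow 2)).fun_sub ((c2.fun_mul (b i j)).fun_mul (a i j))))
  refine (h1.mul (g := fun y => (2 * gram V y i j * gram V y i k * gram V y j k)⁻¹)
    ((((continuousAt_const.mul (a i j)).mul (a i k)).mul (a j k)).inv₀ (by simp [n1, n2, n3]))).congr ?_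
  filter_upwards [hy.eventually, hc.eventually hint.eventually_rate] with z hz hz'
  have h2 := rate_sub_tripleRate hint.symm hz hz' hij hik hjk
  have n1 : gram V z i j ≠ 0 := hz.ne_zero i j hij
  have n2 : gram V z i k ≠ 0 := hz.ne_zero i k hik
  have n3 : gram V z j k ≠ 0 := hz.ne_zero j k hjk
  rw [← h2]
  field_simp

end Reduction

/-! ### Involution and the Goursat problem -/

namespace Reduction

variable {N : ℕ} {V : ℂ → Matrix (Fin 3) (Fin 3) ℂ} {y : Option (Fin N × Fin 3) → ℂ}

theorem continuousAt_coord (b : Option (Fin N × Fin 3)) :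
    ContinuousAt (fun y : Option (Fin N × Fin 3) → ℂ => y b) y :=
  (continuous_apply b).continuousAt

/-- The Gibbons–Tsarev system is in involution modulo the dispersion relation. -/
theorem dispBounded_compatibility (hint : IntegrabilityAt V (y none)) (hy : Regular V y)
    {a : Option (Fin N × Fin 3)} {j k : Fin N} (hj : j ∉ frozen a) (hk : k ∉ frozen a)
    (hjk : j ≠ k) :
    DispBounded V y (fun y => fderiv ℂ (fun y => rhs V y a k) y (fun b => rhs V y b j) -
      fderiv ℂ (fun y => rhs V y a j) y (fun b => rhs V y b k)) := by
  rcases a with _ | ⟨i, c⟩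
  -- For `u` itself compatibility is exact, because the equation for `∂_j v_i` is symmetric in `i`
  -- and `j`.
  · refine ⟨0, ?_⟩
    have hp : ∀ (y d : Option (Fin N × Fin 3) → ℂ) (l : Fin N),
        fderiv ℂ (fun y => rhs V y none l) y d = d (some (l, 0)) := by
      intro y d l
      have h := (ContinuousLinearMap.proj (R := ℂ) (φ := fun _ : Option (Fin N × Fin 3) => ℂ)
        (some (l, 0))).hasFDerivAt (x := y)
      exact congrArg (fun L => L d) h.fderiv
    refine Eventually.of_forall fun z => ?_
    beta_reduce
    rw [hp, hp, rhs_velocity _ hjk, rhs_velocity _ hjk.symm,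
      bil_comm _ _ (matDeriv_isSymm hint.symm _), bil_comm (speed z k) _ (hint.symm _)]
    simp only [zero_mul, norm_le_zero_iff]
    ring
  · have hij : i ≠ j := fun h => hj (by simp [frozen, h])
    have hik : i ≠ k := fun h => hk (by simp [frozen, h])
    obtain ⟨κ, hκc, hκ⟩ := hint.exists_continuousAt
    have gv := fun i j => (hy.analyticAt_gram hy.analytic i j).continuousAt
    have gw := fun i j => (hy.analyticAt_gram (analyticAt_matDeriv hy.analytic) i j).continuousAt
    have hu : ContinuousAt (fun y : Option (Fin N × Fin 3) → ℂ => y none) y :=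
      continuousAt_coord none
    have hκ' : ContinuousAt (fun y : Option (Fin N × Fin 3) → ℂ => κ (y none)) y :=
      ContinuousAt.comp (g := κ) hκc hu
    have n1 : gram V y i j ≠ 0 := hy.ne_zero i j hij
    have n2 : gram V y i k ≠ 0 := hy.ne_zero i k hik
    have hz : ∀ z : Option (Fin N × Fin 3) → ℂ, matDeriv (matDeriv V) (z none) =
        logDeriv (fun s => (V s).det) (z none) • matDeriv V (z none) + κ (z none) • V (z none) →
        ∀ i j, gram (matDeriv (matDeriv V)) z i j =
          logDeriv (fun s => (V s).det) (z none) * gram (matDeriv V) z i j +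
            κ (z none) * gram V z i j := by
      intro z hz i j
      simp only [gram, hz, bil_add_smul_matrix]
    have hrate := dispBounded_rate hint hy hik hij hjk.symm
    have hsp := fun i c => (analyticAt_speed (y := y) i c).continuousAt
    have hcd := fun b => continuousAt_coord (y := y) b
    -- After substituting `V'' = ω V' + κ V`, the two contributions of `κ` cancel for the
    -- velocities, and for the speeds they carry the factor `disp V i`. All else carries the factor
    -- `ω - tripleRate`.
    by_cases hc : c = 0
    · subst hc
      refine (hrate.mul ((((hcd (some (i, 0))).fun_mul (hcd (some (k, 0)))).fun_mul
        (hcd (some (j, 0)))).fun_mul (((gw i j).div (gv i j) n1).fun_sub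
          ((gw i k).div (gv i k) n2)))).congr ?_
      filter_upwards [hy.eventually, hu.eventually hκ] with z hzr hzκ
      have n1 : gram V z i j ≠ 0 := hzr.ne_zero i j hij
      have n2 : gram V z i k ≠ 0 := hzr.ne_zero i k hik
      simp only [Pi.div_apply]
      rw [fderiv_rhs_velocity hint.symm hzr hik hij hjk.symm, hz z hzκ, hz z hzκ]
      field_simp
      ring
    · have hK : ContinuousAt (fun y => -(1 / 2) * (y (some (k, 0)) * y (some (j, 0))) *
          ((speed y k c - speed y i c) / gram V y i k -
            (speed y j c - speed y i c) / gram V y i j)) y :=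
        (continuousAt_const.fun_mul ((hcd (some (k, 0))).fun_mul (hcd (some (j, 0))))).fun_mul
          ((((hsp k c).fun_sub (hsp i c)).div (gv i k) n2).fun_sub
          (((hsp j c).fun_sub (hsp i c)).div (gv i j) n1))
      refine (((hrate.mul (gw i i)).add ((dispBounded_disp i).mul hκ')).mul hK).congr ?_
      filter_upwards [hy.eventually, hu.eventually hκ] with z hzr hzκ
      rw [fderiv_rhs_speed hint.symm hzr hc hik hij hjk.symm, hz z hzκ,
        show gram V z i i = disp V i z from rfl]
      ring

theorem dispBounded_uniform {ι : Type*} [Finite ι] {y₀ : Option (Fin N × Fin 3) → ℂ}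
    {p : ι → Prop} {f : ι → (Option (Fin N × Fin 3) → ℂ) → ℂ}
    (hf : ∀ i, p i → DispBounded V y₀ (f i)) :
    ∃ K, ∀ᶠ y in 𝓝 y₀, ∀ i, p i → ‖f i y‖ ≤ K * ∑ i, ‖disp V i y‖ := by
  classical
  cases nonempty_fintype ι
  have h : ∀ i, ∃ K, p i → ∀ᶠ y in 𝓝 y₀, ‖f i y‖ ≤ K * ∑ i, ‖disp V i y‖ := by
    intro i
    by_cases hp : p i
    · obtain ⟨K, hK⟩ := hf i hp; exact ⟨K, fun _ => hK⟩
    · exact ⟨0, fun h => absurd h hp⟩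
  choose K hK using h
  refine ⟨∑ i, |K i|, eventually_all.2 fun i => ?_⟩
  by_cases hp : p i
  · filter_upwards [hK i hp] with y hy _
    refine hy.trans (mul_le_mul_of_nonneg_right ?_ (Finset.sum_nonneg fun i _ => norm_nonneg _))
    exact (le_abs_self _).trans (Finset.single_le_sum (f := fun i => |K i|)
      (fun i _ => abs_nonneg _) (Finset.mem_univ i))
  · exact Eventually.of_forall fun y h => absurd h hp

/-- The Goursat problem for the Gibbons–Tsarev system. -/
theorem exists_gibbonsTsarev_solution {u₀ : ℂ} (hint : IntegrabilityAt V u₀)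
    {f l m : Fin N → ℂ → ℂ} (hf : ∀ i, AnalyticAt ℂ (f i) 0) (hl : ∀ i, AnalyticAt ℂ (l i) 0)
    (hm : ∀ i, AnalyticAt ℂ (m i) 0) (hf0 : ∀ i, f i 0 = u₀)
    (hdisp : ∀ i, ∀ᶠ s in 𝓝 0, bil (V (f i s)) ![1, m i s, l i s] ![1, m i s, l i s] = 0)
    (hdist : ∀ i j, i ≠ j → (l i 0, m i 0) ≠ (l j 0, m j 0)) :
    ∃ Y : (Fin N → ℂ) → Option (Fin N × Fin 3) → ℂ, AnalyticAt ℂ Y 0 ∧ Y 0 none = u₀ ∧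
      (∀ᶠ R in 𝓝 0, Regular V (Y R) ∧
        (∀ a, ∀ j ∉ frozen a, pd j (fun R => Y R a) R = rhs V (Y R) a j) ∧
        ∀ i, disp V i (Y R) = 0) ∧
      ∀ i, ∀ᶠ s in 𝓝 (0 : ℂ), Y (Pi.single i s) none = f i s ∧
        Y (Pi.single i s) (some (i, 1)) = m i s ∧ Y (Pi.single i s) (some (i, 2)) = l i s := by
  -- The Goursat data prescribe `u` only at the origin; the function `f i` enters through its
  -- derivative, as the value of `∂u/∂Rⁱ` on the `i`-th axis.
  set g : (Fin N → ℂ) → Option (Fin N × Fin 3) → ℂ := fun R a =>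
    match a with
    | none => u₀
    | some (i, c) => ![deriv (f i) (R i), m i (R i), l i (R i)] c with hg
  have hR : ∀ i, AnalyticAt ℂ (fun R : Fin N → ℂ => R i) 0 := fun i =>
    (ContinuousLinearMap.proj (R := ℂ) (φ := fun _ : Fin N => ℂ) i).analyticAt _
  have hcomp : ∀ {h : ℂ → ℂ} (i : Fin N), AnalyticAt ℂ h 0 →
      AnalyticAt ℂ (fun R : Fin N → ℂ => h (R i)) 0 := fun {h} i hh =>
    AnalyticAt.comp (g := h) (f := fun R : Fin N → ℂ => R i) (by simpa using hh) (hR i)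
  have hgan : AnalyticAt ℂ g 0 := by
    refine analyticAt_pi_iff.2 fun a => ?_
    rcases a with _ | ⟨i, c⟩
    · exact analyticAt_const
    · fin_cases c
      · exact hcomp i (hf i).deriv
      · exact hcomp i (hm i)
      · exact hcomp i (hl i)
  have hspeed : ∀ R i, speed (g R) i = ![1, m i (R i), l i (R i)] := by
    intro R i
    funext a
    fin_cases a <;> simp [speed, hg]
  have hreg : Regular V (g 0) := by
    refine ⟨hint.analytic, fun i j hij => ?_⟩
    have hn : ∀ i, bil (V u₀) (speed (g 0) i) (speed (g 0) i) = 0 := by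
      intro i
      have := (hdisp i).self_of_nhds
      rw [hf0] at this
      rw [hspeed]; exact this
    refine bil_ne_zero_of_null (hint.symm _) hint.det_ne_zero (by simp [hspeed]) (by simp [hspeed])
      ?_ (hn i) (hn j)
    intro h
    rw [hspeed, hspeed] at h
    apply hdist i j hij
    have h1 := congrFun h 1
    have h2 := congrFun h 2
    simp only [Pi.zero_apply, Matrix.cons_val] at h1 h2
    rw [h1, h2]
  obtain ⟨Y, hY, hY0, hrad, haxis⟩ := exists_euler_solution (S := frozen (N := N)) (F := rhs V)
    (g := g) hreg.analyticAt_rhs hgan (by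
      intro a R R' h
      rcases a with _ | ⟨i, c⟩
      · rfl
      · simp only [hg, h i (by simp [frozen])])
  rw [← hY0] at hreg
  have hint' : IntegrabilityAt V (Y 0 none) := by rw [hY0]; exact hint
  have hsing : ∀ i : Fin N, ContinuousAt (fun s : ℂ => (Pi.single i s : Fin N → ℂ)) 0 := fun i =>
    (continuous_single i).continuousAt
  have hsing0 : ∀ i : Fin N, (Pi.single i (0 : ℂ) : Fin N → ℂ) = 0 := fun i => Pi.single_zero i
  have hsev : ∀ (i : Fin N) {p : (Fin N → ℂ) → Prop}, (∀ᶠ R in 𝓝 0, p R) →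
      ∀ᶠ s : ℂ in 𝓝 0, p (Pi.single i s) := by
    intro i p hp
    have h := hsing i
    rw [ContinuousAt, hsing0] at h
    exact h.eventually hp
  have hYi : ∀ i, ∀ᶠ s : ℂ in 𝓝 0, ∀ c, Y (Pi.single i s) (some (i, c)) =
      ![deriv (f i) s, m i s, l i s] c := by
    intro i
    filter_upwards [hsev i haxis] with s hs c
    rw [hs (some (i, c)) (by
      intro j hj
      have : j ≠ i := fun h => hj (by simp [frozen, h])
      simp [this])]
    simp [hg]
  -- On the `i`-th axis the radial equation for `u` reads `s (d/ds) (u - f i) = 0`.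
  have hu : ∀ i, ∀ᶠ s : ℂ in 𝓝 0, Y (Pi.single i s) none = f i s := by
    intro i
    have hsan : ∀ s : ℂ, HasDerivAt (fun s : ℂ => (Pi.single i s : Fin N → ℂ)) (Pi.single i 1) s :=
      fun s => by
        refine hasDerivAt_pi.2 fun j => ?_
        by_cases h : j = i
        · subst h; simp only [Pi.single_eq_same]; exact hasDerivAt_id' s
        · simpa [h] using hasDerivAt_const s (0 : ℂ)
    have hYn : AnalyticAt ℂ (fun R => Y R none) 0 := analyticAt_pi_iff.1 hY none
    have hYSan : AnalyticAt ℂ (fun s : ℂ => Y (Pi.single i s) none) 0 := by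
      refine AnalyticAt.comp (g := fun R => Y R none) (f := fun s : ℂ => (Pi.single i s : Fin N → ℂ))
        (by rw [hsing0]; exact hYn) ?_
      exact (ContinuousLinearMap.single ℂ (fun _ : Fin N => ℂ) i).analyticAt 0
    have h1 := eventually_eq_zero_of_mul_deriv (h := fun s => Y (Pi.single i s) none - f i s)
      (hYSan.sub (hf i)) (by rw [hsing0, hY0, hf0]; simp [hg]) (by
        filter_upwards [hsev i hrad, hYi i, hsev i hYn.eventually_analyticAt,
          (hf i).eventually_analyticAt] with s h1 h2 h3 h4
        have h5 := h1 none
        have h6 : HasDerivAt (fun s : ℂ => Y (Pi.single i s) none)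
            (pd i (fun R => Y R none) (Pi.single i s)) s :=
          h3.differentiableAt.hasFDerivAt.comp_hasDerivAt s (hsan s)
        rw [(h6.fun_sub h4.differentiableAt.hasDerivAt).deriv]
        rw [Finset.sum_eq_single i (by
          intro j _ hj
          simp [hj]) (by simp [frozen])] at h5
        have h7 := h2 0
        simp only [Matrix.cons_val_zero] at h7
        simpa [rhs, h7] using h5)
    filter_upwards [h1] with s hs
    exact sub_eq_zero.1 hs
  obtain ⟨K₁, hK₁⟩ := dispBounded_uniform (V := V) (y₀ := Y 0)
    (p := fun x : Option (Fin N × Fin 3) × Fin N × Fin N =>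
      x.2.1 ∉ frozen x.1 ∧ x.2.2 ∉ frozen x.1 ∧ x.2.1 ≠ x.2.2)
    (f := fun x y => fderiv ℂ (fun y => rhs V y x.1 x.2.2) y (fun b => rhs V y b x.2.1) -
      fderiv ℂ (fun y => rhs V y x.1 x.2.1) y (fun b => rhs V y b x.2.2))
    (fun x hx => dispBounded_compatibility hint' hreg hx.1 hx.2.1 hx.2.2)
  obtain ⟨K₂, hK₂⟩ := dispBounded_uniform (V := V) (y₀ := Y 0)
    (p := fun x : Fin N × Fin N => x.1 ≠ x.2)
    (f := fun x y => fderiv ℂ (disp V x.1) y (fun b => rhs V y b x.2))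
    (by
      intro x hx
      have h0 : gram V (Y 0) x.1 x.2 ≠ 0 := hreg.ne_zero _ _ hx
      refine ((dispBounded_disp x.1).mul ((((continuousAt_coord (y := Y 0) (some (x.2, 0))).fun_mul
        (hreg.analyticAt_gram (analyticAt_matDeriv hreg.analytic) x.1 x.1).continuousAt).div
        (hreg.analyticAt_gram hreg.analytic x.1 x.2).continuousAt h0))).congr ?_
      filter_upwards [hreg.eventually] with z hz
      simp only [Pi.div_apply]
      rw [fderiv_disp hint.symm hz hx]
      ring)
  have hmain := involutive_of_radial (S := frozen (N := N)) (T := fun i : Fin N => {i})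
    (F := rhs V) (c := disp V) hY hreg.analyticAt_rhs (fun i => hreg.analyticAt_disp i) hrad
    (by
      filter_upwards [hreg.eventually] with z hz a b j k h1 h2 h3 h4
      exact fderiv_rhs_eq_zero hz h1 h2 h3 h4)
    ⟨K₁, by
      filter_upwards [hK₁] with z hz a j k h1 h2 h3
      exact hz (a, j, k) ⟨h1, h2, h3⟩⟩
    (by
      filter_upwards [hreg.eventually] with z hz i b j h1 h2
      exact fderiv_disp_eq_zero hz (by simpa using h1) h2)
    ⟨K₂, by
      filter_upwards [hK₂] with z hz i j h1
      refine hz (i, j) ?_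
      intro h
      exact h1 (by simp [show i = j from h])⟩
    (by
      refine eventually_all.2 fun i => ?_
      -- The `i`-th constraint starts from the `i`-th axis, where it is the dispersion relation of
      -- the data.
      have h1 : ∀ᶠ s : ℂ in 𝓝 0, disp V i (Y (Pi.single i s)) = 0 := by
        filter_upwards [hu i, hYi i, hdisp i] with s h1 h2 h3
        have h4 : speed (Y (Pi.single i s)) i = ![1, m i s, l i s] := by
          funext a
          fin_cases a <;> simp [speed, h2]
        rw [disp, h1, h4, h3]
      have h2 : Tendsto (fun R : Fin N → ℂ => R i) (𝓝 0) (𝓝 0) := by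
        simpa using (continuous_apply i).tendsto (0 : Fin N → ℂ)
      filter_upwards [h2.eventually h1] with R hR hz
      have : R = Pi.single i (R i) := by
        funext j
        by_cases h : j = i
        · subst h; simp
        · rw [hz j (by simpa using h)]; simp [h]
      rw [this]; simpa using hR)
  refine ⟨Y, hY, by rw [hY0], ?_, fun i => ?_⟩
  · filter_upwards [hmain, hY.continuousAt.eventually hreg.eventually] with R h1 h2
    exact ⟨h2, h1.1, h1.2⟩
  · filter_upwards [hu i, hYi i] with s h1 h2
    exact ⟨h1, by simpa using h2 1, by simpa using h2 2⟩

end Reduction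

/-! ### Partial derivatives of products, sums and composites -/

section pd

variable {n : ℕ} {f g : (Fin n → ℂ) → ℂ} {z : Fin n → ℂ}

theorem pd_fun_mul (hf : DifferentiableAt ℂ f z) (hg : DifferentiableAt ℂ g z) (j : Fin n) :
    pd j (fun w => f w * g w) z = pd j f z * g z + f z * pd j g z := by
  unfold pd
  rw [fderiv_fun_mul hf hg]
  simp only [add_apply, smul_apply, smul_eq_mul]
  ring

theorem pd_fun_sum {ι : Type*} {s : Finset ι} {f : ι → (Fin n → ℂ) → ℂ}
    (hf : ∀ i ∈ s, DifferentiableAt ℂ (f i) z) (j : Fin n) :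
    pd j (fun w => ∑ i ∈ s, f i w) z = ∑ i ∈ s, pd j (f i) z := by
  unfold pd
  rw [fderiv_fun_sum hf, sum_apply]

theorem pd_const (c : ℂ) (j : Fin n) : pd j (fun _ => c) z = 0 := by
  simp [pd]

theorem pd_scalar_comp {A : ℂ → ℂ} (hA : DifferentiableAt ℂ A (f z)) (hf : DifferentiableAt ℂ f z)
    (j : Fin n) : pd j (fun w => A (f w)) z = deriv A (f z) * pd j f z := by
  have h := hA.hasDerivAt.comp_hasFDerivAt z hf.hasFDerivAt
  unfold pd
  rw [show (fun w => A (f w)) = A ∘ f from rfl, h.fderiv]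
  simp

theorem pd_pd_scalar_comp {A : ℂ → ℂ} (hA : AnalyticAt ℂ A (f z)) (hf : AnalyticAt ℂ f z)
    (j k : Fin n) : pd j (pd k fun w => A (f w)) z =
      deriv (deriv A) (f z) * pd k f z * pd j f z + deriv A (f z) * pd j (pd k f) z := by
  have h : (pd k fun w => A (f w)) =ᶠ[𝓝 z] fun w => deriv A (f w) * pd k f w := by
    filter_upwards [hf.continuousAt.eventually hA.eventually_analyticAt,
      hf.eventually_analyticAt] with w h1 h2
    exact pd_scalar_comp h1.differentiableAt h2.differentiableAt k
  rw [pd_congr h, pd_fun_mul (f := fun w => deriv A (f w)) (hA.deriv.comp hf).differentiableAt (hf.pd k).differentiableAt,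
    pd_scalar_comp hA.deriv.differentiableAt hf.differentiableAt]
  ring

theorem pd_comp_sum {m : ℕ} {G : (Fin m → ℂ) → ℂ} {Y : (Fin n → ℂ) → Fin m → ℂ}
    (hG : DifferentiableAt ℂ G (Y z)) (hY : DifferentiableAt ℂ Y z) (j : Fin n) :
    pd j (fun w => G (Y w)) z = ∑ k, pd j (fun w => Y w k) z * pd k G (Y z) := by
  rw [pd_comp hG hY, fderiv_apply_eq_sum_pd]

end pd

/-! ### The equation on solutions of hydrodynamic systems -/

namespace QuadPDE

variable {E : QuadPDE}

theorem V_isSymm (u : ℂ) : (E.V u).IsSymm := by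
  ext i j; fin_cases i <;> fin_cases j <;> rfl

/-- The coefficient functions are holomorphic at a point. -/
structure AnalyticCoeffAt (E : QuadPDE) (u : ℂ) : Prop where
  a : AnalyticAt ℂ E.a u
  b : AnalyticAt ℂ E.b u
  c : AnalyticAt ℂ E.c u
  p : AnalyticAt ℂ E.p u
  q : AnalyticAt ℂ E.q u
  r : AnalyticAt ℂ E.r u

theorem Holomorphic.analyticCoeffAt {D : Set ℂ} (h : E.Holomorphic D) {u : ℂ} (hu : u ∈ D) :
    E.AnalyticCoeffAt u :=
  ⟨h.1 u hu, h.2.1 u hu, h.2.2.1 u hu, h.2.2.2.1 u hu, h.2.2.2.2.1 u hu, h.2.2.2.2.2 u hu⟩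

theorem AnalyticCoeffAt.analyticAt_V {u : ℂ} (h : E.AnalyticCoeffAt u) (i j : Fin 3) :
    AnalyticAt ℂ (fun s => E.V s i j) u := by
  fin_cases i <;> fin_cases j
  exacts [h.a.deriv, h.p.deriv, h.q.deriv, h.p.deriv, h.b.deriv, h.r.deriv, h.q.deriv, h.r.deriv,
    h.c.deriv]

theorem dispersion_eq_bil (u l m : ℂ) :
    E.dispersion u l m = bil (E.V u) ![1, m, l] ![1, m, l] := by
  simp only [dispersion, bil, Fin.sum_univ_three, V, Matrix.of_apply, Matrix.cons_val]
  ring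

/-- The left-hand side of the equation. -/
noncomputable def lhs (E : QuadPDE) (u : (Fin 3 → ℂ) → ℂ) (z : Fin 3 → ℂ) : ℂ :=
  pd 0 (pd 0 fun w => E.a (u w)) z + pd 1 (pd 1 fun w => E.b (u w)) z
      + pd 2 (pd 2 fun w => E.c (u w)) z + 2 * pd 1 (pd 0 fun w => E.p (u w)) z
      + 2 * pd 2 (pd 0 fun w => E.q (u w)) z + 2 * pd 2 (pd 1 fun w => E.r (u w)) z

theorem lhs_eq {u : (Fin 3 → ℂ) → ℂ} {z : Fin 3 → ℂ} (hE : E.AnalyticCoeffAt (u z))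
    (hu : AnalyticAt ℂ u z) :
    E.lhs u z = ∑ a, ∑ b, (matDeriv E.V (u z) a b * pd a u z * pd b u z +
      E.V (u z) a b * pd b (pd a u) z) := by
  rw [lhs, pd_pd_scalar_comp hE.a hu, pd_pd_scalar_comp hE.b hu, pd_pd_scalar_comp hE.c hu,
    pd_pd_scalar_comp hE.p hu, pd_pd_scalar_comp hE.q hu, pd_pd_scalar_comp hE.r hu]
  simp only [Fin.sum_univ_three, V, matDeriv, Matrix.of_apply, Matrix.cons_val]
  rw [pd_comm hu 0 1, pd_comm hu 0 2, pd_comm hu 1 2]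
  ring

variable {N : ℕ}

/-- The vector `(1, μⁱ, λⁱ)`. -/
def direction (lam mu : Fin N → (Fin N → ℂ) → ℂ) (i : Fin N) (R : Fin N → ℂ) : Fin 3 → ℂ :=
  ![1, mu i R, lam i R]

theorem direction_zero (lam mu : Fin N → (Fin N → ℂ) → ℂ) (i : Fin N) (R : Fin N → ℂ) :
    direction lam mu i R 0 = 1 := rfl

theorem analyticAt_direction {lam mu : Fin N → (Fin N → ℂ) → ℂ} {R : Fin N → ℂ}
    (hl : ∀ i, AnalyticAt ℂ (lam i) R) (hm : ∀ i, AnalyticAt ℂ (mu i) R) (i : Fin N) (a : Fin 3) :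
    AnalyticAt ℂ (fun R => direction lam mu i R a) R := by
  fin_cases a
  exacts [analyticAt_const, hm i, hl i]

theorem SolvesHydro.pd_eq {lam mu : Fin N → (Fin N → ℂ) → ℂ} {W : Set (Fin 3 → ℂ)}
    {R : (Fin 3 → ℂ) → (Fin N → ℂ)} (h : SolvesHydro lam mu W R) {z : Fin 3 → ℂ} (hz : z ∈ W)
    (i : Fin N) (a : Fin 3) :
    pd a (fun w => R w i) z = direction lam mu i (R z) a * pd 0 (fun w => R w i) z := by
  fin_cases a
  · simp [direction]
  · exact (h z hz i).2
  · exact (h z hz i).1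

/-- The derivative of the direction of the `i`-th phase along the `j`-th one. -/
noncomputable def pdDirection (lam mu : Fin N → (Fin N → ℂ) → ℂ) (j i : Fin N) (R : Fin N → ℂ) :
    Fin 3 → ℂ := fun a => pd j (fun R => direction lam mu i R a) R

/-- The interaction of the `i`-th and `j`-th phases. -/
noncomputable def interaction (E : QuadPDE) (u : (Fin N → ℂ) → ℂ)
    (lam mu : Fin N → (Fin N → ℂ) → ℂ) (i j : Fin N) (R : Fin N → ℂ) : ℂ :=
  bil (matDeriv E.V (u R)) (direction lam mu i R) (direction lam mu j R) * pd i u R * pd j u R +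
  bil (E.V (u R)) (direction lam mu i R) (direction lam mu j R) * pd j (pd i u) R +
  pd i u R * (bil (E.V (u R)) (pdDirection lam mu j i R) (direction lam mu j R) +
    bil (E.V (u R)) (direction lam mu i R) (pdDirection lam mu j i R))

/-- All derivatives of the phases reduce to `Rⁱ_x` and `Rⁱ_xx`. The second ones occur only along
`X_i ⊗ X_i`, so they meet the dispersion relation; everything else is quadratic in the slopes. -/
theorem lhs_hydro {u : (Fin N → ℂ) → ℂ} {lam mu : Fin N → (Fin N → ℂ) → ℂ}
    {W : Set (Fin 3 → ℂ)} {R : (Fin 3 → ℂ) → (Fin N → ℂ)} (hW : IsOpen W)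
    (h : SolvesHydro lam mu W R) {z : Fin 3 → ℂ} (hz : z ∈ W)
    (hE : E.AnalyticCoeffAt (u (R z))) (hu : AnalyticAt ℂ u (R z))
    (hl : ∀ i, AnalyticAt ℂ (lam i) (R z)) (hm : ∀ i, AnalyticAt ℂ (mu i) (R z))
    (hR : AnalyticAt ℂ R z) :
    E.lhs (fun w => u (R w)) z =
      ∑ i, (bil (E.V (u (R z))) (direction lam mu i (R z)) (direction lam mu i (R z)) *
        pd i u (R z) * pd 0 (pd 0 fun w => R w i) z +
      ∑ j, pd 0 (fun w => R w i) z * pd 0 (fun w => R w j) z *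
        E.interaction u lam mu i j (R z)) := by
  have hRi := fun i => analyticAt_pi_iff.1 hR i
  have hX := fun i a => analyticAt_direction hl hm i a
  have hXR : ∀ i a, AnalyticAt ℂ (fun w => direction lam mu i (R w) a) z := fun i a =>
    AnalyticAt.comp (g := fun R => direction lam mu i R a) (f := R) (hX i a) hR
  have hpR : ∀ i, AnalyticAt ℂ (fun w => pd i u (R w)) z := fun i => (hu.pd i).comp hR
  have hρ := fun i => (hRi i).pd 0
  -- derivatives of functions of the phases
  have hcomp : ∀ {G : (Fin N → ℂ) → ℂ}, AnalyticAt ℂ G (R z) → ∀ a, pd a (fun w => G (R w)) z =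
      ∑ j, direction lam mu j (R z) a * pd 0 (fun w => R w j) z * pd j G (R z) := by
    intro G hG a
    rw [pd_comp_sum hG.differentiableAt hR.differentiableAt]
    exact Finset.sum_congr rfl fun j _ => by rw [h.pd_eq hz]
  have hgev : ∀ a, pd a (fun w => u (R w)) =ᶠ[𝓝 z] fun w =>
      ∑ i, direction lam mu i (R w) a * pd 0 (fun w => R w i) w * pd i u (R w) := by
    intro a
    filter_upwards [hW.mem_nhds hz, hR.eventually_analyticAt,
      hR.continuousAt.eventually hu.eventually_analyticAt] with w h1 h2 h3
    rw [pd_comp_sum h3.differentiableAt h2.differentiableAt]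
    exact Finset.sum_congr rfl fun j _ => by rw [h.pd_eq h1]
  -- Mixed second derivatives of `Rⁱ` are eliminated by differentiating `Rⁱ_b = X_i(b) Rⁱ_x` in `x`.
  have hρb : ∀ i b, pd b (pd 0 fun w => R w i) z =
      (∑ j, pd 0 (fun w => R w j) z * pdDirection lam mu j i (R z) b) * pd 0 (fun w => R w i) z +
        direction lam mu i (R z) b * pd 0 (pd 0 fun w => R w i) z := by
    intro i b
    have h1 : (pd b fun w => R w i) =ᶠ[𝓝 z] fun w =>
        direction lam mu i (R w) b * pd 0 (fun w => R w i) w := by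
      filter_upwards [hW.mem_nhds hz] with w hw using h.pd_eq hw i b
    rw [pd_comm (hRi i), pd_congr h1, pd_fun_mul (hXR i b).differentiableAt
      (hρ i).differentiableAt, hcomp (hX i b)]
    simp only [direction_zero, one_mul, pdDirection]
  have hh : ∀ a b, pd b (pd a fun w => u (R w)) z = ∑ i, (
      pd i u (R z) * pd 0 (pd 0 fun w => R w i) z * direction lam mu i (R z) a *
        direction lam mu i (R z) b + ∑ j, pd 0 (fun w => R w i) z * pd 0 (fun w => R w j) z *
        (pd j (pd i u) (R z) * direction lam mu i (R z) a * direction lam mu j (R z) b +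
          pd i u (R z) * direction lam mu i (R z) a * pdDirection lam mu j i (R z) b +
          pd i u (R z) * pdDirection lam mu j i (R z) a * direction lam mu j (R z) b)) := by
    intro a b
    rw [pd_congr (hgev a), pd_fun_sum fun i _ =>
      (((hXR i a).fun_mul (hρ i)).fun_mul (hpR i)).differentiableAt]
    refine Finset.sum_congr rfl fun i _ => ?_
    rw [pd_fun_mul ((hXR i a).fun_mul (hρ i)).differentiableAt (hpR i).differentiableAt,
      pd_fun_mul (hXR i a).differentiableAt (hρ i).differentiableAt, hcomp (hX i a),
      hcomp (hu.pd i), hρb]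
    simp only [pdDirection, Finset.mul_sum, Finset.sum_mul, add_mul, mul_add,
      Finset.sum_add_distrib]
    have e : ∀ {A B C D A' B' C' D' : ℂ}, A = A' → B = B' → C = C' → D = D' →
      A + (B + C) + D = C' + (D' + B' + A') := by
      rintro A B C D _ _ _ _ rfl rfl rfl rfl; ring
    refine e ?_ ?_ ?_ ?_
    · exact Finset.sum_congr rfl fun j _ => by ring
    · exact Finset.sum_congr rfl fun j _ => by ring
    · ring
    · exact Finset.sum_congr rfl fun j _ => by ring
  rw [lhs_eq (u := fun w => u (R w)) hE (hu.comp hR)]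
  have hg := fun a => hcomp hu a
  have hS : ∀ a b, matDeriv E.V (u (R z)) a b * pd a (fun w => u (R w)) z *
      pd b (fun w => u (R w)) z + E.V (u (R z)) a b * pd b (pd a fun w => u (R w)) z =
      ∑ i, (E.V (u (R z)) a b * direction lam mu i (R z) a * direction lam mu i (R z) b *
        pd i u (R z) * pd 0 (pd 0 fun w => R w i) z + ∑ j, pd 0 (fun w => R w i) z *
        pd 0 (fun w => R w j) z * (
        matDeriv E.V (u (R z)) a b * direction lam mu i (R z) a * direction lam mu j (R z) b *
          pd i u (R z) * pd j u (R z) +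
        E.V (u (R z)) a b * direction lam mu i (R z) a * direction lam mu j (R z) b *
          pd j (pd i u) (R z) + pd i u (R z) * (
        E.V (u (R z)) a b * pdDirection lam mu j i (R z) a * direction lam mu j (R z) b +
        E.V (u (R z)) a b * direction lam mu i (R z) a * pdDirection lam mu j i (R z) b))) := by
    intro a b
    rw [hh, hg, hg, mul_assoc (matDeriv E.V (u (R z)) a b), Finset.sum_mul_sum, Finset.mul_sum,
      Finset.mul_sum, ← Finset.sum_add_distrib]
    refine Finset.sum_congr rfl fun i _ => ?_
    rw [mul_add, Finset.mul_sum, Finset.mul_sum, add_left_comm, ← Finset.sum_add_distrib]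
    refine congrArg₂ _ (by ring) (Finset.sum_congr rfl fun j _ => by ring)
  simp only [hS, interaction, bil]
  generalize matDeriv E.V (u (R z)) = M'
  generalize E.V (u (R z)) = M
  have comm3 : ∀ F : Fin 3 → Fin 3 → Fin N → ℂ, ∑ a, ∑ b, ∑ i, F a b i =
      ∑ i, ∑ a, ∑ b, F a b i := by
    intro F
    rw [Finset.sum_comm]
    conv_lhs => enter [2, b]; rw [Finset.sum_comm]
    rw [Finset.sum_comm]
    exact Finset.sum_congr rfl fun i _ => Finset.sum_comm
  rw [comm3]
  refine Finset.sum_congr rfl fun i _ => ?_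
  simp only [Finset.sum_add_distrib]
  refine congrArg₂ _ ?_ ?_
  · simp only [Finset.sum_mul]
  · rw [comm3]
    refine Finset.sum_congr rfl fun j _ => ?_
    simp only [Finset.sum_mul, Finset.mul_sum, ← Finset.sum_add_distrib]

end QuadPDE

theorem pd_bil {N : ℕ} {V : ℂ → Matrix (Fin 3) (Fin 3) ℂ} {u : (Fin N → ℂ) → ℂ}
    {x y : (Fin N → ℂ) → Fin 3 → ℂ} {R : Fin N → ℂ}
    (hV : ∀ a b, DifferentiableAt ℂ (fun s => V s a b) (u R)) (hu : DifferentiableAt ℂ u R)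
    (hx : ∀ a, DifferentiableAt ℂ (fun R => x R a) R)
    (hy : ∀ a, DifferentiableAt ℂ (fun R => y R a) R) (j : Fin N) :
    pd j (fun R => bil (V (u R)) (x R) (y R)) R =
      pd j u R * bil (matDeriv V (u R)) (x R) (y R) +
        bil (V (u R)) (fun a => pd j (fun R => x R a) R) (y R) +
        bil (V (u R)) (x R) (fun a => pd j (fun R => y R a) R) := by
  have hVu : ∀ a b, DifferentiableAt ℂ (fun R => V (u R) a b) R := fun a b =>
    DifferentiableAt.comp R (g := fun s => V s a b) (hV a b) hu
  unfold bil
  rw [pd_fun_sum fun a _ => DifferentiableAt.fun_sum fun b _ =>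
    ((hVu a b).fun_mul (hx a)).fun_mul (hy b)]
  simp only [Finset.mul_sum, ← Finset.sum_add_distrib]
  refine Finset.sum_congr rfl fun a _ => ?_
  rw [pd_fun_sum fun b _ => ((hVu a b).fun_mul (hx a)).fun_mul (hy b)]
  refine Finset.sum_congr rfl fun b _ => ?_
  rw [pd_fun_mul ((hVu a b).fun_mul (hx a)) (hy b), pd_fun_mul (hVu a b) (hx a),
    pd_scalar_comp (A := fun s => V s a b) (hV a b) hu]
  simp only [matDeriv, Matrix.of_apply]
  ring

/-! ### Sufficiency of the criterion -/

namespace QuadPDE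

open Reduction

variable {E : QuadPDE} {D : Set ℂ}

theorem integrabilityAt (hD : IsOpen D) (hE : E.Holomorphic D) (hdet : E.Nondegenerate D)
    {k : ℂ → ℂ} (hk : ∀ u ∈ D, matDeriv (matDeriv E.V) u =
      logDeriv (fun s => (E.V s).det) u • matDeriv E.V u + k u • E.V u) {u : ℂ} (hu : u ∈ D) :
    IntegrabilityAt E.V u :=
  ⟨V_isSymm, (hE.analyticCoeffAt hu).analyticAt_V, hdet u hu, k, by
    filter_upwards [hD.mem_nhds hu] with w hw using hk w hw⟩

/-- A solution of the Goursat problem is a reduction: the speed equations give commutativity, the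
dispersion relation removes the terms with `Rⁱ_xx`, and every interaction vanishes separately. -/
theorem integrable_of_ode (hD : IsOpen D) (hE : E.Holomorphic D) (hdet : E.Nondegenerate D)
    (hk : ∃ k : ℂ → ℂ, ∀ u ∈ D, matDeriv (matDeriv E.V) u =
      logDeriv (fun s => (E.V s).det) u • matDeriv E.V u + k u • E.V u) : E.Integrable D := by
  obtain ⟨k, hk⟩ := hk
  intro N u₀ f l m hdata
  obtain ⟨Y, hY, hY0, hsol, haxis⟩ := exists_gibbonsTsarev_solution
    (integrabilityAt hD hE hdet hk hdata.mem) hdata.analytic_f hdata.analytic_l hdata.analytic_m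
    hdata.value (by
      intro i
      filter_upwards [hdata.dispersion_eq i] with s hs
      rw [← dispersion_eq_bil, hs]) hdata.distinct
  have hYD : ∀ᶠ R in 𝓝 0, Y R none ∈ D := by
    have h : ContinuousAt (fun R => Y R none) 0 := (analyticAt_pi_iff.1 hY none).continuousAt
    exact h.eventually (by beta_reduce; rw [hY0]; exact hD.mem_nhds hdata.mem)
  obtain ⟨U, hU, hUo, h0⟩ := eventually_nhds_iff.1 (hsol.and (hY.eventually_analyticAt.and hYD))
  have hYa : ∀ R ∈ U, ∀ a, AnalyticAt ℂ (fun R => Y R a) R := fun R hR =>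
    analyticAt_pi_iff.1 (hU R hR).2.1
  refine ⟨U, fun R => Y R none, fun i R => Y R (some (i, 2)), fun i R => Y R (some (i, 1)), h0,
    ⟨hUo, fun R hR => hYa R hR _, fun i R hR => hYa R hR _, fun i R hR => hYa R hR _,
      fun R hR => (hU R hR).2.2, ?_, ?_⟩, ?_⟩
  · intro R hR i j hij
    have h1 := fun c => (hU R hR).1.2.1 (some (i, c)) j (by simp [frozen, hij.symm])
    rw [h1, h1]
    simp only [rhs, hij.symm, if_false, speed]
    simp only [Fin.isValue, Fin.reduceEq, if_false]
    ring
  · intro W R hW hR hmap hsolves z hz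
    have hRz := hmap hz
    have hUz : ∀ᶠ S in 𝓝 (R z), S ∈ U := hUo.mem_nhds hRz
    have hreg := (hU _ hRz).1.1
    have key := lhs_hydro (E := E) (u := fun R => Y R none) hW hsolves hz
      (hE.analyticCoeffAt (hU _ hRz).2.2) (hYa _ hRz _) (fun i => hYa _ hRz _)
      (fun i => hYa _ hRz _) (hR z hz)
    refine key.trans ?_
    have hdir : ∀ S i, direction (fun i R => Y R (some (i, 2))) (fun i R => Y R (some (i, 1))) i S =
        speed (Y S) i := by
      intro S i
      funext a
      fin_cases a <;> simp [speed, direction]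
    have hpu : ∀ i, pd i (fun R => Y R none) =ᶠ[𝓝 (R z)] fun S => Y S (some (i, 0)) := by
      intro i
      filter_upwards [hUz] with S hS
      rw [(hU S hS).1.2.1 none i (by simp [frozen])]
      rfl
    have hpu' := fun i => (hpu i).eq_of_nhds
    refine Finset.sum_eq_zero fun i _ => ?_
    have hdisp : bil (E.V (Y (R z) none)) (speed (Y (R z)) i) (speed (Y (R z)) i) = 0 :=
      (hU _ hRz).1.2.2 i
    rw [hdir, hdisp, zero_mul, zero_mul, zero_add]
    refine Finset.sum_eq_zero fun j _ => ?_
    refine mul_eq_zero_of_right _ ?_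
    unfold interaction
    rw [hdir, hdir, hpu', hpu', pd_congr (hpu i)]
    -- On the diagonal the interaction is `v_j` times the derivative of the dispersion relation
    -- along `R_j`. Off it, the two terms with the derivative of `X_i` cancel on null vectors, and
    -- the velocity equation cancels the rest.
    by_cases hij : j = i
    · subst hij
      have h1 : pd j (fun S => bil (E.V (Y S none)) (speed (Y S) j) (speed (Y S) j)) (R z) = 0 := by
        rw [pd_congr (g := fun _ => 0) _ j, pd_const]
        filter_upwards [hUz] with S hS using (hU S hS).1.2.2 j
      have hsp : ∀ a, DifferentiableAt ℂ (fun S => speed (Y S) j a) (R z) := fun a =>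
        (AnalyticAt.comp (g := fun y => speed y j a) (f := Y) (analyticAt_speed j a)
          (hU _ hRz).2.1).differentiableAt
      rw [pd_bil (u := fun S => Y S none) (fun a b =>
        ((hE.analyticCoeffAt (hU _ hRz).2.2).analyticAt_V a b).differentiableAt)
        (hYa _ hRz _).differentiableAt hsp hsp] at h1
      have h2 : pdDirection (fun i R => Y R (some (i, 2))) (fun i R => Y R (some (i, 1))) j j (R z)
          = fun a => pd j (fun S => speed (Y S) j a) (R z) := by
        funext a; unfold pdDirection; simp only [hdir]
      rw [h2, ← pd_congr (hpu j)]
      rw [hpu' j] at h1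
      have h3 : pd j (pd j fun R => Y R none) (R z) = pd j (fun S => Y S (some (j, 0))) (R z) :=
        pd_congr (hpu j) j
      rw [hdisp]
      linear_combination Y (R z) (some (j, 0)) * h1
    · have hne := hreg.ne_zero i j (Ne.symm hij)
      have h1 := fun c => (hU _ hRz).1.2.1 (some (i, c)) j (by simp [frozen, hij])
      have h2 : pdDirection (fun i R => Y R (some (i, 2))) (fun i R => Y R (some (i, 1))) j i (R z)
          = (-(bil (matDeriv E.V (Y (R z) none)) (speed (Y (R z)) i) (speed (Y (R z)) i) /
        (2 * bil (E.V (Y (R z) none)) (speed (Y (R z)) i) (speed (Y (R z)) j))) *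
          Y (R z) (some (j, 0))) • (speed (Y (R z)) j - speed (Y (R z)) i) := by
        funext a
        unfold pdDirection
        simp only [hdir, Pi.smul_apply, Pi.sub_apply, smul_eq_mul]
        by_cases ha : a = 0
        · subst ha
          simp [speed, pd_const]
        · have h3 : (fun S => speed (Y S) i a) = fun S => Y S (some (i, a)) := by
            funext S; simp [speed, ha]
          rw [h3, h1]
          simp only [rhs, hij, ha, if_false]
      rw [h2, h1]
      have hdj : bil (E.V (Y (R z) none)) (speed (Y (R z)) j) (speed (Y (R z)) j) = 0 :=
        (hU _ hRz).1.2.2 j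
      simp only [rhs, hij, if_false, if_true, bil_smul_left, bil_smul_right, bil_sub_left,
        bil_sub_right, hdisp, hdj]
      field_simp
      ring
  · intro i
    filter_upwards [haxis i] with s hs
    exact ⟨hs.1, hs.2.2, hs.2.1⟩

end QuadPDE

/-! ### Waves from the hodograph equations -/

/-- There are as many equations as unknowns, so injectivity of the partial Jacobian already gives
the invertibility required by the implicit function theorem. -/
theorem exists_implicit {n m : ℕ} {G : (Fin n → ℂ) × (Fin m → ℂ) → Fin m → ℂ}
    {X : Fin n → ℂ} {R : Fin m → ℂ} (hG : AnalyticAt ℂ G (X, R)) (h0 : G (X, R) = 0)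
    (hinj : ∀ v : Fin m → ℂ, (∀ i, ∑ j, v j * pd j (fun S => G (X, S) i) R = 0) → v = 0) :
    ∃ r : (Fin n → ℂ) → Fin m → ℂ, AnalyticAt ℂ r X ∧ r X = R ∧ ∀ᶠ Y in 𝓝 X, G (Y, r Y) = 0 := by
  have happ : ∀ v i, (fderiv ℂ G (X, R) ∘L .inr ℂ (Fin n → ℂ) (Fin m → ℂ)) v i =
      ∑ j, v j * pd j (fun S => G (X, S) i) R := by
    intro v i
    have h1 : HasFDerivAt (fun S : Fin m → ℂ => (X, S))
        (ContinuousLinearMap.inr ℂ (Fin n → ℂ) (Fin m → ℂ)) R := hasFDerivAt_prodMk_right X R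
    have h2 := hG.differentiableAt.hasFDerivAt.comp R h1
    have h3 := (hasFDerivAt_pi'.1 h2 i).fderiv
    have h4 : fderiv ℂ (fun S => G (X, S) i) R v =
        (fderiv ℂ G (X, R) ∘L .inr ℂ (Fin n → ℂ) (Fin m → ℂ)) v i := by
      rw [show (fun S => G (X, S) i) = fun S => (G ∘ fun S => (X, S)) S i from rfl, h3]
      rfl
    rw [← h4, fderiv_apply_eq_sum_pd]
  have hinv : (fderiv ℂ G (X, R) ∘L .inr ℂ (Fin n → ℂ) (Fin m → ℂ)).IsInvertible := by
    set L := fderiv ℂ G (X, R) ∘L .inr ℂ (Fin n → ℂ) (Fin m → ℂ)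
    have hLinj : Function.Injective (L : (Fin m → ℂ) →ₗ[ℂ] (Fin m → ℂ)) := by
      refine (injective_iff_map_eq_zero _).2 fun v hv => ?_
      refine hinj v fun i => ?_
      rw [← happ, show L v = 0 from hv]
      rfl
    refine ⟨(LinearEquiv.ofInjectiveEndo _ hLinj).toContinuousLinearEquiv, ?_⟩
    ext v : 1
    rfl
  have hC : ContDiffAt ℂ ⊤ G (X, R) := hG.contDiffAt
  refine ⟨hC.implicitFunction (by simp) hinv, ?_, hC.implicitFunction_apply_self _ hinv, ?_⟩
  · exact ContDiffAt.analyticAt (hC.contDiffAt_implicitFunction (by simp) hinv)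
  · have := hC.eventually_apply_implicitFunction (by simp) hinv
    rw [h0] at this
    exact this

/-- Waves of a commuting pair of systems of hydrodynamic type: the phases outside `A` are constant,
those in `A` are determined by the hodograph equations. -/
theorem exists_wave {N : ℕ} {ξ : Fin N → (Fin N → ℂ) → Fin 3 → ℂ} {R₀ : Fin N → ℂ}
    {X₀ : Fin 3 → ℂ} (A : Finset (Fin N)) {η : Fin N → ℂ → ℂ}
    (hξ : ∀ i a, AnalyticAt ℂ (fun R => ξ i R a) R₀) (hη : ∀ i, AnalyticAt ℂ (η i) (R₀ i))
    (hη0 : ∀ i ∈ A, ∀ k ∈ A, i ≠ k → ∀ s, η i s = 0)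
    (hcross : ∀ᶠ R in 𝓝 R₀, ∀ i ∈ A, ∀ k ∈ A, i ≠ k → ∃ γ : ℂ, ∀ a,
      pd k (fun R => ξ i R a) R = γ * (ξ k R a - ξ i R a))
    (h0 : ∀ i ∈ A, ∑ a, X₀ a * ξ i R₀ a = η i (R₀ i))
    (hd : ∀ i ∈ A, deriv (η i) (R₀ i) - ∑ a, X₀ a * pd i (fun R => ξ i R a) R₀ ≠ 0) :
    ∃ R : (Fin 3 → ℂ) → Fin N → ℂ, AnalyticAt ℂ R X₀ ∧ R X₀ = R₀ ∧ ∀ᶠ X in 𝓝 X₀,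
      (∀ i ∈ A, deriv (η i) (R X i) - ∑ a, X a * pd i (fun R => ξ i R a) (R X) ≠ 0 ∧
        ∀ a, pd a (fun X => R X i) X =
          ξ i (R X) a / (deriv (η i) (R X i) - ∑ a, X a * pd i (fun R => ξ i R a) (R X))) ∧
      ∀ i ∉ A, ∀ a, pd a (fun X => R X i) X = 0 := by
  classical
  set G : (Fin 3 → ℂ) × (Fin N → ℂ) → Fin N → ℂ := fun p i =>
    if i ∈ A then η i (p.2 i) - ∑ a, p.1 a * ξ i p.2 a else p.2 i - R₀ i with hGdef
  have hproj : ∀ (R : Fin N → ℂ) i, AnalyticAt ℂ (fun R : Fin N → ℂ => R i) R := fun R i =>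
    (ContinuousLinearMap.proj (R := ℂ) (φ := fun _ : Fin N => ℂ) i).analyticAt _
  have hproj3 : ∀ (R : Fin 3 → ℂ) i, AnalyticAt ℂ (fun R : Fin 3 → ℂ => R i) R := fun R i =>
    (ContinuousLinearMap.proj (R := ℂ) (φ := fun _ : Fin 3 => ℂ) i).analyticAt _
  have hpdproj : ∀ {n : ℕ} (R : Fin n → ℂ) i j, pd j (fun R : Fin n → ℂ => R i) R =
      if i = j then 1 else 0 := by
    intro n R i j
    have h := (ContinuousLinearMap.proj (R := ℂ) (φ := fun _ : Fin n => ℂ) i).hasFDerivAt (x := R)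
    unfold pd
    have h2 : fderiv ℂ (fun R : Fin n → ℂ => R i) R = _ := h.fderiv
    rw [h2]
    simp [Pi.single_apply]
  have hfst : ∀ a, AnalyticAt ℂ (fun p : (Fin 3 → ℂ) × (Fin N → ℂ) => p.1 a) (X₀, R₀) := fun a =>
    AnalyticAt.comp (g := fun X : Fin 3 → ℂ => X a) (hproj3 _ a) analyticAt_fst
  have hsnd : ∀ i, AnalyticAt ℂ (fun p : (Fin 3 → ℂ) × (Fin N → ℂ) => p.2 i) (X₀, R₀) := fun i =>
    AnalyticAt.comp (g := fun X : Fin N → ℂ => X i) (hproj _ i) analyticAt_snd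
  have hGan : AnalyticAt ℂ G (X₀, R₀) := by
    refine analyticAt_pi_iff.2 fun i => ?_
    by_cases hi : i ∈ A
    · simp only [hi, if_true]
      refine (AnalyticAt.comp (g := η i)
        (f := fun p : (Fin 3 → ℂ) × (Fin N → ℂ) => p.2 i) (hη i) (hsnd i)).sub
        (Finset.analyticAt_fun_sum _ fun a _ => (hfst a).mul ?_)
      exact AnalyticAt.comp (g := fun R => ξ i R a)
        (f := fun p : (Fin 3 → ℂ) × (Fin N → ℂ) => p.2) (hξ i a) analyticAt_snd
    · simp only [hi, if_false]
      exact (hsnd i).sub analyticAt_const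
  have hηR : ∀ {R : Fin N → ℂ} {i : Fin N}, AnalyticAt ℂ (η i) (R i) →
      DifferentiableAt ℂ (fun S : Fin N → ℂ => η i (S i)) R := fun {R i} h =>
    (AnalyticAt.comp (g := η i) (f := fun S : Fin N → ℂ => S i) h (hproj R i)).differentiableAt
  have hpdsub : ∀ {n : ℕ} {f g : (Fin n → ℂ) → ℂ} {z : Fin n → ℂ}, DifferentiableAt ℂ f z →
      DifferentiableAt ℂ g z → ∀ j, pd j (fun w => f w - g w) z = pd j f z - pd j g z := by
    intro n f g z hf hg j
    unfold pd
    rw [fderiv_fun_sub hf hg]; rfl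
  have hGi : ∀ i ∈ A, ∀ j, pd j (fun S => G (X₀, S) i) R₀ =
      (if i = j then deriv (η i) (R₀ i) else 0) - ∑ a, X₀ a * pd j (fun R => ξ i R a) R₀ := by
    intro i hi j
    simp only [hGdef, hi, if_true]
    have hm : ∀ a, DifferentiableAt ℂ (fun S => X₀ a * ξ i S a) R₀ := fun a =>
      (differentiableAt_const _).mul (hξ i a).differentiableAt
    rw [hpdsub (hηR (hη i)) (DifferentiableAt.fun_sum fun a _ => hm a),
      pd_scalar_comp (f := fun S : Fin N → ℂ => S i) (hη i).differentiableAt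
        (hproj _ i).differentiableAt, hpdproj, pd_fun_sum fun a _ => hm a]
    congr 1
    · split_ifs <;> simp
    · refine Finset.sum_congr rfl fun a _ => ?_
      rw [pd_fun_mul (differentiableAt_const _) (hξ i a).differentiableAt, pd_const]
      ring
  have hGi' : ∀ i ∉ A, ∀ j, pd j (fun S => G (X₀, S) i) R₀ = if i = j then 1 else 0 := by
    intro i hi j
    simp only [hGdef, hi, if_false]
    rw [hpdsub (hproj _ i).differentiableAt (differentiableAt_const _), hpdproj, pd_const, sub_zero]
  -- Where `X · ξ_i = X · ξ_k = 0`, commutativity gives `X · ∂_k ξ_i = γ (X · ξ_k - X · ξ_i) = 0`.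
  -- So the Jacobian of the hodograph equations is diagonal on `A`. This is why several active
  -- phases require zero right-hand sides.
  have hsumcross : ∀ {R : Fin N → ℂ} {X : Fin 3 → ℂ} {i k : Fin N} {γ : ℂ},
      ∑ a, X a * ξ i R a = 0 → ∑ a, X a * ξ k R a = 0 →
      (∀ a, pd k (fun R => ξ i R a) R = γ * (ξ k R a - ξ i R a)) →
      ∑ a, X a * pd k (fun R => ξ i R a) R = 0 := by
    intro R X i k γ h1 h2 h3
    have : ∑ a, X a * pd k (fun R => ξ i R a) R =
        γ * (∑ a, X a * ξ k R a - ∑ a, X a * ξ i R a) := by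
      rw [← Finset.sum_sub_distrib, Finset.mul_sum]
      exact Finset.sum_congr rfl fun a _ => by rw [h3]; ring
    rw [this, h1, h2]; ring
  have hsumA : ∀ {R : Fin N → ℂ} {X : Fin 3 → ℂ} {v : Fin N → ℂ} {i : Fin N}, i ∈ A →
      (∀ j ∈ A, ∑ a, X a * ξ j R a = η j (R j)) →
      (∀ i ∈ A, ∀ k ∈ A, i ≠ k → ∃ γ : ℂ, ∀ a,
        pd k (fun R => ξ i R a) R = γ * (ξ k R a - ξ i R a)) → (∀ j ∉ A, v j = 0) →
      ∑ j, v j * ∑ a, X a * pd j (fun R => ξ i R a) R =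
        v i * ∑ a, X a * pd i (fun R => ξ i R a) R := by
    intro R X v i hi h1 h2 h3
    rw [Finset.sum_eq_single i]
    · intro j _ hij
      by_cases hj : j ∈ A
      · obtain ⟨γ, hγ⟩ := h2 i hi j hj hij.symm
        rw [hsumcross (by rw [h1 i hi, hη0 i hi j hj hij.symm])
          (by rw [h1 j hj, hη0 j hj i hi hij]) hγ, mul_zero]
      · rw [h3 j hj, zero_mul]
    · simp
  obtain ⟨R, hR, hR0, hRG⟩ := exists_implicit (G := G) hGan (by
    funext i
    by_cases hi : i ∈ A
    · simp [hGdef, hi, h0 i hi]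
    · simp [hGdef, hi]) (by
    intro v hv
    have h1 : ∀ j ∉ A, v j = 0 := by
      intro j hj
      have := hv j
      simpa [hGi' j hj] using this
    funext i
    by_cases hi : i ∈ A
    · have h2 := hv i
      simp only [hGi i hi, mul_sub, Finset.sum_sub_distrib] at h2
      rw [hsumA hi h0 hcross.self_of_nhds h1] at h2
      simp only [mul_ite, mul_zero, Finset.sum_ite_eq, Finset.mem_univ, if_true] at h2
      rw [← mul_sub] at h2
      exact (mul_eq_zero.1 h2).resolve_right (hd i hi)
    · exact h1 i hi)
  refine ⟨R, hR, hR0, ?_⟩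
  have hRi := fun i => analyticAt_pi_iff.1 hR i
  have hRc : Tendsto R (𝓝 X₀) (𝓝 R₀) := by
    have := hR.continuousAt.tendsto; rwa [hR0] at this
  have hden : ∀ᶠ X in 𝓝 X₀, ∀ i ∈ A,
      deriv (η i) (R X i) - ∑ a, X a * pd i (fun R => ξ i R a) (R X) ≠ 0 := by
    refine eventually_all.2 fun i => ?_
    by_cases hi : i ∈ A
    · have hc : ContinuousAt (fun X =>
          deriv (η i) (R X i) - ∑ a, X a * pd i (fun R => ξ i R a) (R X)) X₀ := by
        refine ContinuousAt.sub ?_ (tendsto_finsetSum _ fun a _ => ContinuousAt.mul ?_ ?_)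
        · exact ContinuousAt.comp (g := deriv (η i)) (f := fun X => R X i)
            (by rw [hR0]; exact (hη i).deriv.continuousAt) (hRi i).continuousAt
        · exact (continuous_apply a).continuousAt
        · exact ContinuousAt.comp (g := pd i (fun R => ξ i R a)) (f := R)
            (by rw [hR0]; exact ((hξ i a).pd i).continuousAt) hR.continuousAt
      have := hc.eventually_ne (by rw [hR0]; exact hd i hi)
      filter_upwards [this] with X hX _ using hX
    · exact Eventually.of_forall fun X h => absurd h hi
  have hηev : ∀ᶠ X in 𝓝 X₀, ∀ i, AnalyticAt ℂ (η i) (R X i) := by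
    refine eventually_all.2 fun i => ?_
    have : Tendsto (fun X => R X i) (𝓝 X₀) (𝓝 (R₀ i)) := by
      simpa [hR0] using (hRi i).continuousAt.tendsto
    exact this.eventually (hη i).eventually_analyticAt
  have hξev : ∀ᶠ X in 𝓝 X₀, ∀ i a, AnalyticAt ℂ (fun R => ξ i R a) (R X) :=
    eventually_all.2 fun i => eventually_all.2 fun a => hRc.eventually (hξ i a).eventually_analyticAt
  filter_upwards [hden, hηev, hξev, hR.eventually_analyticAt, hRG.eventually_nhds,
    hRc.eventually hcross] with X h1 h2 h3 h4 h5 h6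
  have hout : ∀ i ∉ A, ∀ a, pd a (fun X => R X i) X = 0 := by
    intro i hi a
    rw [pd_congr (g := fun _ => R₀ i) _ a, pd_const]
    filter_upwards [h5] with Z hZ
    have := congrFun hZ i
    simp only [hGdef, hi, if_false] at this
    exact sub_eq_zero.1 this
  refine ⟨fun i hi => ⟨h1 i hi, fun a => ?_⟩, hout⟩
  have hRXi : DifferentiableAt ℂ (fun X => R X i) X := (analyticAt_pi_iff.1 h4 i).differentiableAt
  have hξX : ∀ b, DifferentiableAt ℂ (fun X => ξ i (R X) b) X := fun b =>
    (AnalyticAt.comp (g := fun R => ξ i R b) (f := R) (h3 i b) h4).differentiableAt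
  have hm : ∀ b, DifferentiableAt ℂ (fun X : Fin 3 → ℂ => X b * ξ i (R X) b) X := fun b =>
    (hproj3 X b).differentiableAt.mul (hξX b)
  have hE : pd a (fun X => η i (R X i) - ∑ b, X b * ξ i (R X) b) X = 0 := by
    rw [pd_congr (g := fun _ => 0) _ a, pd_const]
    filter_upwards [h5] with Z hZ
    have := congrFun hZ i
    simp only [hGdef, hi, if_true] at this
    exact this
  rw [hpdsub (f := fun X => η i (R X i))
      (DifferentiableAt.comp X (g := η i) (h2 i).differentiableAt hRXi)
      (DifferentiableAt.fun_sum fun b _ => hm b),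
    pd_scalar_comp (f := fun X => R X i) (h2 i).differentiableAt hRXi,
    pd_fun_sum fun b _ => hm b] at hE
  have hE2 : ∑ b, pd a (fun X : Fin 3 → ℂ => X b * ξ i (R X) b) X = ξ i (R X) a +
      pd a (fun X => R X i) X * ∑ b, X b * pd i (fun R => ξ i R b) (R X) := by
    have h7 : ∀ b, pd a (fun X : Fin 3 → ℂ => X b * ξ i (R X) b) X =
        (if b = a then 1 else 0) * ξ i (R X) b + ∑ j, pd a (fun X => R X j) X *
          (X b * pd j (fun R => ξ i R b) (R X)) := by
      intro b
      rw [pd_fun_mul (hproj3 X b).differentiableAt (hξX b), hpdproj,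
        pd_comp_sum (G := fun R => ξ i R b) (h3 i b).differentiableAt h4.differentiableAt,
        Finset.mul_sum]
      congr 1
      exact Finset.sum_congr rfl fun j _ => by ring
    simp only [h7, Finset.sum_add_distrib]
    rw [Finset.sum_comm]
    simp only [← Finset.mul_sum]
    rw [hsumA hi (fun j hj => ?_) h6 (fun j hj => hout j hj a)]
    · simp
    · have := congrFun h5.self_of_nhds j
      simp only [hGdef, hj, if_true] at this
      exact (sub_eq_zero.1 this).symm
  rw [hE2] at hE
  rw [eq_div_iff (h1 i hi)]
  linear_combination hE

/-! ### What simple and double waves force on a reduction -/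

namespace QuadPDE

variable {E : QuadPDE} {D : Set ℂ} {N : ℕ} {U : Set (Fin N → ℂ)} {u : (Fin N → ℂ) → ℂ}
  {lam mu : Fin N → (Fin N → ℂ) → ℂ}

/-- A hodograph wave is a legitimate test solution. Evaluating the equation on it at `X₀` gives an
algebraic relation at `R₀` to which the constant phases contribute nothing. -/
theorem IsReduction.exists_wave (hred : E.IsReduction D U u lam mu) (hE : E.Holomorphic D)
    {R₀ : Fin N → ℂ} (hR₀ : R₀ ∈ U) {X₀ : Fin 3 → ℂ} (A : Finset (Fin N)) {η : Fin N → ℂ → ℂ}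
    (hη : ∀ i, AnalyticAt ℂ (η i) (R₀ i))
    (hη0 : ∀ i ∈ A, ∀ k ∈ A, i ≠ k → ∀ s, η i s = 0)
    (hcross : ∀ᶠ R in 𝓝 R₀, ∀ i ∈ A, ∀ k ∈ A, i ≠ k → ∃ γ : ℂ, ∀ a,
      pdDirection lam mu k i R a = γ * (direction lam mu k R a - direction lam mu i R a))
    (h0 : ∀ i ∈ A, ∑ a, X₀ a * direction lam mu i R₀ a = η i (R₀ i))
    (hd : ∀ i ∈ A, deriv (η i) (R₀ i) - ∑ a, X₀ a * pdDirection lam mu i i R₀ a ≠ 0) :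
    ∃ R : (Fin 3 → ℂ) → Fin N → ℂ, AnalyticAt ℂ R X₀ ∧ R X₀ = R₀ ∧
      (∀ᶠ X in 𝓝 X₀,
        (∀ i ∈ A, deriv (η i) (R X i) - ∑ a, X a * pdDirection lam mu i i (R X) a ≠ 0 ∧
          pd 0 (fun X => R X i) X =
            1 / (deriv (η i) (R X i) - ∑ a, X a * pdDirection lam mu i i (R X) a)) ∧
        ∀ i ∉ A, pd 0 (fun X => R X i) X = 0) ∧
      ∑ i ∈ A, (bil (E.V (u R₀)) (direction lam mu i R₀) (direction lam mu i R₀) *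
        pd i u R₀ * pd 0 (pd 0 fun w => R w i) X₀ +
      ∑ j ∈ A, pd 0 (fun w => R w i) X₀ * pd 0 (fun w => R w j) X₀ *
        E.interaction u lam mu i j R₀) = 0 := by
  obtain ⟨R, hR, hRX, hev⟩ := _root_.exists_wave (ξ := direction lam mu) A
    (fun i a => analyticAt_direction (fun i => hred.analytic_lam i _ hR₀)
      (fun i => hred.analytic_mu i _ hR₀) i a) hη hη0 hcross h0 hd
  have hRc : Tendsto R (𝓝 X₀) (𝓝 R₀) := by
    have := hR.continuousAt.tendsto; rwa [hRX] at this
  have hev0 : ∀ᶠ X in 𝓝 X₀, ∀ i ∉ A, pd 0 (fun X => R X i) X = 0 := by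
    filter_upwards [hev] with X hX i hi using hX.2 i hi 0
  refine ⟨R, hR, hRX, ?_, ?_⟩
  · filter_upwards [hev] with X hX
    exact ⟨fun i hi => ⟨(hX.1 i hi).1, (hX.1 i hi).2 0⟩, fun i hi => hX.2 i hi 0⟩
  · obtain ⟨W, hW, hWo, hXW⟩ := eventually_nhds_iff.1
      (hev.and (hR.eventually_analyticAt.and (hRc.eventually (hred.isOpen.mem_nhds hR₀))))
    have hsol : SolvesHydro lam mu W R := by
      intro z hz i
      by_cases hi : i ∈ A
      · have h1 := ((hW z hz).1.1 i hi).2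
        rw [h1, h1, h1]
        simp only [direction, Matrix.cons_val]
        exact ⟨by ring, by ring⟩
      · have h1 := (hW z hz).1.2 i hi
        rw [h1, h1, h1]; simp
    have hlhs : E.lhs (fun z => u (R z)) X₀ = 0 := hred.solves W R hWo
      (fun z hz => (hW z hz).2.1) (fun z hz => (hW z hz).2.2) hsol X₀ hXW
    have hRR : R X₀ ∈ U := by rwa [hRX]
    rw [lhs_hydro hWo hsol hXW (hE.analyticCoeffAt (hred.mapsTo hRR)) (hred.analytic_u _ hRR)
      (fun i => hred.analytic_lam i _ hRR) (fun i => hred.analytic_mu i _ hRR) hR, hRX] at hlhs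
    rw [← hlhs]
    have h2 : ∀ i ∉ A, pd 0 (pd 0 fun w => R w i) X₀ = 0 := by
      intro i hi
      rw [pd_congr (g := fun _ => 0) _ 0, pd_const]
      filter_upwards [hev0] with X hX using hX i hi
    have h1 := hev0.self_of_nhds
    have h3 : ∀ i, ∑ j, pd 0 (fun w => R w i) X₀ * pd 0 (fun w => R w j) X₀ *
        E.interaction u lam mu i j R₀ = ∑ j ∈ A, pd 0 (fun w => R w i) X₀ *
        pd 0 (fun w => R w j) X₀ * E.interaction u lam mu i j R₀ := by
      intro i
      refine (Finset.sum_subset (Finset.subset_univ _) fun j _ hj => ?_).symm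
      rw [h1 j hj]; ring
    simp only [h3]
    refine Finset.sum_subset (Finset.subset_univ _) fun i _ hi => ?_
    rw [h2 i hi, h1 i hi]; simp

theorem pdDirection_zero (j i : Fin N) (R : Fin N → ℂ) : pdDirection lam mu j i R 0 = 0 := by
  simp [pdDirection, direction, pd_const]

/-- Simple waves force the dispersion relation. -/
theorem IsReduction.self_interaction (hred : E.IsReduction D U u lam mu) (hE : E.Holomorphic D)
    {R₀ : Fin N → ℂ} (hR₀ : R₀ ∈ U) (i : Fin N) :
    bil (E.V (u R₀)) (direction lam mu i R₀) (direction lam mu i R₀) * pd i u R₀ = 0 ∧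
      E.interaction u lam mu i i R₀ = 0 := by
  -- The quadratic coefficient `c` of the hodograph function is free. At the origin the wave has
  -- `R_x = 1` and `R_xx = -2 c`, so the values `c = 0` and `c = 1` separate the two terms.
  have key : ∀ c : ℂ, bil (E.V (u R₀)) (direction lam mu i R₀) (direction lam mu i R₀) *
      pd i u R₀ * (-(2 * c)) + E.interaction u lam mu i i R₀ = 0 := by
    intro c
    have hder : ∀ s, HasDerivAt (fun s : ℂ => (s - R₀ i) + c * (s - R₀ i) ^ 2)
        (1 + 2 * c * (s - R₀ i)) s := by
      intro s
      have h := (hasDerivAt_id' s).sub_const (R₀ i)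
      refine (h.fun_add ((h.fun_pow 2).const_mul c)).congr_deriv ?_
      simp; ring
    have hder' : deriv (fun s : ℂ => (s - R₀ i) + c * (s - R₀ i) ^ 2) =
        fun s => 1 + 2 * c * (s - R₀ i) := funext fun s => (hder s).deriv
    obtain ⟨R, hR, hRX, hev, hsum⟩ := hred.exists_wave hE hR₀ (X₀ := 0) {i}
      (η := fun _ s => (s - R₀ i) + c * (s - R₀ i) ^ 2)
      (by
        intro j
        fun_prop)
      (by
        intro j hj k hk hjk
        rw [Finset.mem_singleton] at hj hk
        exact absurd (hj.trans hk.symm) hjk)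
      (Eventually.of_forall fun R j hj k hk hjk => by
        rw [Finset.mem_singleton] at hj hk
        exact absurd (hj.trans hk.symm) hjk)
      (by simp) (by simp [hder'])
    simp only [Finset.sum_singleton] at hsum
    have hev0 := (hev.self_of_nhds.1 i (Finset.mem_singleton_self i)).2
    simp only [hder', hRX, sub_self, mul_zero, add_zero, Pi.zero_apply, zero_mul,
      Finset.sum_const_zero, sub_zero, div_one] at hev0
    have hpR : ∀ a, AnalyticAt ℂ (fun X => pdDirection lam mu i i (R X) a) 0 := fun a =>
      AnalyticAt.comp (g := fun S => pdDirection lam mu i i S a) (f := R) (by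
        rw [hRX]
        exact (analyticAt_direction (fun i => hred.analytic_lam i _ hR₀)
          (fun i => hred.analytic_mu i _ hR₀) i a).pd i) hR
    have hRi : AnalyticAt ℂ (fun X => R X i) 0 := analyticAt_pi_iff.1 hR i
    have hproj : ∀ a, AnalyticAt ℂ (fun X : Fin 3 → ℂ => X a) 0 := fun a =>
      (ContinuousLinearMap.proj (R := ℂ) (φ := fun _ : Fin 3 => ℂ) a).analyticAt _
    have hmul : (fun X => pd 0 (fun X => R X i) X *
        (1 + 2 * c * (R X i - R₀ i) - ∑ a, X a * pdDirection lam mu i i (R X) a)) =ᶠ[𝓝 0]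
        fun _ => 1 := by
      filter_upwards [hev] with X hX
      have h1 := hX.1 i (Finset.mem_singleton_self i)
      simp only [hder'] at h1
      rw [h1.2, one_div, inv_mul_cancel₀ h1.1]
    have hσ : pd 0 (pd 0 fun w => R w i) 0 = -(2 * c) := by
      have h1 := pd_congr hmul 0
      have hA : DifferentiableAt ℂ (fun X => 1 + 2 * c * (R X i - R₀ i)) 0 :=
        (analyticAt_const.add (analyticAt_const.mul (hRi.sub analyticAt_const))).differentiableAt
      have hB : DifferentiableAt ℂ (fun X : Fin 3 → ℂ =>
          ∑ a, X a * pdDirection lam mu i i (R X) a) 0 :=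
        (Finset.analyticAt_fun_sum _ fun a _ => (hproj a).mul (hpR a)).differentiableAt
      rw [pd_const, pd_fun_mul (hRi.pd 0).differentiableAt (hA.fun_sub hB), hev0] at h1
      have h2 : pd 0 (fun X => 1 + 2 * c * (R X i - R₀ i)) 0 = 2 * c := by
        rw [pd_scalar_comp (A := fun s => 1 + 2 * c * (s - R₀ i)) (f := fun X => R X i)
          (by fun_prop) hRi.differentiableAt, hev0]
        simp
      have h3 : pd 0 (fun X : Fin 3 → ℂ => ∑ a, X a * pdDirection lam mu i i (R X) a) 0 = 0 := by
        rw [pd_fun_sum fun a _ => ((hproj a).fun_mul (hpR a)).differentiableAt]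
        refine Finset.sum_eq_zero fun a _ => ?_
        rw [pd_fun_mul (hproj a).differentiableAt (hpR a).differentiableAt, hRX]
        by_cases ha : a = 0
        · subst ha; simp [pdDirection_zero]
        · have : pd 0 (fun X : Fin 3 → ℂ => X a) 0 = 0 := by
            have h := (ContinuousLinearMap.proj (R := ℂ) (φ := fun _ : Fin 3 => ℂ) a).hasFDerivAt
              (x := (0 : Fin 3 → ℂ))
            have h2 : fderiv ℂ (fun X : Fin 3 → ℂ => X a) 0 = _ := h.fderiv
            rw [pd, h2]; simp [ha]
          simp [this]
      have h4 : pd 0 (fun X : Fin 3 → ℂ => 1 + 2 * c * (R X i - R₀ i) -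
          ∑ a, X a * pdDirection lam mu i i (R X) a) 0 = 2 * c := by
        have : pd 0 (fun X : Fin 3 → ℂ => 1 + 2 * c * (R X i - R₀ i) -
          ∑ a, X a * pdDirection lam mu i i (R X) a) 0 =
          pd 0 (fun X => 1 + 2 * c * (R X i - R₀ i)) 0 -
          pd 0 (fun X : Fin 3 → ℂ => ∑ a, X a * pdDirection lam mu i i (R X) a) 0 := by
          unfold pd
          rw [fderiv_fun_sub hA hB]; rfl
        rw [this, h2, h3, sub_zero]
      rw [h4] at h1
      simp only [hRX, sub_self, mul_zero, add_zero, Pi.zero_apply, zero_mul,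
        Finset.sum_const_zero, sub_zero, mul_one, one_mul] at h1
      linear_combination h1
    rw [hσ, hev0] at hsum
    linear_combination hsum
  have h0 := key 0
  have h1 := key 1
  simp only [mul_zero, neg_zero, zero_add] at h0
  refine ⟨?_, h0⟩
  rw [h0] at h1
  linear_combination (-1 / 2) * h1

/-- Double waves determine the second derivatives of `u`. -/
theorem IsReduction.pair_interaction (hred : E.IsReduction D U u lam mu) (hE : E.Holomorphic D)
    {R₀ : Fin N → ℂ} (hR₀ : R₀ ∈ U) {i k : Fin N} (hik : i ≠ k) {X₀ : Fin 3 → ℂ}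
    (hcross : ∀ᶠ R in 𝓝 R₀, ∀ i k, i ≠ k → ∃ γ : ℂ, ∀ a,
      pdDirection lam mu k i R a = γ * (direction lam mu k R a - direction lam mu i R a))
    (hi : ∑ a, X₀ a * direction lam mu i R₀ a = 0) (hk : ∑ a, X₀ a * direction lam mu k R₀ a = 0)
    (hdi : ∑ a, X₀ a * pdDirection lam mu i i R₀ a ≠ 0)
    (hdk : ∑ a, X₀ a * pdDirection lam mu k k R₀ a ≠ 0) :
    E.interaction u lam mu i k R₀ + E.interaction u lam mu k i R₀ = 0 := by
  obtain ⟨R, hR, hRX, hev, hsum⟩ := hred.exists_wave hE hR₀ (X₀ := X₀) {i, k}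
    (η := fun _ _ => 0) (fun _ => analyticAt_const) (fun _ _ _ _ _ _ => rfl)
    (by filter_upwards [hcross] with R hR i _ k _ h using hR i k h)
    (by simp [hi, hk]) (by simp [hdi, hdk])
  rw [Finset.sum_pair hik, Finset.sum_pair hik, Finset.sum_pair hik,
    (hred.self_interaction hE hR₀ i).1, (hred.self_interaction hE hR₀ i).2,
    (hred.self_interaction hE hR₀ k).1, (hred.self_interaction hE hR₀ k).2] at hsum
  have h1 := (hev.self_of_nhds.1 i (by simp))
  have h2 := (hev.self_of_nhds.1 k (by simp))
  have h3 : pd 0 (fun X => R X i) X₀ ≠ 0 := by rw [h1.2]; exact one_div_ne_zero h1.1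
  have h4 : pd 0 (fun X => R X k) X₀ ≠ 0 := by rw [h2.2]; exact one_div_ne_zero h2.1
  refine (mul_eq_zero.1 (?_ : pd 0 (fun X => R X i) X₀ * pd 0 (fun X => R X k) X₀ * _ = 0)
    ).resolve_left (mul_ne_zero h3 h4)
  linear_combination hsum

end QuadPDE

/-! ### The criterion from a three-phase solution -/

namespace Reduction

variable {V : ℂ → Matrix (Fin 3) (Fin 3) ℂ}

/-- Solvability of the Gibbons–Tsarev system for three phases. -/
theorem ode_of_solution (hVs : ∀ u, (V u).IsSymm) {Y : (Fin 3 → ℂ) → Option (Fin 3 × Fin 3) → ℂ}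
    (hY : AnalyticAt ℂ Y 0) (hreg : Regular V (Y 0)) (hdet : (V (Y 0 none)).det ≠ 0)
    (hvel : ∀ i, Y 0 (some (i, 0)) ≠ 0) (hdisp : ∀ i, disp V i (Y 0) = 0)
    (hsol : ∀ᶠ R in 𝓝 0, ∀ a, ∀ j ∉ frozen a, pd j (fun R => Y R a) R = rhs V (Y R) a j) :
    ∃ k : ℂ, matDeriv (matDeriv V) (Y 0 none) =
      logDeriv (fun s => (V s).det) (Y 0 none) • matDeriv V (Y 0 none) + k • V (Y 0 none) := by
  set ω := logDeriv (fun s => (V s).det) (Y 0 none) with hω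
  have hpol := logDeriv_det_mul (fun a b => (hreg.analytic a b).differentiableAt) hdet
  -- Symmetry of the second derivatives of `Y`. The derivatives of phase `k` along `R_k`, about
  -- which nothing is known, drop out by `fderiv_rhs_eq_zero`.
  have hcompat : ∀ a j k, j ∉ frozen a → k ∉ frozen a → j ≠ k →
      fderiv ℂ (fun y => rhs V y a j) (Y 0) (fun b => rhs V (Y 0) b k) -
        fderiv ℂ (fun y => rhs V y a k) (Y 0) (fun b => rhs V (Y 0) b j) = 0 := by
    have key : ∀ a j k, j ∉ frozen a → k ∉ frozen a → j ≠ k →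
        pd k (pd j fun R => Y R a) 0 =
          fderiv ℂ (fun y => rhs V y a j) (Y 0) (fun b => rhs V (Y 0) b k) := by
      intro a j k hj hk hjk
      have h1 : (pd j fun R => Y R a) =ᶠ[𝓝 0] fun R => rhs V (Y R) a j := by
        filter_upwards [hsol] with R hR using hR a j hj
      rw [pd_congr h1, pd_comp (G := fun y => rhs V y a j)
        (hreg.analyticAt_rhs_apply a j).differentiableAt hY.differentiableAt,
        fderiv_apply_eq_add_sum _ _ (fun b => rhs V (Y 0) b k), Finset.sum_eq_zero, add_zero]
      intro b _
      by_cases hb : k ∈ frozen b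
      · rw [fderiv_rhs_eq_zero hreg hj hk hjk hb, mul_zero]
      · rw [hsol.self_of_nhds b k hb, sub_self, zero_mul]
    intro a j k hj hk hjk
    rw [← key a j k hj hk hjk, ← key a k j hk hj hjk.symm,
      pd_comm (analyticAt_pi_iff.1 hY a), sub_self]
  have hrate : ∀ i j k, i ≠ j → i ≠ k → j ≠ k → tripleRate V (Y 0) i j k = ω := by
    intro i j k hij hik hjk
    have h := rate_sub_tripleRate hVs hreg hpol hij hik hjk
    rw [hdisp, hdisp, hdisp, zero_mul, zero_mul, zero_mul, add_zero, add_zero] at h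
    have h1 : gram V (Y 0) i j ≠ 0 := hreg.ne_zero i j hij
    have h2 : gram V (Y 0) i k ≠ 0 := hreg.ne_zero i k hik
    have h3 : gram V (Y 0) j k ≠ 0 := hreg.ne_zero j k hjk
    have h4 := (mul_eq_zero.1 h).resolve_right (by simp [h1, h2, h3])
    exact (sub_eq_zero.1 h4).symm
  have hv : ∀ i j, i ≠ j → gram V (Y 0) i j ≠ 0 := hreg.ne_zero
  have hvii : ∀ i, gram V (Y 0) i i = 0 := hdisp
  set q : Fin 3 → Fin 3 → ℂ := fun i j =>
    gram (matDeriv (matDeriv V)) (Y 0) i j - ω * gram (matDeriv V) (Y 0) i j with hq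
  have hqc : ∀ i j, q i j = q j i := fun i j => by
    simp only [hq, gram_comm (matDeriv_isSymm hVs) i j,
      gram_comm (matDeriv_isSymm (matDeriv_isSymm hVs)) i j]
  have hoff : ∀ i j k, i ≠ j → i ≠ k → j ≠ k →
      q i j / gram V (Y 0) i j = q i k / gram V (Y 0) i k := by
    intro i j k hij hik hjk
    have h := hcompat (some (i, 0)) j k (by simp [frozen, hij.symm]) (by simp [frozen, hik.symm]) hjk
    rw [fderiv_rhs_velocity hVs hreg hij hik hjk, hrate i j k hij hik hjk] at h
    exact sub_eq_zero.1 ((mul_eq_zero.1 h).resolve_left (by simp [hvel]))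
  -- Otherwise the chords `X_j - X_i` and `X_k - X_i`, divided by `V(X_i, X_j)` and `V(X_i, X_k)`,
  -- coincide. Pairing with `X_j` and with `X_k` then gives two values of `V(X_j, X_k)` that are
  -- opposite, hence zero.
  have hdiag : ∀ i j k, i ≠ j → i ≠ k → j ≠ k → q i i = 0 := by
    intro i j k hij hik hjk
    by_contra hne
    have hc : ∀ c, (speed (Y 0) j c - speed (Y 0) i c) / gram V (Y 0) i j =
        (speed (Y 0) k c - speed (Y 0) i c) / gram V (Y 0) i k := by
      intro c
      by_cases hc : c = 0
      · subst hc; simp [speed]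
      · have h := hcompat (some (i, c)) j k (by simp [frozen, hij.symm])
          (by simp [frozen, hik.symm]) hjk
        rw [fderiv_rhs_speed hVs hreg hc hij hik hjk, hrate i j k hij hik hjk] at h
        rcases mul_eq_zero.1 h with h | h
        · rcases mul_eq_zero.1 h with h | h
          · simp [hvel] at h
          · exact absurd h hne
        · exact sub_eq_zero.1 h
    have hvec : (gram V (Y 0) i j)⁻¹ • (speed (Y 0) j - speed (Y 0) i) =
        (gram V (Y 0) i k)⁻¹ • (speed (Y 0) k - speed (Y 0) i) := by
      funext c
      have := hc c
      rw [div_eq_inv_mul, div_eq_inv_mul] at this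
      simpa using this
    have hb : ∀ x, (gram V (Y 0) i j)⁻¹ * (bil (V (Y 0 none)) x (speed (Y 0) j) -
        bil (V (Y 0 none)) x (speed (Y 0) i)) = (gram V (Y 0) i k)⁻¹ *
        (bil (V (Y 0 none)) x (speed (Y 0) k) - bil (V (Y 0 none)) x (speed (Y 0) i)) := by
      intro x
      have := congrArg (bil (V (Y 0 none)) x) hvec
      simpa only [bil_smul_right, bil_sub_right] using this
    have h1 : (gram V (Y 0) i j)⁻¹ * (gram V (Y 0) j j - gram V (Y 0) j i) =
        (gram V (Y 0) i k)⁻¹ * (gram V (Y 0) j k - gram V (Y 0) j i) := hb _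
    have h2 : (gram V (Y 0) i j)⁻¹ * (gram V (Y 0) k j - gram V (Y 0) k i) =
        (gram V (Y 0) i k)⁻¹ * (gram V (Y 0) k k - gram V (Y 0) k i) := hb _
    have n1 := hv i j hij
    have n2 := hv i k hik
    rw [hvii, gram_comm hVs j i] at h1
    rw [hvii, gram_comm hVs k i, gram_comm hVs k j] at h2
    field_simp at h1 h2
    have h3 := mul_left_cancel₀ n1 (show gram V (Y 0) i j * -gram V (Y 0) i k = _ by
      rw [← h1]; ring)
    have h4 := mul_left_cancel₀ n2 (show _ = gram V (Y 0) i k * -gram V (Y 0) i j by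
      rw [h2]; ring)
    apply hv j k hjk
    linear_combination (-1 / 2) * h3 + (1 / 2) * h4
  refine ⟨q 0 1 / gram V (Y 0) 0 1, ?_⟩
  set κ := q 0 1 / gram V (Y 0) 0 1 with hκ
  have h02 : q 0 2 / gram V (Y 0) 0 2 = κ := (hoff 0 1 2 (by decide) (by decide) (by decide)).symm
  have h12 : q 1 2 / gram V (Y 0) 1 2 = κ := by
    rw [← hoff 1 0 2 (by decide) (by decide) (by decide), hqc 1 0, gram_comm hVs 1 0]
  have hg : ∀ i j, q i j = κ * gram V (Y 0) i j := by
    have e01 : q 0 1 = κ * gram V (Y 0) 0 1 := by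
      rw [hκ, div_mul_cancel₀ _ (hv 0 1 (by decide))]
    have e02 : q 0 2 = κ * gram V (Y 0) 0 2 := by
      rw [← h02, div_mul_cancel₀ _ (hv 0 2 (by decide))]
    have e12 : q 1 2 = κ * gram V (Y 0) 1 2 := by
      rw [← h12, div_mul_cancel₀ _ (hv 1 2 (by decide))]
    have e00 := hdiag 0 1 2 (by decide) (by decide) (by decide)
    have e11 := hdiag 1 0 2 (by decide) (by decide) (by decide)
    have e22 := hdiag 2 0 1 (by decide) (by decide) (by decide)
    intro i j
    fin_cases i <;> fin_cases j <;> simp only [Fin.zero_eta, Fin.mk_one, Fin.reduceFinMk, hvii,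
      mul_zero, e00, e11, e22, e01, e02, e12, hqc 1 0, hqc 2 0, hqc 2 1, gram_comm hVs 1 0,
      gram_comm hVs 2 0, gram_comm hVs 2 1]
  set X : Matrix (Fin 3) (Fin 3) ℂ := Matrix.of fun a => speed (Y 0) a with hX
  have hXm : ∀ M : ℂ → Matrix (Fin 3) (Fin 3) ℂ, X * M (Y 0 none) * X.transpose =
      Matrix.of fun a b => gram M (Y 0) a b := by
    intro M
    ext a b
    exact gram_eq_mul_transpose M (Y 0) id a b
  -- The Gram determinant is `2 V(X_0, X_1) V(X_0, X_2) V(X_1, X_2)`. So the three speeds form a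
  -- basis, and the matrix identity can be tested on them.
  have hXdet : X.det ≠ 0 := by
    intro h0
    have h : (X * V (Y 0 none) * X.transpose).det = 0 := by
      rw [Matrix.det_mul, Matrix.det_mul, h0, zero_mul, zero_mul]
    rw [hXm, Matrix.det_fin_three] at h
    simp only [Matrix.of_apply, hvii, gram_comm hVs 1 0, gram_comm hVs 2 0, gram_comm hVs 2 1] at h
    have : gram V (Y 0) 0 1 * gram V (Y 0) 0 2 * gram V (Y 0) 1 2 = 0 := by
      linear_combination (1 / 2) * h
    simp [hv 0 1 (by decide), hv 0 2 (by decide), hv 1 2 (by decide)] at this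
  have hXu : IsUnit X := (Matrix.isUnit_iff_isUnit_det X).2 (isUnit_iff_ne_zero.2 hXdet)
  have hXtu : IsUnit X.transpose := (Matrix.isUnit_iff_isUnit_det _).2 (by
    rw [Matrix.det_transpose]; exact isUnit_iff_ne_zero.2 hXdet)
  refine hXu.mul_left_cancel (hXtu.mul_right_cancel ?_)
  rw [Matrix.mul_add, Matrix.add_mul, Matrix.mul_smul, Matrix.mul_smul, Matrix.smul_mul,
    Matrix.smul_mul, hXm, hXm, hXm]
  ext a b
  have := hg a b
  simp only [hq] at this
  simp only [Matrix.of_apply, Matrix.add_apply, Matrix.smul_apply, smul_eq_mul]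
  linear_combination this

end Reduction

/-! ### Null directions and curves of initial data -/

theorem bil_three (M : Matrix (Fin 3) (Fin 3) ℂ) (x y : Fin 3 → ℂ) : bil M x y =
    M 0 0 * x 0 * y 0 + M 0 1 * x 0 * y 1 + M 0 2 * x 0 * y 2 +
    (M 1 0 * x 1 * y 0 + M 1 1 * x 1 * y 1 + M 1 2 * x 1 * y 2) +
    (M 2 0 * x 2 * y 0 + M 2 1 * x 2 * y 1 + M 2 2 * x 2 * y 2) := by
  simp only [bil, Fin.sum_univ_three]

/-- A smooth conic has infinitely many points with non-vertical tangents. -/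
theorem exists_null_points {M : Matrix (Fin 3) (Fin 3) ℂ} (hM : M.IsSymm) (hdet : M.det ≠ 0) :
    ∃ m l : Fin 3 → ℂ, Function.Injective m ∧ ∀ i, bil M ![1, m i, l i] ![1, m i, l i] = 0 ∧
      bil M ![1, m i, l i] ![0, 0, 1] ≠ 0 := by
  obtain ⟨a, ha⟩ : ∃ a, a = M 0 0 := ⟨_, rfl⟩
  obtain ⟨b, hb⟩ : ∃ b, b = M 1 1 := ⟨_, rfl⟩
  obtain ⟨c, hc⟩ : ∃ c, c = M 2 2 := ⟨_, rfl⟩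
  obtain ⟨p, hp⟩ : ∃ p, p = M 0 1 := ⟨_, rfl⟩
  obtain ⟨q, hq⟩ : ∃ q, q = M 0 2 := ⟨_, rfl⟩
  obtain ⟨r, hr⟩ : ∃ r, r = M 1 2 := ⟨_, rfl⟩
  have hdet' : a * b * c + 2 * p * q * r - a * r ^ 2 - b * q ^ 2 - c * p ^ 2 ≠ 0 := by
    intro h
    apply hdet
    rw [Matrix.det_fin_three, hM.apply 0 1, hM.apply 0 2, hM.apply 1 2, ← ha, ← hb, ← hc, ← hp,
      ← hq, ← hr]
    linear_combination h
  -- A quarter of the discriminant in `l` of the equation of the conic. Where it does not vanish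
  -- there is a point of the conic whose tangent is not vertical. If it vanished identically, `det
  -- M` would be zero.
  set P : Polynomial ℂ := Polynomial.C (r ^ 2 - c * b) * Polynomial.X ^ 2 +
    Polynomial.C (2 * (q * r - c * p)) * Polynomial.X + Polynomial.C (q ^ 2 - c * a) with hP
  have hPe : ∀ m, P.eval m = (q + r * m) ^ 2 - c * (a + 2 * p * m + b * m ^ 2) := by
    intro m; simp [hP]; ring
  have hP0 : P ≠ 0 := by
    intro h
    have e0 := hPe 0
    have e1 := hPe 1
    have e2 := hPe (-1)
    rw [h, Polynomial.eval_zero] at e0 e1 e2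
    apply hdet'
    have c0 : q ^ 2 = c * a := by linear_combination -e0
    have c1 : r ^ 2 = c * b := by linear_combination -(1 / 2) * e1 - (1 / 2) * e2 + e0
    have c2 : q * r = c * p := by linear_combination -(1 / 4) * e1 + (1 / 4) * e2
    by_cases hc0 : c = 0
    · subst hc0
      have hq0 : q = 0 := by simpa using c0
      have hr0 : r = 0 := by simpa using c1
      subst hq0 hr0; ring
    · refine mul_left_cancel₀ hc0 ?_
      linear_combination (2 * p * c) * c2 - (b * c) * c0 - (a * c) * c1 - (q * r + c * p) * c2 +
        r ^ 2 * c0 + c * a * c1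
  have hinf : {m | ¬ P.IsRoot m}.Infinite := (Polynomial.finite_setOfPred_isRoot hP0).infinite_compl
  have hex : ∀ m, ¬ P.IsRoot m → ∃ l, a + 2 * p * m + b * m ^ 2 + 2 * (q + r * m) * l + c * l ^ 2 = 0
      ∧ q + r * m + c * l ≠ 0 := by
    intro m hm
    rw [Polynomial.IsRoot, hPe] at hm
    by_cases hc0 : c = 0
    · subst hc0
      have h1 : q + r * m ≠ 0 := by
        intro h; apply hm; rw [h]; ring
      refine ⟨-(a + 2 * p * m + b * m ^ 2) / (2 * (q + r * m)), ?_, by simpa using h1⟩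
      generalize q + r * m = d at h1 ⊢
      field_simp
      ring
    · obtain ⟨s, hs⟩ := IsAlgClosed.exists_eq_mul_self
        ((q + r * m) ^ 2 - c * (a + 2 * p * m + b * m ^ 2))
      have hs0 : s ≠ 0 := by
        rintro rfl; exact hm (by rw [hs]; ring)
      refine ⟨(-(q + r * m) + s) / c, ?_, ?_⟩
      · field_simp
        linear_combination -hs
      · have : q + r * m + c * ((-(q + r * m) + s) / c) = s := by field_simp; ring
        rwa [this]
  have hc' : ∀ i : Fin 3, ∃ l, _ := fun i =>
    hex (hinf.natEmbedding _ i.val : ℂ) (hinf.natEmbedding _ i.val).2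
  choose l hl using hc'
  refine ⟨fun i => (hinf.natEmbedding _ i.val : ℂ), l, ?_, fun i => ?_⟩
  · intro i j h
    exact Fin.ext ((hinf.natEmbedding _).injective (Subtype.ext h))
  · have h := hl i
    simp only [bil_three, hM.apply 0 1, hM.apply 0 2, hM.apply 1 2, ← ha, ← hb, ← hc, ← hp,
      ← hq, ← hr, Matrix.cons_val]
    refine ⟨?_, fun h0 => h.2 ?_⟩
    · linear_combination h.1
    · linear_combination h0

theorem pd_eq_deriv_of_axis {N : ℕ} {f : (Fin N → ℂ) → ℂ} {g : ℂ → ℂ} {i : Fin N}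
    (hf : DifferentiableAt ℂ f 0) (h : ∀ᶠ s in 𝓝 (0 : ℂ), f (Pi.single i s) = g s) :
    pd i f 0 = deriv g 0 := by
  have h1 : HasDerivAt (fun s : ℂ => (Pi.single i s : Fin N → ℂ)) (Pi.single i 1) 0 := by
    refine hasDerivAt_pi.2 fun j => ?_
    by_cases h : j = i
    · subst h; simp only [Pi.single_eq_same]; exact hasDerivAt_id' 0
    · simpa [h] using hasDerivAt_const (0 : ℂ) (0 : ℂ)
  have h0 : (Pi.single i (0 : ℂ) : Fin N → ℂ) = 0 := Pi.single_zero i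
  have h2 : HasDerivAt (fun s : ℂ => f (Pi.single i s)) (pd i f 0) 0 :=
    HasFDerivAt.comp_hasDerivAt (f := fun s : ℂ => (Pi.single i s : Fin N → ℂ)) 0
      (by rw [h0]; exact hf.hasFDerivAt) h1
  rw [← h2.deriv]
  exact Filter.EventuallyEq.deriv_eq h

namespace QuadPDE

variable {E : QuadPDE} {D : Set ℂ}

/-- A tangent that is not vertical allows the dispersion relation to be solved for `λ`, so that `μ`
may vary with any prescribed slope `m₁`. This freedom is needed to make the data generic. -/
theorem exists_null_curve {u₀ : ℂ} (hE : E.AnalyticCoeffAt u₀) {m₀ l₀ : ℂ}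
    (hnull : bil (E.V u₀) ![1, m₀, l₀] ![1, m₀, l₀] = 0)
    (htan : bil (E.V u₀) ![1, m₀, l₀] ![0, 0, 1] ≠ 0) (m₁ : ℂ) :
    ∃ l : ℂ → ℂ, AnalyticAt ℂ l 0 ∧ l 0 = l₀ ∧
      ∀ᶠ s in 𝓝 0, E.dispersion (u₀ + s) (l s) (m₀ + m₁ * s) = 0 := by
  have hfst : AnalyticAt ℂ (fun p : (Fin 1 → ℂ) × (Fin 1 → ℂ) => p.1 0) (0, fun _ => l₀) :=
    ((ContinuousLinearMap.proj (R := ℂ) (φ := fun _ : Fin 1 => ℂ) 0).comp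
      (ContinuousLinearMap.fst ℂ (Fin 1 → ℂ) (Fin 1 → ℂ))).analyticAt _
  have hsnd : AnalyticAt ℂ (fun p : (Fin 1 → ℂ) × (Fin 1 → ℂ) => p.2 0) (0, fun _ => l₀) :=
    ((ContinuousLinearMap.proj (R := ℂ) (φ := fun _ : Fin 1 => ℂ) 0).comp
      (ContinuousLinearMap.snd ℂ (Fin 1 → ℂ) (Fin 1 → ℂ))).analyticAt _
  have hcomp : ∀ {A : ℂ → ℂ}, AnalyticAt ℂ A u₀ → AnalyticAt ℂ
      (fun p : (Fin 1 → ℂ) × (Fin 1 → ℂ) => deriv A (u₀ + p.1 0)) (0, fun _ => l₀) := fun {A} hA =>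
    AnalyticAt.comp (g := deriv A) (f := fun p : (Fin 1 → ℂ) × (Fin 1 → ℂ) => u₀ + p.1 0)
      (by simpa using hA.deriv) (analyticAt_const.add hfst)
  have hder : HasDerivAt (fun l => E.dispersion u₀ l m₀)
      (2 * bil (E.V u₀) ![1, m₀, l₀] ![0, 0, 1]) l₀ := by
    unfold dispersion
    have h := hasDerivAt_id' l₀
    refine ((((h.fun_pow 2).const_mul (deriv E.c u₀)).const_add _).fun_add
      ((((h.const_mul (deriv E.q u₀)).const_add (deriv E.p u₀ * m₀)).fun_add
        ((h.mul_const m₀).const_mul (deriv E.r u₀))).const_mul 2)).congr_deriv ?_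
    simp only [bil_three, V, Matrix.of_apply, Matrix.cons_val]
    ring
  obtain ⟨r, hr, hr0, hrG⟩ := exists_implicit (n := 1) (m := 1)
    (G := fun p _ => E.dispersion (u₀ + p.1 0) (p.2 0) (m₀ + m₁ * p.1 0)) (X := 0)
    (R := fun _ => l₀) (by
      refine analyticAt_pi_iff.2 fun _ => ?_
      have hm : AnalyticAt ℂ (fun p : (Fin 1 → ℂ) × (Fin 1 → ℂ) => m₀ + m₁ * p.1 0)
        (0, fun _ => l₀) := analyticAt_const.add (analyticAt_const.mul hfst)
      unfold dispersion
      exact (((hcomp hE.a).add ((hcomp hE.b).mul (hm.pow 2))).add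
        ((hcomp hE.c).mul (hsnd.pow 2))).add (analyticAt_const.mul
        ((((hcomp hE.p).mul hm).add ((hcomp hE.q).mul hsnd)).add
          ((hcomp hE.r).mul (hsnd.mul hm)))))
    (by
      funext _
      simpa [dispersion_eq_bil] using hnull)
    (by
      intro v hv
      have h := hv 0
      have hd : pd 0 (fun S : Fin 1 → ℂ => E.dispersion u₀ (S 0) m₀) (fun _ => l₀) =
          2 * bil (E.V u₀) ![1, m₀, l₀] ![0, 0, 1] := by
        have hp : DifferentiableAt ℂ (fun S : Fin 1 → ℂ => S 0) (fun _ => l₀) := by fun_prop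
        rw [pd_scalar_comp (A := fun l => E.dispersion u₀ l m₀) (f := fun S : Fin 1 → ℂ => S 0)
          hder.differentiableAt hp, hder.deriv]
        have h2 := ((ContinuousLinearMap.proj (R := ℂ) (φ := fun _ : Fin 1 => ℂ) 0).hasFDerivAt
          (x := fun _ => l₀)).fderiv
        have h3 : fderiv ℂ (fun S : Fin 1 → ℂ => S 0) (fun _ => l₀) = _ := h2
        rw [pd, h3]
        simp
      simp only [Pi.zero_apply, add_zero, mul_zero, Finset.univ_unique, Fin.default_eq_zero,
        Finset.sum_singleton, hd] at h
      funext j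
      rw [Subsingleton.elim j 0]
      exact (mul_eq_zero.1 h).resolve_right (mul_ne_zero two_ne_zero htan))
  have hdiag : AnalyticAt ℂ (fun s : ℂ => (fun _ : Fin 1 => s)) 0 :=
    analyticAt_pi_iff.2 fun _ => analyticAt_id
  refine ⟨fun s => r (fun _ => s) 0, ?_, ?_, ?_⟩
  · exact AnalyticAt.comp (g := fun X => r X 0) (f := fun s : ℂ => (fun _ : Fin 1 => s))
      (analyticAt_pi_iff.1 hr 0) hdiag
  · exact congrFun hr0 0
  · have := hdiag.continuousAt.eventually (show ∀ᶠ Y in 𝓝 (fun _ : Fin 1 => (0 : ℂ)), _ from hrG)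
    filter_upwards [this] with s hs
    exact congrFun hs 0

end QuadPDE

/-! ### Necessity of the criterion -/

namespace QuadPDE

open Reduction

variable {E : QuadPDE} {D : Set ℂ}

/-- The state of the Gibbons–Tsarev system given by a reduction. -/
noncomputable def stateOf {N : ℕ} (u : (Fin N → ℂ) → ℂ) (lam mu : Fin N → (Fin N → ℂ) → ℂ)
    (R : Fin N → ℂ) : Option (Fin N × Fin 3) → ℂ
  | none => u R
  | some (i, c) => ![pd i u R, mu i R, lam i R] c

/-- One three-phase reduction with generic data through `u₀` is enough: its state satisfies the
Gibbons–Tsarev system near the origin, and `ode_of_solution` applies. -/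
theorem ode_of_integrable (hE : E.Holomorphic D) (hdet : E.Nondegenerate D)
    (hint : E.Integrable D) {u₀ : ℂ} (hu₀ : u₀ ∈ D) :
    ∃ k : ℂ, matDeriv (matDeriv E.V) u₀ =
      logDeriv (fun s => (E.V s).det) u₀ • matDeriv E.V u₀ + k • E.V u₀ := by
  have hEu := hE.analyticCoeffAt hu₀
  obtain ⟨m₀, l₀, hm₀, hnull⟩ := exists_null_points (E.V_isSymm u₀) (hdet u₀ hu₀)
  -- For `k ≠ i` the excluded slope is the one that makes `X_i`, `X_k` and `∂_i X_i` dependent: then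
  -- `∂_i X_i` is a multiple of `X_k - X_i`, fixed by differentiating the dispersion relation. For
  -- `k = i` the quotient is `0` by convention, a harmless extra exclusion.
  have hm₁ : ∀ i : Fin 3, ∃ m₁ : ℂ, ∀ k, m₁ ≠
      -(bil (matDeriv E.V u₀) ![1, m₀ i, l₀ i] ![1, m₀ i, l₀ i] * (m₀ k - m₀ i)) /
        (2 * bil (E.V u₀) ![1, m₀ i, l₀ i] ![1, m₀ k, l₀ k]) := by
    intro i
    obtain ⟨x, hx⟩ := Infinite.exists_notMem_finset (Finset.univ.image fun k =>
      -(bil (matDeriv E.V u₀) ![1, m₀ i, l₀ i] ![1, m₀ i, l₀ i] * (m₀ k - m₀ i)) /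
        (2 * bil (E.V u₀) ![1, m₀ i, l₀ i] ![1, m₀ k, l₀ k]))
    exact ⟨x, fun k h => hx (Finset.mem_image.2 ⟨k, Finset.mem_univ _, h.symm⟩)⟩
  choose m₁ hm₁ using hm₁
  have hcurve := fun i => exists_null_curve hEu (hnull i).1 (hnull i).2 (m₁ i)
  choose l hl hl0 hldisp using hcurve
  have hdata : E.IsInitialData D u₀ (fun _ s => u₀ + s) l (fun i s => m₀ i + m₁ i * s) := by
    refine ⟨hu₀, fun _ => by fun_prop, hl, fun _ => by fun_prop, fun _ => by simp, fun _ => ?_,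
      hldisp, fun i j hij h => hij (hm₀ ?_)⟩
    · simp
    · simpa using congrArg Prod.snd h
  obtain ⟨U, u, lam, mu, h0U, hred, haxis⟩ := hint 3 u₀ _ l _ hdata
  have hu := fun R hR => hred.analytic_u R hR
  have hlam := fun i R hR => hred.analytic_lam i R hR
  have hmu := fun i R hR => hred.analytic_mu i R hR
  have hs0 : ∀ i : Fin 3, (Pi.single i (0 : ℂ) : Fin 3 → ℂ) = 0 := fun i => Pi.single_zero i
  have hu0 : u 0 = u₀ := by simpa [hs0] using ((haxis 0).self_of_nhds).1
  have hlam0 : ∀ i, lam i 0 = l₀ i := fun i => by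
    simpa [hs0, hl0] using ((haxis i).self_of_nhds).2.1
  have hmu0 : ∀ i, mu i 0 = m₀ i := fun i => by simpa [hs0] using ((haxis i).self_of_nhds).2.2
  have hpu0 : ∀ i, pd i u 0 = 1 := fun i => by
    rw [pd_eq_deriv_of_axis (hu 0 h0U).differentiableAt
      ((haxis i).mono fun s hs => hs.1)]
    simp
  have hpmu0 : ∀ i, pd i (mu i) 0 = m₁ i := fun i => by
    rw [pd_eq_deriv_of_axis (hmu i 0 h0U).differentiableAt ((haxis i).mono fun s hs => hs.2.2)]
    simp
  have hUev : ∀ᶠ R in 𝓝 0, R ∈ U := hred.isOpen.mem_nhds h0U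
  have hpuev : ∀ᶠ R in 𝓝 0, ∀ i, pd i u R ≠ 0 := eventually_all.2 fun i =>
    ((hu 0 h0U).pd i).continuousAt.eventually_ne (by rw [hpu0]; exact one_ne_zero)
  have hdir : ∀ R ∈ U, ∀ i a, AnalyticAt ℂ (fun R => direction lam mu i R a) R := fun R hR =>
    analyticAt_direction (fun i => hlam i R hR) (fun i => hmu i R hR)
  have hspeed : ∀ R i, speed (stateOf u lam mu R) i = direction lam mu i R := by
    intro R i
    funext a
    fin_cases a <;> simp [speed, direction, stateOf]
  have hnullev : ∀ᶠ R in 𝓝 0, ∀ i,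
      bil (E.V (u R)) (direction lam mu i R) (direction lam mu i R) = 0 := by
    filter_upwards [hUev, hpuev] with R hR hp i
    exact (mul_eq_zero.1 (hred.self_interaction hE hR i).1).resolve_right (hp i)
  have hmune : ∀ᶠ R in 𝓝 0, ∀ i k, i ≠ k → mu k R - mu i R ≠ 0 := by
    refine eventually_all.2 fun i => eventually_all.2 fun k => ?_
    by_cases hik : i = k
    · exact Eventually.of_forall fun R h => absurd hik h
    · have h : mu k 0 - mu i 0 ≠ 0 := by
        rw [hmu0, hmu0, sub_ne_zero]; exact fun h => hik (hm₀ h).symm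
      have hc : ContinuousAt (fun R => mu k R - mu i R) 0 :=
        (hmu k 0 h0U).continuousAt.sub (hmu i 0 h0U).continuousAt
      filter_upwards [hc.eventually_ne h] with R hR _ using hR
  have hgram : ∀ R ∈ U, (∀ i, bil (E.V (u R)) (direction lam mu i R) (direction lam mu i R) = 0) →
      (∀ i k, i ≠ k → mu k R - mu i R ≠ 0) → ∀ i k, i ≠ k →
      bil (E.V (u R)) (direction lam mu i R) (direction lam mu k R) ≠ 0 := by
    intro R hR h1 h2 i k hik
    refine bil_ne_zero_of_null (V_isSymm _) (hdet _ (hred.mapsTo hR)) rfl rfl (fun h => ?_)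
      (h1 i) (h1 k)
    have := congrFun h 1
    simp only [direction, Matrix.cons_val] at this
    exact h2 i k hik (by rw [this, sub_self])
  -- Commutativity, with the denominator placed under the derivative of `mu`. The chosen `m₀` are
  -- distinct, so that denominator does not vanish.
  have hcross : ∀ᶠ R in 𝓝 0, ∀ i k, i ≠ k → ∀ a, pdDirection lam mu k i R a =
      pd k (mu i) R / (mu k R - mu i R) * (direction lam mu k R a - direction lam mu i R a) := by
    filter_upwards [hUev, hmune] with R hR hne i k hik a
    have h1 := hne i k hik
    have h2 := hred.compatible R hR i k hik
    fin_cases a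
    · simp [pdDirection_zero, direction]
    · simp only [pdDirection, direction, Fin.mk_one, Matrix.cons_val]
      field_simp
    · simp only [pdDirection, direction, Fin.reduceFinMk, Matrix.cons_val]
      field_simp
      exact h2
  have hpdbil : ∀ᶠ R in 𝓝 0, ∀ i k, pd k u R *
      bil (matDeriv E.V (u R)) (direction lam mu i R) (direction lam mu i R) +
      2 * bil (E.V (u R)) (direction lam mu i R) (pdDirection lam mu k i R) = 0 := by
    filter_upwards [hUev, hnullev.eventually_nhds] with R hR hn i k
    have h1 : pd k (fun R => bil (E.V (u R)) (direction lam mu i R) (direction lam mu i R)) R = 0 := by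
      rw [pd_congr (g := fun _ => 0) _ k, pd_const]
      filter_upwards [hn] with S hS using hS i
    rw [pd_bil (fun a b => ((hE.analyticCoeffAt (hred.mapsTo hR)).analyticAt_V a b).differentiableAt)
      (hu R hR).differentiableAt (fun a => (hdir R hR i a).differentiableAt)
      (fun a => (hdir R hR i a).differentiableAt)] at h1
    have h2 := bil_comm (fun a => pd k (fun R => direction lam mu i R a) R) (direction lam mu i R)
      (E.V_isSymm (u R))
    rw [h2] at h1
    unfold pdDirection
    linear_combination h1
  -- Inserting `∂_k X_i = γ (X_k - X_i)` into the differentiated dispersion relation determines `γ`.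
  have hγ : ∀ᶠ R in 𝓝 0, ∀ i k, i ≠ k → pd k (mu i) R / (mu k R - mu i R) =
      -(bil (matDeriv E.V (u R)) (direction lam mu i R) (direction lam mu i R) /
        (2 * bil (E.V (u R)) (direction lam mu i R) (direction lam mu k R))) * pd k u R := by
    filter_upwards [hUev, hnullev, hmune, hcross, hpdbil] with R hR h1 h2 h3 h4 i k hik
    have hg := hgram R hR h1 h2 i k hik
    have h5 := h4 i k
    rw [show pdDirection lam mu k i R = (pd k (mu i) R / (mu k R - mu i R)) •
      (direction lam mu k R - direction lam mu i R) from funext fun a => h3 i k hik a,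
      bil_smul_right, bil_sub_right, h1, sub_zero] at h5
    generalize pd k (mu i) R / (mu k R - mu i R) = γ at h5 ⊢
    field_simp
    linear_combination h5
  have hdet0 : ∀ i k, i ≠ k → ∑ a, crossProduct (direction lam mu i 0) (direction lam mu k 0) a *
      pdDirection lam mu i i 0 a ≠ 0 := by
    intro i k hik h
    have hg := hgram 0 h0U hnullev.self_of_nhds hmune.self_of_nhds i k hik
    apply hm₁ i k
    have h1 := hpdbil.self_of_nhds i i
    have h2 := hnullev.self_of_nhds i
    have hd0 : ∀ i, direction lam mu i 0 = ![1, m₀ i, l₀ i] := fun i => by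
      simp only [direction, hmu0, hlam0]
    rw [hpu0, hu0, hd0] at h1
    rw [hu0, hd0] at h2
    rw [hu0, hd0, hd0] at hg
    rw [hd0, hd0] at h
    have hpd1 : pdDirection lam mu i i 0 1 = m₁ i := hpmu0 i
    rw [eq_div_iff (mul_ne_zero two_ne_zero hg)]
    simp only [bil_three, cross_apply, Fin.sum_univ_three, Matrix.cons_val, hpd1,
      pdDirection_zero] at h h1 h2 ⊢
    have hM := E.V_isSymm u₀
    simp only [hM.apply 0 1, hM.apply 0 2, hM.apply 1 2] at h1 h2 ⊢
    linear_combination (m₀ k - m₀ i) * h1 - 2 * (E.V u₀ 0 2 + E.V u₀ 1 2 * m₀ i + E.V u₀ 2 2 * l₀ i)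
      * h + 2 * m₁ i * h2
  have hdetev : ∀ᶠ R in 𝓝 0, ∀ i k, i ≠ k → ∑ a, crossProduct (direction lam mu i R)
      (direction lam mu k R) a * pdDirection lam mu i i R a ≠ 0 := by
    refine eventually_all.2 fun i => eventually_all.2 fun k => ?_
    by_cases hik : i = k
    · exact Eventually.of_forall fun R h => absurd hik h
    · have hc : ContinuousAt (fun R => ∑ a, crossProduct (direction lam mu i R)
          (direction lam mu k R) a * pdDirection lam mu i i R a) 0 := by
        have c1 := fun i a => (hdir 0 h0U i a).continuousAt
        refine tendsto_finsetSum _ fun a _ =>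
          ContinuousAt.mul ?_ ((hdir 0 h0U i a).pd i).continuousAt
        fin_cases a <;> simp only [cross_apply, Fin.zero_eta, Fin.mk_one, Fin.reduceFinMk,
          Matrix.cons_val]
        exacts [((c1 i 1).mul (c1 k 2)).sub ((c1 i 2).mul (c1 k 1)),
          ((c1 i 2).mul (c1 k 0)).sub ((c1 i 0).mul (c1 k 2)),
          ((c1 i 0).mul (c1 k 1)).sub ((c1 i 1).mul (c1 k 0))]
      filter_upwards [hc.eventually_ne (hdet0 i k hik)] with R hR _ using hR
  -- The double wave is taken at the cross product of the two directions, which satisfies both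
  -- hodograph equations; the choice of slopes makes it nondegenerate there. In the sum of the two
  -- interactions the derivatives of the directions cancel.
  have hsecond : ∀ᶠ R in 𝓝 0, ∀ i k, i ≠ k → pd k (pd i u) R =
      -(bil (matDeriv E.V (u R)) (direction lam mu i R) (direction lam mu k R) /
        bil (E.V (u R)) (direction lam mu i R) (direction lam mu k R)) * pd i u R * pd k u R := by
    filter_upwards [hUev, hnullev, hmune, hcross.eventually_nhds, hdetev] with R hR h1 h2 h3 h4 i k hik
    have hg := hgram R hR h1 h2 i k hik
    have hsum := hred.pair_interaction hE hR hik
      (X₀ := crossProduct (direction lam mu i R) (direction lam mu k R))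
      (by filter_upwards [h3] with S hS i k hik using ⟨_, hS i k hik⟩)
      (by simp only [cross_apply, Fin.sum_univ_three, Matrix.cons_val]; ring)
      (by simp only [cross_apply, Fin.sum_univ_three, Matrix.cons_val]; ring)
      (h4 i k hik) (by
        have h := h4 k i hik.symm
        rw [← cross_anticomm] at h
        simpa using h)
    have hpd : ∀ i k, i ≠ k → pdDirection lam mu k i R = (pd k (mu i) R / (mu k R - mu i R)) •
        (direction lam mu k R - direction lam mu i R) := fun i k hik =>
      funext fun a => h3.self_of_nhds i k hik a
    unfold interaction at hsum
    rw [hpd i k hik, hpd k i hik.symm] at hsum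
    simp only [bil_smul_left, bil_smul_right, bil_sub_left, bil_sub_right, h1] at hsum
    rw [bil_comm (direction lam mu k R) (direction lam mu i R) (E.V_isSymm _),
      bil_comm (direction lam mu k R) (direction lam mu i R) (matDeriv_isSymm E.V_isSymm _),
      pd_comm (hu R hR) i k] at hsum
    field_simp
    linear_combination (1 / 2) * hsum
  have hY : AnalyticAt ℂ (stateOf u lam mu) 0 := by
    refine analyticAt_pi_iff.2 fun a => ?_
    rcases a with _ | ⟨i, c⟩
    · exact hu 0 h0U
    · fin_cases c
      exacts [(hu 0 h0U).pd i, hmu i 0 h0U, hlam i 0 h0U]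
  have hY0 : stateOf u lam mu 0 none = u₀ := hu0
  have := ode_of_solution (V := E.V) E.V_isSymm hY
    ⟨by rw [hY0]; exact hEu.analyticAt_V, by
      intro i k hik
      rw [hspeed, hspeed]
      exact hgram 0 h0U hnullev.self_of_nhds hmune.self_of_nhds i k hik⟩
    (by rw [hY0]; exact hdet u₀ hu₀)
    (fun i => hpuev.self_of_nhds i)
    (fun i => by
      rw [disp, hspeed]
      exact hnullev.self_of_nhds i)
    (by
      filter_upwards [hcross, hγ, hsecond] with R h1 h2 h3 a j hj
      rcases a with _ | ⟨i, c⟩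
      · rfl
      · have hij : i ≠ j := fun h => hj (by simp [frozen, h])
        by_cases hc : c = 0
        · subst hc
          rw [rhs_velocity _ hij.symm, hspeed, hspeed]
          exact h3 i j hij
        · rw [rhs_speed _ hc hij.symm, hspeed, hspeed]
          have h4 := h1 i j hij c
          rw [h2 i j hij] at h4
          rw [← show pdDirection lam mu j i R c = pd j (fun R => stateOf u lam mu R (some (i, c))) R
            from ?_, h4]
          · rfl
          · unfold pdDirection
            congr 1
            funext S
            rw [← hspeed]
            simp [speed, hc])
  rwa [hY0] at this

theorem integrable_iff (hD : IsOpen D) (hE : E.Holomorphic D) (hdet : E.Nondegenerate D) :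
    E.Integrable D ↔ ∃ k : ℂ → ℂ, ∀ u ∈ D, matDeriv (matDeriv E.V) u =
      logDeriv (fun s => (E.V s).det) u • matDeriv E.V u + k u • E.V u := by
  refine ⟨fun h => ?_, integrable_of_ode hD hE hdet⟩
  have key : ∀ u, ∃ k : ℂ, u ∈ D → matDeriv (matDeriv E.V) u =
      logDeriv (fun s => (E.V s).det) u • matDeriv E.V u + k • E.V u := by
    intro u
    by_cases hu : u ∈ D
    · obtain ⟨k, hk⟩ := ode_of_integrable hE hdet h hu
      exact ⟨k, fun _ => hk⟩
    · exact ⟨0, fun h => absurd h hu⟩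
  choose k hk using key
  exact ⟨k, hk⟩

end QuadPDE

/-! ### Normal forms of pencils of ternary quadratic forms -/

open Matrix in
theorem bil_eq_dotProduct (M : Matrix (Fin 3) (Fin 3) ℂ) (x y : Fin 3 → ℂ) :
    bil M x y = (x ᵥ* M) ⬝ᵥ y := by
  simp only [bil, dotProduct, vecMul, Finset.sum_mul]
  rw [Finset.sum_comm]
  exact Finset.sum_congr rfl fun a _ => Finset.sum_congr rfl fun b _ => by ring

open Matrix in
/-- The vector orthogonal to two given ones. -/
noncomputable def bilCross (M : Matrix (Fin 3) (Fin 3) ℂ) (x y : Fin 3 → ℂ) : Fin 3 → ℂ :=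
  crossProduct (x ᵥ* M) (y ᵥ* M)

section bilCross

variable (M : Matrix (Fin 3) (Fin 3) ℂ) (x y : Fin 3 → ℂ)

theorem bil_bilCross_left : bil M x (bilCross M x y) = 0 := by
  rw [bil_eq_dotProduct, bilCross, dot_self_cross]

theorem bil_bilCross_right : bil M y (bilCross M x y) = 0 := by
  rw [bil_eq_dotProduct, bilCross, dot_cross_self]

variable {M}

open Matrix in
-- Applying `M` to the cross product of `x M` and `y M` gives `det M` times that of `x` and `y`; the
-- Binet–Cauchy identity does the rest.
theorem bil_bilCross_self (hM : M.IsSymm) : bil M (bilCross M x y) (bilCross M x y) =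
    M.det * (bil M x x * bil M y y - bil M x y ^ 2) := by
  have h : bilCross M x y ᵥ* M = M.det • crossProduct x y := by
    funext i
    rw [det_fin_three]
    fin_cases i <;>
    · simp only [bilCross, vecMul, dotProduct, Fin.sum_univ_three, cross_apply, Pi.smul_apply,
        smul_eq_mul, cons_val, Fin.zero_eta, Fin.mk_one, Fin.reduceFinMk, hM.apply 0 1,
        hM.apply 0 2, hM.apply 1 2]
      ring
  rw [bil_eq_dotProduct, h, smul_dotProduct, bilCross, cross_dot_cross, bil_comm x y hM,
    bil_eq_dotProduct, bil_eq_dotProduct, bil_eq_dotProduct, smul_eq_mul,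
    dotProduct_comm x, dotProduct_comm y, dotProduct_comm x, dotProduct_comm y]
  have h2 : x ᵥ* M ⬝ᵥ y = y ᵥ* M ⬝ᵥ x := by
    rw [← bil_eq_dotProduct, ← bil_eq_dotProduct, bil_comm x y hM]
  rw [h2]
  ring

end bilCross

/-- The first generator of the pencil of a canonical form. -/
noncomputable def pencilFst : Fin 5 → Matrix (Fin 3) (Fin 3) ℂ :=
  ![!![1, 0, 0; 0, 1, 0; 0, 0, 0], !![1, 0, 0; 0, 1, 0; 0, 0, 0], !![-1, 1, 0; 1, 0, 0; 0, 0, 0],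
    !![0, 0, 1 / 2; 0, -1, 0; 1 / 2, 0, 0], !![0, 0, 1; 0, 1, 0; 1, 0, 0]]

/-- The second generator of the pencil of a canonical form. -/
noncomputable def pencilSnd : Fin 5 → Matrix (Fin 3) (Fin 3) ℂ :=
  ![!![-1, 0, 0; 0, 0, 0; 0, 0, 1], !![0, 0, 0; 0, 0, 0; 0, 0, 1], !![1, 0, 0; 0, 0, 0; 0, 0, 1],
    !![-1, 0, 0; 0, 0, 0; 0, 0, 0], !![0, 1, 0; 1, 0, 0; 0, 0, 0]]

/-- A congruence takes the pencil spanned by `B` and `G` into that of the `i`-th canonical form. -/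
def HasNormalForm (B G : Matrix (Fin 3) (Fin 3) ℂ) (i : Fin 5) : Prop :=
  ∃ (S : Matrix (Fin 3) (Fin 3) ℂ) (a b c d : ℂ), S.det ≠ 0 ∧
    S * B * S.transpose = a • pencilFst i + b • pencilSnd i ∧
    S * G * S.transpose = c • pencilFst i + d • pencilSnd i

/-- Only the span of `B` and `G` matters, so an eigenvalue can be shifted to zero. -/
theorem HasNormalForm.of_sub_smul {B G : Matrix (Fin 3) (Fin 3) ℂ} {i : Fin 5} {s : ℂ}
    (h : HasNormalForm B (G - s • B) i) : HasNormalForm B G i := by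
  obtain ⟨S, a, b, c, d, hS, hB, hG⟩ := h
  refine ⟨S, a, b, c + s * a, d + s * b, hS, hB, ?_⟩
  have : S * G * S.transpose = S * (G - s • B) * S.transpose + s • (S * B * S.transpose) := by
    simp [Matrix.mul_sub, Matrix.sub_mul]
  rw [this, hG, hB]
  module

/-- The congruence has rows `x`, `y`, `z`. Its invertibility comes for free from the Gram
determinant of `B`. -/
theorem hasNormalForm_of_gram {B G : Matrix (Fin 3) (Fin 3) ℂ} {i : Fin 5} (hB : B.IsSymm)
    (hG : G.IsSymm) (x y z : Fin 3 → ℂ) (a b c d : ℂ)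
    (h1 : !![bil B x x, bil B x y, bil B x z; bil B x y, bil B y y, bil B y z;
      bil B x z, bil B y z, bil B z z] = a • pencilFst i + b • pencilSnd i)
    (h2 : !![bil G x x, bil G x y, bil G x z; bil G x y, bil G y y, bil G y z;
      bil G x z, bil G y z, bil G z z] = c • pencilFst i + d • pencilSnd i)
    (hdet : (a • pencilFst i + b • pencilSnd i).det ≠ 0) : HasNormalForm B G i := by
  have key : ∀ M : Matrix (Fin 3) (Fin 3) ℂ, M.IsSymm →
      Matrix.of ![x, y, z] * M * (Matrix.of ![x, y, z]).transpose =
      !![bil M x x, bil M x y, bil M x z; bil M x y, bil M y y, bil M y z;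
        bil M x z, bil M y z, bil M z z] := by
    intro M hM
    ext i j
    rw [bil_eq_mul_transpose]
    fin_cases i <;> fin_cases j <;> simp [bil_comm _ _ hM]
  refine ⟨Matrix.of ![x, y, z], a, b, c, d, fun h => hdet ?_, (key B hB).trans h1,
    (key G hG).trans h2⟩
  rw [← h1, ← key B hB, Matrix.det_mul, Matrix.det_mul, h, zero_mul, zero_mul]

/-- Vectors `e`, `f`, `g` with the Gram matrix of an orthonormal vector `f` and an isotropic pair. -/
structure IsWittBasis (B : Matrix (Fin 3) (Fin 3) ℂ) (e f g : Fin 3 → ℂ) : Prop where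
  ee : bil B e e = 0
  ef : bil B e f = 0
  eg : bil B e g = 1
  ff : bil B f f = 1
  fg : bil B f g = 0
  gg : bil B g g = 0

section

variable {B G : Matrix (Fin 3) (Fin 3) ℂ}

theorem exists_bil_ne_zero (hdet : B.det ≠ 0) {e : Fin 3 → ℂ} (he : e ≠ 0) :
    ∃ y, bil B e y ≠ 0 := by
  by_contra! h
  have h1 : Matrix.vecMul e B = 0 := by
    funext i
    have := h (Pi.single i 1)
    rw [bil_eq_dotProduct] at this
    simpa using this
  exact he (Matrix.eq_zero_of_vecMul_eq_zero hdet h1)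

/-- The vector `e` is completed to a hyperbolic pair `e`, `g`. The vector orthogonal to the pair has
square `-det B`, which is not zero, so it can be normalised. -/
theorem exists_isWittBasis (hB : B.IsSymm) (hdet : B.det ≠ 0) {e : Fin 3 → ℂ} (he : e ≠ 0)
    (hee : bil B e e = 0) : ∃ f g, IsWittBasis B e f g := by
  obtain ⟨y, hy⟩ := exists_bil_ne_zero hdet he
  obtain ⟨y', hy'⟩ : ∃ y', y' = (bil B e y)⁻¹ • y := ⟨_, rfl⟩
  have h1 : bil B e y' = 1 := by rw [hy', bil_smul_right, inv_mul_cancel₀ hy]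
  obtain ⟨g, hg⟩ : ∃ g, g = y' - (bil B y' y' / 2) • e := ⟨_, rfl⟩
  have heg : bil B e g = 1 := by rw [hg, bil_sub_right, bil_smul_right, h1, hee]; ring
  have hgg : bil B g g = 0 := by
    rw [hg]
    simp only [bil_sub_left, bil_sub_right, bil_smul_left, bil_smul_right, hee, h1,
      bil_comm y' e hB]
    ring
  have hf := bil_bilCross_self e g hB
  rw [hee, hgg, heg] at hf
  obtain ⟨s, hs⟩ := IsAlgClosed.exists_eq_mul_self (bil B (bilCross B e g) (bilCross B e g))
  have hs0 : s ≠ 0 := by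
    rintro rfl
    rw [hf] at hs
    exact hdet (by linear_combination -hs)
  refine ⟨s⁻¹ • bilCross B e g, g, hee, ?_, heg, ?_, ?_, hgg⟩
  · rw [bil_smul_right, bil_bilCross_left, mul_zero]
  · rw [bil_smul_left, bil_smul_right, hs]; field_simp
  · rw [bil_comm _ _ hB, bil_smul_right, bil_bilCross_right, mul_zero]

/-- The transvections fixing `e`. -/
theorem IsWittBasis.transvection (hB : B.IsSymm) {e f g : Fin 3 → ℂ} (h : IsWittBasis B e f g)
    (t : ℂ) : IsWittBasis B e (f - t • e) (g + t • f - (t ^ 2 / 2) • e) := by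
  obtain ⟨ee, ef, eg, ff, fg, gg⟩ := h
  have hc := fun x y => bil_comm x y hB
  constructor <;> simp only [bil_sub_left, bil_sub_right, bil_smul_left, bil_smul_right,
    bil_add_left, bil_add_right, ee, ef, eg, ff, fg, gg, hc f e, hc g e, hc g f] <;> ring

/-- Pencils with an isotropic eigenvector. -/
theorem exists_hasNormalForm_of_isotropic (hB : B.IsSymm) (hG : G.IsSymm) (hdet : B.det ≠ 0)
    {e : Fin 3 → ℂ} (he : e ≠ 0) (hee : bil B e e = 0) (hGe : ∀ y, bil G e y = 0) :
    ∃ i, HasNormalForm B G i := by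
  obtain ⟨f₀, g₀, h₀⟩ := exists_isWittBasis hB hdet he hee
  have hGe' : ∀ y, bil G y e = 0 := fun y => by rw [bil_comm _ _ hG, hGe]
  have hc := fun x y => bil_comm x y hB
  have hcG := fun x y => bil_comm x y hG
  -- Since `e` lies in the kernel, `G` has three entries `z = G(f, f)`, `x = G(f, g)`, `y = G(g,
  -- g)`. The transvection by `t` fixes `z`, adds `t z` to `x` and `2 t x + t² z` to `y`. So `x` can
  -- be removed if `z ≠ 0`, and `y` if `z = 0` and `x ≠ 0`. The possibilities `z = x = 0`; `z = 0 ≠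
  -- x`; `z ≠ 0 = y`; `z, y ≠ 0` give the indices `3`, `4`, `1`, `2`.
  by_cases hz : bil G f₀ f₀ = 0
  · by_cases hx : bil G f₀ g₀ = 0
    · obtain ⟨ee, ef, eg, ff, fg, gg⟩ := h₀
      refine ⟨3, hasNormalForm_of_gram hB hG g₀ (Complex.I • f₀) ((1 / 2 : ℂ) • e) 1 0 0
        (-bil G g₀ g₀) ?_ ?_ ?_⟩
      · simp only [bil_smul_left, bil_smul_right, hc g₀ e, hc f₀ e, ee, ef, eg, ff, hc g₀ f₀,
          fg, gg, pencilFst, pencilSnd]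
        ext i j; fin_cases i <;> fin_cases j <;> simp
      · simp only [bil_smul_left, bil_smul_right, hGe', hcG g₀ f₀, hx, hz, pencilFst, pencilSnd]
        ext i j; fin_cases i <;> fin_cases j <;> simp
      · simp [pencilFst, pencilSnd, Matrix.det_fin_three]
    · obtain ⟨t, ht⟩ : ∃ t, t = -bil G g₀ g₀ / (2 * bil G f₀ g₀) := ⟨_, rfl⟩
      have h := h₀.transvection hB t
      have hff : bil G (f₀ - t • e) (f₀ - t • e) = 0 := by
        simp only [bil_sub_left, bil_sub_right, bil_smul_left, bil_smul_right, hGe, hGe', hz]; ring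
      have hfg : bil G (f₀ - t • e) (g₀ + t • f₀ - (t ^ 2 / 2) • e) = bil G f₀ g₀ := by
        simp only [bil_sub_left, bil_sub_right, bil_smul_left, bil_smul_right, bil_add_right,
          hGe, hGe', hz]; ring
      have hgg : bil G (g₀ + t • f₀ - (t ^ 2 / 2) • e) (g₀ + t • f₀ - (t ^ 2 / 2) • e) = 0 := by
        simp only [bil_sub_left, bil_sub_right, bil_smul_left, bil_smul_right, bil_add_right,
          bil_add_left, hGe, hGe', hz, hcG g₀ f₀]
        rw [ht]; field_simp; ring
      generalize g₀ + t • f₀ - (t ^ 2 / 2) • e = g at h hfg hgg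
      generalize f₀ - t • e = f at h hff hfg
      obtain ⟨ee, ef, eg, ff, fg, gg⟩ := h
      refine ⟨4, hasNormalForm_of_gram hB hG g f e 1 0 0 (bil G f₀ g₀) ?_ ?_ ?_⟩
      · simp only [hc g e, hc f e, hc g f, ee, ef, eg, ff, fg, gg, pencilFst, pencilSnd]
        ext i j; fin_cases i <;> fin_cases j <;> simp
      · simp only [hGe', hcG g f, hff, hfg, hgg, pencilFst, pencilSnd]
        ext i j; fin_cases i <;> fin_cases j <;> simp
      · simp [pencilFst, pencilSnd, Matrix.det_fin_three]
  · obtain ⟨t, ht⟩ : ∃ t, t = -bil G f₀ g₀ / bil G f₀ f₀ := ⟨_, rfl⟩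
    have h := h₀.transvection hB t
    have hff : bil G (f₀ - t • e) (f₀ - t • e) = bil G f₀ f₀ := by
      simp only [bil_sub_left, bil_sub_right, bil_smul_left, bil_smul_right, hGe, hGe']; ring
    have hfg : bil G (f₀ - t • e) (g₀ + t • f₀ - (t ^ 2 / 2) • e) = 0 := by
      simp only [bil_sub_left, bil_sub_right, bil_smul_left, bil_smul_right, bil_add_right,
        hGe, hGe']
      rw [ht]; field_simp; ring
    generalize g₀ + t • f₀ - (t ^ 2 / 2) • e = g at h hfg
    generalize f₀ - t • e = f at h hff hfg
    obtain ⟨ee, ef, eg, ff, fg, gg⟩ := h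
    generalize bil G f₀ f₀ = z at hz hff
    by_cases hy : bil G g g = 0
    · refine ⟨1, hasNormalForm_of_gram hB hG (g + (1 / 2 : ℂ) • e)
        (Complex.I • (g - (1 / 2 : ℂ) • e)) f 1 1 0 z ?_ ?_ ?_⟩
      · simp only [bil_sub_left, bil_sub_right, bil_smul_left, bil_smul_right, bil_add_left,
          bil_add_right, hc g e, hc g f, ee, ef, eg, ff, fg, gg, pencilFst, pencilSnd]
        ext i j; fin_cases i <;> fin_cases j <;> simp <;> norm_num
        linear_combination -Complex.I_mul_I
      · simp only [bil_sub_left, bil_sub_right, bil_smul_left, bil_smul_right, bil_add_left,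
          bil_add_right, hGe, hGe', hcG g f, hfg, hff, hy, pencilFst, pencilSnd]
        ext i j; fin_cases i <;> fin_cases j <;> simp
      · simp [pencilFst, pencilSnd, Matrix.det_fin_three]
    · obtain ⟨s, hs⟩ := IsAlgClosed.exists_eq_mul_self (z / bil G g g)
      have hs0 : s ≠ 0 := by
        rintro rfl
        simp [hz, hy] at hs
      have hs2 : s * (s * bil G g g) = z := by
        rw [← mul_assoc, ← hs]; field_simp
      refine ⟨2, hasNormalForm_of_gram hB hG (s • g) (s⁻¹ • e) f 1 1 0 z ?_ ?_ ?_⟩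
      · simp only [bil_smul_left, bil_smul_right, hc g e, hc g f, ee, ef, eg, ff, fg, gg,
          pencilFst, pencilSnd]
        ext i j; fin_cases i <;> fin_cases j <;> simp [hs0]
      · simp only [bil_smul_left, bil_smul_right, hGe, hGe', hcG g f, hfg, hff, hs2,
          pencilFst, pencilSnd]
        ext i j; fin_cases i <;> fin_cases j <;> simp
      · simp [pencilFst, pencilSnd, Matrix.det_fin_three]

theorem bil_eq_zero_of_basis {M X : Matrix (Fin 3) (Fin 3) ℂ} (hX : X.det ≠ 0) {x : Fin 3 → ℂ}
    (h : ∀ i, bil M x (X i) = 0) (y : Fin 3 → ℂ) : bil M x y = 0 := by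
  have h1 : X.mulVec (Matrix.vecMul x M) = 0 := by
    funext i
    have := h i
    rw [bil_eq_dotProduct, dotProduct_comm] at this
    exact this
  rw [bil_eq_dotProduct, Matrix.eq_zero_of_mulVec_eq_zero hX h1, zero_dotProduct]

/-- Otherwise, by polarisation, `B(e, e) B` would be the square of the linear form `B(e, ·)`, of
rank one. -/
theorem exists_bil_mul_sub_sq_ne_zero (hB : B.IsSymm) (hdet : B.det ≠ 0) {e : Fin 3 → ℂ}
    (hee : bil B e e ≠ 0) : ∃ y, bil B e e * bil B y y - bil B e y ^ 2 ≠ 0 := by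
  by_contra! h
  have h1 : ∀ x y, bil B e e * bil B x y = bil B e x * bil B e y := by
    intro x y
    have hx := h x
    have hy := h y
    have hxy := h (x + y)
    simp only [bil_add_left, bil_add_right, bil_comm y x hB] at hxy
    linear_combination (1 / 2) * hxy - (1 / 2) * hx - (1 / 2) * hy
  have h2 : ∀ i j, bil B e e * B i j = bil B e (Pi.single i 1) * bil B e (Pi.single j 1) := by
    intro i j
    rw [← h1]
    congr 1
    simp [bil, Pi.single_apply]
  have h3 : bil B e e ^ 3 * B.det = 0 := by
    have hd : (bil B e e • B).det = bil B e e ^ 3 * B.det := by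
      rw [Matrix.det_smul, Fintype.card_fin]
    rw [← hd, Matrix.det_fin_three]
    simp only [Matrix.smul_apply, smul_eq_mul, h2]
    ring
  exact mul_ne_zero (pow_ne_zero _ hee) hdet h3

/-- Pencils without isotropic eigenvectors. -/
theorem hasNormalForm_of_anisotropic (hB : B.IsSymm) (hG : G.IsSymm) (hdet : B.det ≠ 0)
    {e₁ : Fin 3 → ℂ} (h₁ : bil B e₁ e₁ ≠ 0) (hG₁ : ∀ y, bil G e₁ y = 0)
    (hP : ∀ c e, e ≠ 0 → bil B e e = 0 → ¬ ∀ y, bil G e y = c * bil B e y) :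
    HasNormalForm B G 0 := by
  have hc := fun x y => bil_comm x y hB
  have hcG := fun x y => bil_comm x y hG
  have hG₁' : ∀ y, bil G y e₁ = 0 := fun y => by rw [hcG, hG₁]
  -- An isotropic basis of the plane orthogonal to `e₁`, obtained from two orthogonal anisotropic
  -- vectors of that plane.
  obtain ⟨e, g, h1e, h1g, hee, heg, hgg⟩ : ∃ e g, bil B e₁ e = 0 ∧ bil B e₁ g = 0 ∧
      bil B e e = 0 ∧ bil B e g = 1 ∧ bil B g g = 0 := by
    obtain ⟨y, hy⟩ := exists_bil_mul_sub_sq_ne_zero hB hdet h₁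
    have f1 := bil_bilCross_left B e₁ y
    have ff := bil_bilCross_self e₁ y hB
    generalize bilCross B e₁ y = f at f1 ff
    have g1 := bil_bilCross_left B e₁ f
    have gf := bil_bilCross_right B e₁ f
    have gg := bil_bilCross_self e₁ f hB
    generalize bilCross B e₁ f = g at g1 gf gg
    rw [f1] at gg
    have ff0 : bil B f f ≠ 0 := by rw [ff]; exact mul_ne_zero hdet hy
    have gg0 : bil B g g ≠ 0 := by
      rw [gg]; exact mul_ne_zero hdet (by simp [h₁, ff0])
    obtain ⟨s, hs⟩ := IsAlgClosed.exists_eq_mul_self (bil B f f)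
    obtain ⟨t, ht⟩ := IsAlgClosed.exists_eq_mul_self (-bil B g g)
    have hs0 : s ≠ 0 := by rintro rfl; exact ff0 (by rw [hs]; ring)
    have ht0 : t ≠ 0 := by rintro rfl; exact gg0 (by linear_combination -ht)
    have ht' : bil B g g = -(t * t) := by linear_combination -ht
    refine ⟨s⁻¹ • f + t⁻¹ • g, (1 / 2 : ℂ) • (s⁻¹ • f - t⁻¹ • g), ?_, ?_, ?_, ?_, ?_⟩ <;>
    simp only [bil_sub_left, bil_sub_right, bil_smul_left, bil_smul_right, bil_add_left,
      bil_add_right, f1, g1, hc g f, gf, hs, ht'] <;> field_simp <;> ring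
  set X : Matrix (Fin 3) (Fin 3) ℂ := Matrix.of ![e₁, e, g] with hX
  have hXdet : X.det ≠ 0 := by
    intro h0
    have h : (X * B * X.transpose).det = 0 := by
      rw [Matrix.det_mul, Matrix.det_mul, h0, zero_mul, zero_mul]
    rw [Matrix.det_fin_three] at h
    simp only [hX, bil_eq_mul_transpose, Matrix.cons_val, hc e e₁, hc g e₁, hc g e, h1e, h1g, hee,
      heg, hgg] at h
    exact h₁ (by linear_combination -h)
  have hbasis : ∀ c v, bil G v e = c * bil B v e → bil G v g = c * bil B v g →
      c * bil B v e₁ = 0 → ∀ y, bil G v y = c * bil B v y := by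
    intro c v h1 h2 h3 y
    have key : ∀ y, bil (G - c • B) v y = bil G v y - c * bil B v y := by
      intro y
      have := bil_add_smul_matrix G v y 1 B (-c)
      rw [one_smul, neg_smul, ← sub_eq_add_neg] at this
      rw [this]; ring
    have := bil_eq_zero_of_basis (M := G - c • B) hXdet (x := v) (by
      intro i
      rw [key]
      fin_cases i
      · exact (by rw [hG₁', h3, sub_zero] : bil G v e₁ - c * bil B v e₁ = 0)
      · exact sub_eq_zero.2 h1
      · exact sub_eq_zero.2 h2) y
    rw [key] at this
    exact sub_eq_zero.1 this
  obtain ⟨p, hp⟩ : ∃ p, p = bil G e e := ⟨_, rfl⟩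
  obtain ⟨q, hq⟩ : ∃ q, q = bil G e g := ⟨_, rfl⟩
  obtain ⟨r, hr⟩ : ∃ r, r = bil G g g := ⟨_, rfl⟩
  have hzero : ∀ y : Fin 3 → ℂ, bil B 0 y = 0 := fun y => by simp [bil]
  have hp0 : p ≠ 0 := by
    intro h
    refine hP q e (fun h0 => ?_) hee (hbasis q e ?_ ?_ ?_)
    · rw [h0, hzero] at heg; exact zero_ne_one heg
    · rw [← hp, h, hee, mul_zero]
    · rw [heg, mul_one, hq]
    · rw [hc, h1e, mul_zero]
  have hr0 : r ≠ 0 := by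
    intro h
    refine hP q g (fun h0 => ?_) hgg (hbasis q g ?_ ?_ ?_)
    · rw [hc, h0, hzero] at heg; exact zero_ne_one heg
    · rw [hcG, hc g e, heg, mul_one, hq]
    · rw [← hr, h, hgg, mul_zero]
    · rw [hc, h1g, mul_zero]
  obtain ⟨s, hs⟩ := IsAlgClosed.exists_eq_mul_self (p * r)
  have hs0 : s ≠ 0 := by
    rintro rfl
    simp [hp0, hr0] at hs
  -- The vector `s e + p g` is an eigenvector with eigenvalue `q + s`. If that were zero, a
  -- combination with `e₁` would be isotropic and in the kernel of `G`, which `hP` forbids.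
  have heig : ∀ s, p * r = s * s → s ≠ 0 → q + s ≠ 0 := by
    intro s hs hs0 hqs
    obtain ⟨c, hcc⟩ := IsAlgClosed.exists_eq_mul_self (-(2 * s * p) / bil B e₁ e₁)
    have hvv : bil B (c • e₁ + (s • e + p • g)) (s • e + p • g) = 2 * s * p := by
      simp only [bil_smul_left, bil_smul_right, bil_add_left, bil_add_right, hc g e, h1e, h1g, hee, heg,
        hgg]; ring
    refine hP 0 (c • e₁ + (s • e + p • g)) (fun h0 => ?_) ?_ (hbasis 0 _ ?_ ?_ ?_)
    · rw [h0, hzero] at hvv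
      simp [hs0, hp0] at hvv
    · rw [bil_add_right, hvv, hc, bil_smul_left, bil_add_right, bil_add_right, bil_smul_right,
        bil_smul_right, bil_smul_right, h1e, h1g]
      rw [show c * (c * bil B e₁ e₁ + (s * 0 + p * 0)) = c * c * bil B e₁ e₁ by ring, ← hcc]
      field_simp; ring
    · simp only [bil_smul_left, bil_add_left, hG₁, hcG g e, ← hp, ← hq]
      linear_combination p * hqs
    · simp only [bil_smul_left, bil_add_left, hG₁, ← hq, ← hr]
      linear_combination s * hqs + hs
    · ring
  have hκ := heig s hs hs0
  have hν := heig (-s) (by rw [hs]; ring) (neg_ne_zero.2 hs0)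
  -- The three eigenvectors are scaled so that `B` becomes `diag(-2s, q - s, q + s)` and `G` becomes
  -- `(q² - s²) diag(0, 1, 1)`, both in the pencil of index `0`.
  obtain ⟨x, hx⟩ := IsAlgClosed.exists_eq_mul_self (-(2 * s) / bil B e₁ e₁)
  obtain ⟨y, hy⟩ := IsAlgClosed.exists_eq_mul_self ((q + -s) / (2 * s * p))
  obtain ⟨z, hz⟩ := IsAlgClosed.exists_eq_mul_self (-(q + s) / (2 * s * p))
  have hx' : x * (x * bil B e₁ e₁) = -(2 * s) := by rw [← mul_assoc, ← hx]; field_simp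
  have hy' : y * y * (2 * s * p) = q + -s := by rw [← hy]; field_simp
  have hz' : z * z * (2 * s * p) = -(q + s) := by rw [← hz]; field_simp
  refine hasNormalForm_of_gram hB hG (x • e₁) (y • (s • e + p • g)) (z • (-s • e + p • g))
    (q + -s) (q + s) ((q + s) * (q + -s)) ((q + s) * (q + -s)) ?_ ?_ ?_
  · simp only [bil_smul_left, bil_smul_right, bil_add_left, bil_add_right, hc g e, h1e, h1g, hee, heg, hgg, pencilFst, pencilSnd, hx']
    ext i j; fin_cases i <;> fin_cases j <;> simp
    · ring
    · linear_combination hy'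
    · right; ring
    · right; ring
    · linear_combination -hz'
  · simp only [bil_smul_left, bil_smul_right, bil_add_left, bil_add_right, hG₁, hG₁',
      hcG g e, ← hp, ← hq, ← hr, pencilFst, pencilSnd]
    ext i j; fin_cases i <;> fin_cases j <;> simp
    · linear_combination (q + s) * hy' + y * y * p * hs
    · right; linear_combination y * p * hs
    · right; linear_combination y * p * hs
    · linear_combination -(q - s) * hz' + z * z * p * hs
  · rw [Matrix.det_fin_three]
    simp only [pencilFst, pencilSnd]
    have : (q + -s) - (q + s) ≠ 0 := by
      intro h; exact hs0 (by linear_combination (-1 / 2) * h)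
    have h3 := mul_ne_zero (mul_ne_zero this hν) hκ
    simp
    refine ⟨⟨?_, ?_⟩, ?_⟩
    · intro h; exact this (by linear_combination h)
    · exact hν
    · exact hκ

/-- Every regular pencil of ternary quadratic forms has one of five normal forms. -/
theorem exists_hasNormalForm (hB : B.IsSymm) (hG : G.IsSymm) (hdet : B.det ≠ 0) :
    ∃ i, HasNormalForm B G i := by
  have hsub : ∀ c : ℂ, (G - c • B).IsSymm := fun c => hG.sub (hB.smul c)
  have hbil : ∀ c x y, bil (G - c • B) x y = bil G x y - c * bil B x y := by
    intro c x y
    have := bil_add_smul_matrix G x y 1 B (-c)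
    rw [one_smul, neg_smul, ← sub_eq_add_neg] at this
    rw [this]; ring
  by_cases hP : ∃ c e, e ≠ 0 ∧ bil B e e = 0 ∧ ∀ y, bil G e y = c * bil B e y
  · obtain ⟨c, e, he, hee, h⟩ := hP
    obtain ⟨i, hi⟩ := exists_hasNormalForm_of_isotropic hB (hsub c) hdet he hee
      fun y => by rw [hbil, h, sub_self]
    exact ⟨i, hi.of_sub_smul⟩
  · push Not at hP
    -- An eigenvector of `G` relative to `B` always exists; here it must be anisotropic.
    obtain ⟨c, hc⟩ := Module.End.exists_eigenvalue (Matrix.toLin' (G * B⁻¹).transpose)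
    obtain ⟨e, he⟩ := hc.exists_hasEigenvector
    have h1 : Matrix.vecMul e G = c • Matrix.vecMul e B := by
      have h2 := he.apply_eq_smul
      rw [Matrix.toLin'_apply, Matrix.mulVec_transpose] at h2
      have h3 := congrArg (fun v => Matrix.vecMul v B) h2
      simp only [Matrix.vecMul_vecMul, Matrix.mul_assoc,
        Matrix.nonsing_inv_mul B (isUnit_iff_ne_zero.2 hdet), Matrix.mul_one,
        Matrix.smul_vecMul] at h3
      exact h3
    have h4 : ∀ y, bil G e y = c * bil B e y := fun y => by
      rw [bil_eq_dotProduct, h1, smul_dotProduct, ← bil_eq_dotProduct, smul_eq_mul]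
    have hee : bil B e e ≠ 0 := fun h => by
      obtain ⟨y, hy⟩ := hP c e he.2 h
      exact hy (h4 y)
    refine ⟨0, (hasNormalForm_of_anisotropic hB (hsub c) hdet hee
      (fun y => by rw [hbil, h4, sub_self]) ?_).of_sub_smul⟩
    intro d e he hee h
    obtain ⟨y, hy⟩ := hP (d + c) e he hee
    have := h y
    rw [hbil] at this
    exact hy (by linear_combination this)

end

/-! ### The curve `V` of an integrable equation is plane -/

section

variable {D : Set ℂ} {V : ℂ → Matrix (Fin 3) (Fin 3) ℂ}

/-- The Wronskians of the entries of `V` are proportional to `det V`. -/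
theorem wronskian_entries (hD : IsOpen D) (hpre : IsPreconnected D)
    (hV : ∀ i j, AnalyticOnNhd ℂ (fun u => V u i j) D) (hdet : ∀ u ∈ D, (V u).det ≠ 0)
    {k : ℂ → ℂ} (hk : ∀ u ∈ D, matDeriv (matDeriv V) u =
      logDeriv (fun s => (V s).det) u • matDeriv V u + k u • V u)
    {u₁ u : ℂ} (hu₁ : u₁ ∈ D) (hu : u ∈ D) (i j i' j' : Fin 3) :
    V u i j * matDeriv V u i' j' - V u i' j' * matDeriv V u i j =
      (V u₁ i j * matDeriv V u₁ i' j' - V u₁ i' j' * matDeriv V u₁ i j) / (V u₁).det *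
        (V u).det := by
  set W : ℂ → ℂ := fun u =>
    (V u i j * matDeriv V u i' j' - V u i' j' * matDeriv V u i j) / (V u).det with hW
  -- Abel's identity: all entries solve one scalar equation `y'' = ω y' + k y` with `ω = (ln det
  -- V)'`, so their Wronskians grow like `det V`.
  have hder : ∀ u ∈ D, HasDerivAt W 0 u := by
    intro u hu
    have h0 := fun a b => (hV a b u hu).differentiableAt.hasDerivAt
    have h1 := fun a b => (hV a b u hu).deriv.differentiableAt.hasDerivAt
    have h2 := hasDerivAt_det fun a b => (hV a b u hu).differentiableAt
    have h3 := logDeriv_det_mul (fun a b => (hV a b u hu).differentiableAt) (hdet u hu)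
    rw [h3] at h2
    refine ((((h0 i j).fun_mul (h1 i' j')).fun_sub ((h0 i' j').fun_mul (h1 i j))).fun_div h2
      (hdet u hu)).congr_deriv ?_
    have e : ∀ a b, deriv (deriv fun s => V s a b) u =
        logDeriv (fun s => (V s).det) u * deriv (fun s => V s a b) u + k u * V u a b := by
      intro a b
      have := congrFun (congrFun (hk u hu) a) b
      simpa [matDeriv] using this
    rw [e, e]
    have := hdet u hu
    field_simp
    ring
  have hconst := hD.is_const_of_deriv_eq_zero hpre
    (fun u hu => (hder u hu).differentiableAt.differentiableWithinAt)
    (fun u hu => (hder u hu).deriv) hu hu₁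
  rw [← div_eq_iff (hdet u hu)]
  exact hconst

/-- The curve `V` lies in a plane. -/
theorem exists_pencil (hD : IsOpen D) (hpre : IsPreconnected D)
    (hV : ∀ i j, AnalyticOnNhd ℂ (fun u => V u i j) D) (hsymm : ∀ u, (V u).IsSymm)
    (hdet : ∀ u ∈ D, (V u).det ≠ 0) {k : ℂ → ℂ} (hk : ∀ u ∈ D, matDeriv (matDeriv V) u =
      logDeriv (fun s => (V s).det) u • matDeriv V u + k u • V u)
    (hlin : ¬ ∃ (V₀ : Matrix (Fin 3) (Fin 3) ℂ) (f : ℂ → ℂ), ∀ u ∈ D, V u = f u • V₀)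
    {u₁ : ℂ} (hu₁ : u₁ ∈ D) :
    ∃ (G : Matrix (Fin 3) (Fin 3) ℂ) (α β : ℂ → ℂ) (c : ℂ), G.IsSymm ∧
      AnalyticOnNhd ℂ α D ∧ AnalyticOnNhd ℂ β D ∧ c ≠ 0 ∧ ∀ u ∈ D,
        V u = α u • V u₁ + β u • G ∧ α u * deriv β u - β u * deriv α u = c * (V u).det := by
  obtain ⟨i, j, hij⟩ : ∃ i j, V u₁ i j ≠ 0 := by
    by_contra! h
    exact hdet u₁ hu₁ (by rw [Matrix.det_fin_three]; simp [h])
  have hwr := fun u hu => wronskian_entries hD hpre hV hdet hk (u := u) hu₁ hu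
  -- If every Wronskian with the nonzero entry `(i, j)` vanished, all ratios to that entry would be
  -- constant near `u₁`, hence on `D` by analytic continuation, and `V` would stay on a line.
  obtain ⟨i', j', hC⟩ : ∃ i' j',
      V u₁ i j * matDeriv V u₁ i' j' - V u₁ i' j' * matDeriv V u₁ i j ≠ 0 := by
    by_contra! h
    refine hlin ⟨(V u₁ i j)⁻¹ • V u₁, fun u => V u i j, ?_⟩
    intro u hu
    ext a b
    have hw : ∀ u ∈ D, V u i j * matDeriv V u a b - V u a b * matDeriv V u i j = 0 := by
      intro u hu; rw [hwr u hu, h, zero_div, zero_mul]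
    obtain ⟨ε, hε, hball⟩ := Metric.eventually_nhds_iff_ball.1
      ((hD.eventually_mem hu₁).and ((hV i j u₁ hu₁).continuousAt.eventually_ne hij))
    have hder : ∀ u ∈ Metric.ball u₁ ε, HasDerivAt (fun u => V u a b / V u i j) 0 u := by
      intro u hu
      obtain ⟨h1, h2⟩ := hball u hu
      refine ((hV a b u h1).differentiableAt.hasDerivAt.fun_div
        (hV i j u h1).differentiableAt.hasDerivAt h2).congr_deriv ?_
      have := hw u h1
      simp only [matDeriv, Matrix.of_apply] at this
      rw [div_eq_zero_iff]
      exact Or.inl (by linear_combination this)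
    have heq : (fun u => V u a b) =ᶠ[𝓝 u₁] fun u => V u i j * ((V u₁ i j)⁻¹ * V u₁ a b) := by
      filter_upwards [Metric.ball_mem_nhds u₁ hε] with u hu
      have := Metric.isOpen_ball.is_const_of_deriv_eq_zero (convex_ball u₁ ε).isPreconnected
        (fun u hu => (hder u hu).differentiableAt.differentiableWithinAt)
        (fun u hu => (hder u hu).deriv) hu (Metric.mem_ball_self hε)
      have h2 := (hball u hu).2
      field_simp at this ⊢
      linear_combination this
    have := (hV a b).eqOn_of_preconnected_of_eventuallyEq
      (fun u hu => (hV i j u hu).mul analyticAt_const) hpre hu₁ heq hu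
    simpa using this
  set C : Fin 3 → Fin 3 → Fin 3 → Fin 3 → ℂ := fun a b a' b' =>
    (V u₁ a b * matDeriv V u₁ a' b' - V u₁ a' b' * matDeriv V u₁ a b) / (V u₁).det with hCdef
  have hC0 : C i j i' j' ≠ 0 := div_ne_zero hC (hdet u₁ hu₁)
  -- The three-term relation among Wronskians of three functions; here they are constants times `det
  -- V`, which cancels.
  have hlin2 : ∀ u ∈ D, ∀ a b, V u a b * C i j i' j' =
      C a b i' j' * V u i j + C i j a b * V u i' j' := by
    intro u hu a b
    refine mul_right_cancel₀ (hdet u hu) ?_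
    have h1 : _ = C i j i' j' * (V u).det := hwr u hu i j i' j'
    have h2 : _ = C a b i' j' * (V u).det := hwr u hu a b i' j'
    have h3 : _ = C i j a b * (V u).det := hwr u hu i j a b
    linear_combination V u i j * h2 + V u i' j' * h3 - V u a b * h1
  refine ⟨Matrix.of fun a b => C i j a b / C i j i' j', fun u => V u i j / V u₁ i j,
    fun u => V u i' j' - V u i j * (V u₁ i' j' / V u₁ i j), C i j i' j' / V u₁ i j, ?_,
    fun u hu => (hV i j u hu).div analyticAt_const hij,
    fun u hu => (hV i' j' u hu).sub ((hV i j u hu).mul analyticAt_const),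
    div_ne_zero hC0 hij, fun u hu => ⟨?_, ?_⟩⟩
  · ext a b
    simp only [Matrix.transpose_apply, Matrix.of_apply, hCdef]
    rw [(hsymm u₁).apply a b, (matDeriv_isSymm hsymm u₁).apply a b]
  · ext a b
    simp only [Matrix.add_apply, Matrix.smul_apply, Matrix.of_apply, smul_eq_mul]
    have h1 := hlin2 u hu a b
    have h2 := hlin2 u₁ hu₁ a b
    field_simp
    linear_combination V u₁ i j * h1 - V u i j * h2
  · have h0 := fun a b => (hV a b u hu).differentiableAt.hasDerivAt
    have h1 : _ = C i j i' j' * (V u).det := hwr u hu i j i' j'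
    rw [((h0 i j).div_const _).deriv, ((h0 i' j').fun_sub ((h0 i j).mul_const _)).deriv]
    simp only [matDeriv, Matrix.of_apply] at h1
    field_simp
    linear_combination V u₁ i j * h1

end

/-! ### Local equivalence from pencil and Wronskian -/

theorem eventually_eq_of_hasDerivAt_zero {f : ℂ → ℂ} {z : ℂ} (h : ∀ᶠ w in 𝓝 z, HasDerivAt f 0 w) :
    ∀ᶠ w in 𝓝 z, f w = f z := by
  obtain ⟨ε, hε, hball⟩ := Metric.eventually_nhds_iff_ball.1 h
  filter_upwards [Metric.ball_mem_nhds z hε] with w hw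
  exact Metric.isOpen_ball.is_const_of_deriv_eq_zero (convex_ball z ε).isPreconnected
    (fun u hu => (hball u hu).differentiableAt.differentiableWithinAt)
    (fun u hu => (hball u hu).deriv) hw (Metric.mem_ball_self hε)

theorem exists_analytic_localInverse {f : ℂ → ℂ} {z : ℂ} (hf : AnalyticAt ℂ f z)
    (hd : deriv f z ≠ 0) :
    ∃ g : ℂ → ℂ, AnalyticAt ℂ g (f z) ∧ g (f z) = z ∧ ∀ᶠ t in 𝓝 (f z), f (g t) = t := by
  have hC : ContDiffAt ℂ ⊤ f z := hf.contDiffAt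
  have hd' := hf.differentiableAt.hasDerivAt.hasFDerivAt_equiv hd
  refine ⟨hC.localInverse hd' (by simp), (hC.to_localInverse hd' (by simp)).analyticAt,
    hC.localInverse_apply_image hd' (by simp), ?_⟩
  exact (hC.hasStrictFDerivAt' hd' (by simp)).eventually_right_inverse

namespace QuadPDE

variable {E F : QuadPDE}

theorem AnalyticCoeffAt.eventually {u : ℂ} (h : E.AnalyticCoeffAt u) :
    ∀ᶠ w in 𝓝 u, E.AnalyticCoeffAt w := by
  filter_upwards [h.a.eventually_analyticAt, h.b.eventually_analyticAt, h.c.eventually_analyticAt,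
    h.p.eventually_analyticAt, h.q.eventually_analyticAt, h.r.eventually_analyticAt]
    with w h1 h2 h3 h4 h5 h6 using ⟨h1, h2, h3, h4, h5, h6⟩

theorem matDeriv_coeffMatrix (u : ℂ) : matDeriv E.coeffMatrix u = E.V u := by
  ext i j; fin_cases i <;> fin_cases j <;> rfl

theorem AnalyticCoeffAt.differentiableAt_coeffMatrix {u : ℂ} (h : E.AnalyticCoeffAt u)
    (i j : Fin 3) : DifferentiableAt ℂ (fun s => E.coeffMatrix s i j) u := by
  fin_cases i <;> fin_cases j
  exacts [h.a.differentiableAt, h.p.differentiableAt, h.q.differentiableAt, h.p.differentiableAt,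
    h.b.differentiableAt, h.r.differentiableAt, h.q.differentiableAt, h.r.differentiableAt,
    h.c.differentiableAt]

/-- An equality of the matrices `V` integrates to one of the coefficient matrices; the constants of
integration are the matrix `C`. -/
theorem locallyEquivalent_of_deriv {D' : Set ℂ} {S : Matrix (Fin 3) (Fin 3) ℂ} {φ : ℂ → ℂ}
    {w₀ : ℂ} (hS : S.det ≠ 0) (hw₀ : w₀ ∈ D') (hφ : AnalyticAt ℂ φ w₀) (hφ' : deriv φ w₀ ≠ 0)
    (hE : E.AnalyticCoeffAt (φ w₀)) (hF : F.AnalyticCoeffAt w₀)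
    (h : ∀ᶠ w in 𝓝 w₀, F.V w = deriv φ w • (S * E.V (φ w) * S.transpose)) :
    E.LocallyEquivalent (φ w₀) F D' := by
  have hS' : ∀ (M : Matrix (Fin 3) (Fin 3) ℂ) i j, (S * M * S.transpose) i j =
      bil M (S i) (S j) := fun M i j => bil_eq_mul_transpose M S i j
  have key : ∀ i j, ∀ᶠ w in 𝓝 w₀, F.coeffMatrix w i j - bil (E.coeffMatrix (φ w)) (S i) (S j) =
      F.coeffMatrix w₀ i j - bil (E.coeffMatrix (φ w₀)) (S i) (S j) := by
    intro i j
    refine eventually_eq_of_hasDerivAt_zero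
      (f := fun w => F.coeffMatrix w i j - bil (E.coeffMatrix (φ w)) (S i) (S j)) ?_
    filter_upwards [h, hF.eventually, hφ.eventually_analyticAt,
      hφ.continuousAt.eventually hE.eventually] with w h1 h2 h3 h4
    have hb := hasDerivAt_bil (M := E.coeffMatrix) h4.differentiableAt_coeffMatrix
      h3.differentiableAt.hasDerivAt (hasDerivAt_const w (S i)) (hasDerivAt_const w (S j))
    refine ((h2.differentiableAt_coeffMatrix i j).hasDerivAt.fun_sub hb).congr_deriv ?_
    have h5 : deriv (fun s => F.coeffMatrix s i j) w = F.V w i j :=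
      congrFun (congrFun (matDeriv_coeffMatrix w) i) j
    rw [h5, h1, matDeriv_coeffMatrix, Matrix.smul_apply, hS', smul_eq_mul]
    simp [bil]
  refine ⟨S, F.coeffMatrix w₀ - S * E.coeffMatrix (φ w₀) * S.transpose, φ, w₀, hS, hw₀, hφ, rfl,
    hφ', ?_⟩
  filter_upwards [eventually_all.2 fun i => eventually_all.2 fun j => key i j] with w hw
  ext i j
  rw [Matrix.add_apply, Matrix.sub_apply, hS', hS']
  linear_combination hw i j

/-- A pencil and the Wronskian constant determine an equation up to equivalence. -/
theorem locallyEquivalent_of_pencil {D' : Set ℂ} {u₀ w₀ : ℂ} {P Q S : Matrix (Fin 3) (Fin 3) ℂ}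
    {α β γ δ : ℂ → ℂ} {c d : ℂ} (hw₀ : w₀ ∈ D') (hE : E.AnalyticCoeffAt u₀)
    (hF : F.AnalyticCoeffAt w₀) (hS : S.det ≠ 0) (hα : AnalyticAt ℂ α u₀) (hβ : AnalyticAt ℂ β u₀)
    (hγ : AnalyticAt ℂ γ w₀) (hδ : AnalyticAt ℂ δ w₀) (hc : c ≠ 0) (hd : d ≠ 0)
    (hEV : ∀ᶠ u in 𝓝 u₀, S * E.V u * S.transpose = α u • P + β u • Q ∧
      α u * deriv β u - β u * deriv α u = c * (α u • P + β u • Q).det)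
    (hFV : ∀ᶠ w in 𝓝 w₀, F.V w = γ w • P + δ w • Q ∧
      γ w * deriv δ w - δ w * deriv γ w = d * (γ w • P + δ w • Q).det)
    (hα0 : α u₀ ≠ 0) (hγ0 : γ w₀ ≠ 0) (hratio : β u₀ / α u₀ = δ w₀ / γ w₀)
    (hdet : (α u₀ • P + β u₀ • Q).det ≠ 0) : E.LocallyEquivalent u₀ F D' := by
  have hτ : AnalyticAt ℂ (fun u => β u / α u) u₀ := hβ.div hα hα0
  have hσ : AnalyticAt ℂ (fun w => δ w / γ w) w₀ := hδ.div hγ hγ0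
  have hτ' : ∀ {α β : ℂ → ℂ} {u : ℂ}, AnalyticAt ℂ α u → AnalyticAt ℂ β u → α u ≠ 0 →
      deriv (fun u => β u / α u) u = (α u * deriv β u - β u * deriv α u) / α u ^ 2 := by
    intro α β u h1 h2 h3
    rw [(h2.differentiableAt.hasDerivAt.fun_div h1.differentiableAt.hasDerivAt h3).deriv]
    ring
  -- The ratio `β / α` is a local coordinate, since its derivative is the Wronskian over `α²`. The
  -- change `φ` matches this ratio with `δ / γ`.
  obtain ⟨ψ, hψ, hψ0, hψτ⟩ := exists_analytic_localInverse hτ (by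
    rw [hτ' hα hβ hα0, hEV.self_of_nhds.2]
    exact div_ne_zero (mul_ne_zero hc hdet) (pow_ne_zero _ hα0))
  rw [hratio] at hψ hψ0 hψτ
  set φ : ℂ → ℂ := fun w => ψ (δ w / γ w) with hφdef
  have hφ : AnalyticAt ℂ φ w₀ := AnalyticAt.comp (g := ψ) (f := fun w => δ w / γ w) hψ hσ
  have hφ0 : φ w₀ = u₀ := hψ0
  have hφτ : ∀ᶠ w in 𝓝 w₀, β (φ w) / α (φ w) = δ w / γ w := hσ.continuousAt.eventually hψτ
  have hφu : Tendsto φ (𝓝 w₀) (𝓝 u₀) := by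
    have := hφ.continuousAt.tendsto; rwa [hφ0] at this
  have hdetu : ∀ᶠ u in 𝓝 u₀, (α u • P + β u • Q).det ≠ 0 := by
    refine ContinuousAt.eventually_ne ?_ hdet
    simp only [Matrix.det_fin_three, Matrix.add_apply, Matrix.smul_apply, smul_eq_mul]
    have := hα.continuousAt
    have := hβ.continuousAt
    fun_prop
  have hmain : ∀ᶠ w in 𝓝 w₀, deriv φ w ≠ 0 ∧
      F.V w = (c / d) • (deriv φ w • (S * E.V (φ w) * S.transpose)) := by
    filter_upwards [hφτ.eventually_nhds, hφu.eventually hEV, hFV, hφu.eventually hdetu,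
      hφ.eventually_analyticAt, hφu.eventually hα.eventually_analyticAt,
      hφu.eventually hβ.eventually_analyticAt, hγ.eventually_analyticAt, hδ.eventually_analyticAt,
      hφu.eventually (hα.continuousAt.eventually_ne hα0), hγ.continuousAt.eventually_ne hγ0]
      with w h1 h2 h3 h4 h5 h6 h7 h8 h9 hA hG
    have e1 : deriv (fun u => β u / α u) (φ w) * deriv φ w = deriv (fun w => δ w / γ w) w := by
      have hh : HasDerivAt (fun w => β (φ w) / α (φ w))
          (deriv (fun u => β u / α u) (φ w) * deriv φ w) w :=
        HasDerivAt.comp w (h₂ := fun u => β u / α u)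
          (h7.div h6 hA).differentiableAt.hasDerivAt h5.differentiableAt.hasDerivAt
      rw [← hh.deriv]
      exact Filter.EventuallyEq.deriv_eq h1
    rw [hτ' h6 h7 hA, hτ' h8 h9 hG, h2.2, h3.2] at e1
    have e2 := h1.self_of_nhds
    obtain ⟨ρ, hρ⟩ : ∃ ρ, ρ = α (φ w) / γ w := ⟨_, rfl⟩
    have hA' : α (φ w) = ρ * γ w := by rw [hρ]; field_simp
    have hB' : β (φ w) = ρ * δ w := by
      rw [div_eq_div_iff hA hG] at e2
      rw [hρ]; field_simp; linear_combination e2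
    have hρ0 : ρ ≠ 0 := by rw [hρ]; exact div_ne_zero hA hG
    have hM : α (φ w) • P + β (φ w) • Q = ρ • (γ w • P + δ w • Q) := by
      rw [hA', hB', smul_add, smul_smul, smul_smul]
    have hMdet : (α (φ w) • P + β (φ w) • Q).det = ρ ^ 3 * (γ w • P + δ w • Q).det := by
      rw [hM, Matrix.det_smul, Fintype.card_fin]
    rw [hMdet] at h4 e1
    have hdF : (γ w • P + δ w • Q).det ≠ 0 := right_ne_zero_of_mul h4
    -- The matched curves differ by a scalar `ρ`. Since the determinant is cubic and the Wronskian
    -- quadratic in `ρ`, the two Wronskian conditions force `ρ` to be `d / c` over the derivative of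
    -- `φ`. A square root of `c / d` is absorbed in `S`.
    have e3 : c * (ρ * deriv φ w) = d := by
      rw [hA'] at e1
      field_simp at e1
      linear_combination e1
    refine ⟨fun h => hd (by rw [← e3, h]; ring), ?_⟩
    rw [h2.1, hM, ← h3.1, smul_smul, smul_smul, ← e3]
    have h10 : deriv φ w ≠ 0 := fun h => hd (by rw [← e3, h]; ring)
    have : c / (c * (ρ * deriv φ w)) * (deriv φ w * ρ) = 1 := by field_simp
    rw [mul_assoc, this, one_smul]
  obtain ⟨s, hs⟩ := IsAlgClosed.exists_eq_mul_self (c / d)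
  have hs0 : s ≠ 0 := by
    rintro rfl
    simp [hc, hd] at hs
  rw [← hφ0] at hE ⊢
  refine locallyEquivalent_of_deriv (S := s • S) ?_ hw₀ hφ hmain.self_of_nhds.1 hE hF ?_
  · rw [Matrix.det_smul]; exact mul_ne_zero (pow_ne_zero _ hs0) hS
  · filter_upwards [hmain] with w hw
    rw [hw.2, hs, Matrix.transpose_smul, Matrix.smul_mul, Matrix.smul_mul, Matrix.mul_smul]
    simp only [smul_smul]
    congr 1
    ring

end QuadPDE

/-- A plane curve whose Wronskian is proportional to `det V` satisfies the integrability
condition. -/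
theorem ode_of_pencil {V : ℂ → Matrix (Fin 3) (Fin 3) ℂ} {P Q : Matrix (Fin 3) (Fin 3) ℂ}
    {γ δ : ℂ → ℂ} {d u : ℂ} (hγ : AnalyticAt ℂ γ u) (hδ : AnalyticAt ℂ δ u) (hd : d ≠ 0)
    (hV : ∀ᶠ s in 𝓝 u, V s = γ s • P + δ s • Q ∧
      γ s * deriv δ s - δ s * deriv γ s = d * (V s).det) (hdet : (V u).det ≠ 0) :
    ∃ k : ℂ, matDeriv (matDeriv V) u =
      logDeriv (fun s => (V s).det) u • matDeriv V u + k • V u := by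
  have hmat : ∀ {γ δ : ℂ → ℂ} {W : ℂ → Matrix (Fin 3) (Fin 3) ℂ} {s : ℂ}, AnalyticAt ℂ γ s →
      AnalyticAt ℂ δ s → (∀ᶠ t in 𝓝 s, W t = γ t • P + δ t • Q) →
      matDeriv W s = deriv γ s • P + deriv δ s • Q := by
    intro γ δ W s h1 h2 h3
    ext i j
    have h4 : HasDerivAt (fun t => γ t * P i j + δ t * Q i j)
        (deriv γ s * P i j + deriv δ s * Q i j) s :=
      (h1.differentiableAt.hasDerivAt.mul_const _).fun_add
        (h2.differentiableAt.hasDerivAt.mul_const _)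
    have h5 : deriv (fun t => W t i j) s = deriv (fun t => γ t * P i j + δ t * Q i j) s :=
      Filter.EventuallyEq.deriv_eq (h3.mono fun t ht => by simp [ht])
    simp only [matDeriv, Matrix.of_apply, h5, h4.deriv, Matrix.add_apply, Matrix.smul_apply,
      smul_eq_mul]
  have h1 : ∀ᶠ s in 𝓝 u, matDeriv V s = deriv γ s • P + deriv δ s • Q := by
    filter_upwards [hV.eventually_nhds, hγ.eventually_analyticAt, hδ.eventually_analyticAt]
      with s h1 h2 h3
    exact hmat h2 h3 (h1.mono fun t ht => ht.1)
  rw [hmat hγ.deriv hδ.deriv h1, h1.self_of_nhds, hV.self_of_nhds.1]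
  have hW := hV.self_of_nhds.2
  have hW0 : γ u * deriv δ u - δ u * deriv γ u ≠ 0 := by rw [hW]; exact mul_ne_zero hd hdet
  -- The determinant is a constant multiple of the Wronskian, whose derivative is `γ δ'' - δ γ''`.
  -- The criterion is then Cramer's rule for `(γ'', δ'')` in terms of `(γ', δ')` and `(γ, δ)`.
  have hω : logDeriv (fun s => (V s).det) u =
      (γ u * deriv (deriv δ) u - δ u * deriv (deriv γ) u) /
        (γ u * deriv δ u - δ u * deriv γ u) := by
    have h2 : HasDerivAt (fun s => (V s).det)
        ((γ u * deriv (deriv δ) u - δ u * deriv (deriv γ) u) / d) u := by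
      have h3 : HasDerivAt (fun s => (γ s * deriv δ s - δ s * deriv γ s) / d)
          ((γ u * deriv (deriv δ) u - δ u * deriv (deriv γ) u) / d) u := by
        refine (((hγ.differentiableAt.hasDerivAt.fun_mul
          hδ.deriv.differentiableAt.hasDerivAt).fun_sub (hδ.differentiableAt.hasDerivAt.fun_mul
          hγ.deriv.differentiableAt.hasDerivAt)).div_const d).congr_deriv ?_
        ring
      refine h3.congr_of_eventuallyEq ?_
      filter_upwards [hV] with s hs
      rw [hs.2]; field_simp
    rw [logDeriv_apply, h2.deriv, hW]
    field_simp
  refine ⟨(deriv (deriv γ) u * deriv δ u - deriv (deriv δ) u * deriv γ u) /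
    (γ u * deriv δ u - δ u * deriv γ u), ?_⟩
  rw [hω]
  ext i j
  simp only [Matrix.add_apply, Matrix.smul_apply, smul_eq_mul]
  field_simp
  ring

/-! ### The canonical forms -/

namespace QuadPDE

/-- The coordinates of `V` in the pencil of a canonical form. -/
noncomputable def canonicalCoord : Fin 5 → (ℂ → ℂ) × (ℂ → ℂ) :=
  ![(fun u => 1 / (1 - Complex.exp u), fun u => Complex.exp u / (1 - Complex.exp u)),
    (fun _ => 1, Complex.exp), (fun _ => 1, Complex.exp), (fun _ => 1, fun u => u),
    (fun _ => 1, fun u => u)]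

/-- The Wronskian constants of the canonical forms. -/
noncomputable def canonicalConst : Fin 5 → ℂ := ![1, 1, -1, 4, -1]

theorem isOpen_canonicalDomain (i : Fin 5) : IsOpen (canonicalDomain i) := by
  fin_cases i
  · exact Complex.isOpen_slitPlane.preimage (by fun_prop)
  all_goals exact isOpen_univ

theorem one_sub_exp_ne_zero {u : ℂ} (hu : u ∈ canonicalDomain 0) : 1 - Complex.exp u ≠ 0 :=
  Complex.slitPlane_ne_zero hu

theorem holomorphic_canonicalForm (i : Fin 5) :
    (canonicalForm i).Holomorphic (canonicalDomain i) := by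
  have hlog : AnalyticOnNhd ℂ (fun u => Complex.log (1 - Complex.exp u)) (canonicalDomain 0) :=
    fun u hu => AnalyticAt.clog (by fun_prop) hu
  fin_cases i
  · exact ⟨fun u _ => analyticAt_id, fun u hu => analyticAt_id.sub (hlog u hu),
      fun u hu => (hlog u hu).neg, fun u _ => analyticAt_const, fun u _ => analyticAt_const,
      fun u _ => analyticAt_const⟩
  all_goals
    refine ⟨?_, ?_, ?_, ?_, ?_, ?_⟩ <;> intro u _ <;>
    simp only [canonicalForm, form₂, form₃, form₄, form₅, Fin.reduceFinMk, Matrix.cons_val,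
      Fin.mk_one] <;> fun_prop

theorem canonicalForm_V {i : Fin 5} {u : ℂ} (hu : u ∈ canonicalDomain i) :
    (canonicalForm i).V u = (canonicalCoord i).1 u • pencilFst i +
      (canonicalCoord i).2 u • pencilSnd i := by
  fin_cases i
  · have h0 := one_sub_exp_ne_zero hu
    have h1 : HasDerivAt (fun u => Complex.log (1 - Complex.exp u))
        (-Complex.exp u / (1 - Complex.exp u)) u :=
      HasDerivAt.clog ((Complex.hasDerivAt_exp u).const_sub 1) hu
    have h2 : deriv (fun u => u - Complex.log (1 - Complex.exp u)) u = _ :=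
      ((hasDerivAt_id' u).fun_sub h1).deriv
    have h3 : deriv (fun u => -Complex.log (1 - Complex.exp u)) u = _ := h1.fun_neg.deriv
    simp only [canonicalForm, form₁, V, canonicalCoord, pencilFst, pencilSnd, Fin.zero_eta,
      Matrix.cons_val_zero, h2, h3]
    ext i j; fin_cases i <;> fin_cases j <;> simp <;> field_simp <;> ring
  · simp only [canonicalForm, form₂, V, canonicalCoord, pencilFst, pencilSnd, Fin.mk_one,
      Matrix.cons_val]
    ext i j; fin_cases i <;> fin_cases j <;> simp
  · have h : deriv (fun u => Complex.exp u - u) u = Complex.exp u - 1 :=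
      ((Complex.hasDerivAt_exp u).fun_sub (hasDerivAt_id' u)).deriv
    simp only [canonicalForm, form₃, V, canonicalCoord, pencilFst, pencilSnd, Fin.reduceFinMk,
      Matrix.cons_val, h]
    ext i j; fin_cases i <;> fin_cases j <;> simp
    ring
  · have h : deriv (fun u : ℂ => -(u ^ 2 / 2)) u = -u :=
      ((((hasDerivAt_id' u).fun_pow 2).div_const 2).fun_neg.congr_deriv (by simp)).deriv
    have h2 : deriv (fun u : ℂ => u / 2) u = 1 / 2 := ((hasDerivAt_id' u).div_const 2).deriv
    simp only [canonicalForm, form₄, V, canonicalCoord, pencilFst, pencilSnd, Fin.reduceFinMk,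
      Matrix.cons_val, h, h2]
    ext i j; fin_cases i <;> fin_cases j <;> simp
  · have h : deriv (fun u : ℂ => u ^ 2 / 2) u = u :=
      ((((hasDerivAt_id' u).fun_pow 2).div_const 2).congr_deriv (by simp)).deriv
    simp only [canonicalForm, form₅, V, canonicalCoord, pencilFst, pencilSnd, Fin.reduceFinMk,
      Matrix.cons_val, h]
    ext i j; fin_cases i <;> fin_cases j <;> simp

theorem det_pencil (i : Fin 5) (x y : ℂ) : (x • pencilFst i + y • pencilSnd i).det =
    ![(x - y) * x * y, x ^ 2 * y, -(x ^ 2 * y), x ^ 3 / 4, -x ^ 3] i := by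
  rw [Matrix.det_fin_three]
  simp only [Matrix.add_apply, Matrix.smul_apply, smul_eq_mul]
  fin_cases i <;> simp only [pencilFst, pencilSnd, Fin.zero_eta, Fin.mk_one, Fin.reduceFinMk,
    Matrix.cons_val, Matrix.of_apply] <;>
    norm_num [-mul_eq_mul_right_iff, -mul_eq_mul_left_iff] <;> ring

/-- The Wronskian identity carries the integrability of the canonical forms, through
`ode_of_pencil`, and also fixes the parametrisation to which other equations are brought. -/
theorem canonicalCoord_spec {i : Fin 5} {u : ℂ} (hu : u ∈ canonicalDomain i) :
    AnalyticAt ℂ (canonicalCoord i).1 u ∧ AnalyticAt ℂ (canonicalCoord i).2 u ∧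
    (canonicalCoord i).1 u ≠ 0 ∧
    ((canonicalCoord i).1 u • pencilFst i + (canonicalCoord i).2 u • pencilSnd i).det ≠ 0 ∧
    (canonicalCoord i).1 u * deriv (canonicalCoord i).2 u -
      (canonicalCoord i).2 u * deriv (canonicalCoord i).1 u = canonicalConst i *
      ((canonicalCoord i).1 u • pencilFst i + (canonicalCoord i).2 u • pencilSnd i).det := by
  rw [det_pencil]
  fin_cases i
  · have h0 := one_sub_exp_ne_zero hu
    have he := Complex.exp_ne_zero u
    have h1 : HasDerivAt (fun u => 1 - Complex.exp u) (-Complex.exp u) u :=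
      (Complex.hasDerivAt_exp u).const_sub 1
    have h2 := (hasDerivAt_const u (1 : ℂ)).fun_div h1 h0
    have h3 := (Complex.hasDerivAt_exp u).fun_div h1 h0
    have ha : AnalyticAt ℂ (fun u => 1 - Complex.exp u) u := by fun_prop
    simp only [canonicalCoord, canonicalConst, Fin.zero_eta, Matrix.cons_val_zero, h2.deriv,
      h3.deriv]
    have h4 : 1 / (1 - Complex.exp u) - Complex.exp u / (1 - Complex.exp u) = 1 := by
      field_simp
    refine ⟨analyticAt_const.div ha h0, analyticAt_cexp.div ha h0, one_div_ne_zero h0, ?_, ?_⟩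
    · rw [h4, one_mul]
      exact mul_ne_zero (one_div_ne_zero h0) (div_ne_zero he h0)
    · rw [h4]
      field_simp
      ring
  all_goals
    simp only [canonicalCoord, canonicalConst, Fin.reduceFinMk, Fin.mk_one, Matrix.cons_val]
    refine ⟨by fun_prop, by fun_prop, one_ne_zero, ?_, ?_⟩
    · simp
    · simp

theorem canonicalConst_ne_zero (i : Fin 5) : canonicalConst i ≠ 0 := by
  fin_cases i <;> simp [canonicalConst]

theorem nondegenerate_canonicalForm (i : Fin 5) :
    (canonicalForm i).Nondegenerate (canonicalDomain i) := by
  intro u hu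
  rw [canonicalForm_V hu]
  exact (canonicalCoord_spec hu).2.2.2.1

theorem eventually_canonicalForm_V {i : Fin 5} {u : ℂ} (hu : u ∈ canonicalDomain i) :
    ∀ᶠ w in 𝓝 u, (canonicalForm i).V w = (canonicalCoord i).1 w • pencilFst i +
      (canonicalCoord i).2 w • pencilSnd i ∧
    (canonicalCoord i).1 w * deriv (canonicalCoord i).2 w -
      (canonicalCoord i).2 w * deriv (canonicalCoord i).1 w = canonicalConst i *
      ((canonicalCoord i).1 w • pencilFst i + (canonicalCoord i).2 w • pencilSnd i).det := by
  filter_upwards [(isOpen_canonicalDomain i).mem_nhds hu] with w hw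
  exact ⟨canonicalForm_V hw, (canonicalCoord_spec hw).2.2.2.2⟩

theorem integrable_canonicalForm (i : Fin 5) :
    (canonicalForm i).Integrable (canonicalDomain i) := by
  refine integrable_of_ode (isOpen_canonicalDomain i) (holomorphic_canonicalForm i)
    (nondegenerate_canonicalForm i) ?_
  have key : ∀ u, ∃ k : ℂ, u ∈ canonicalDomain i → matDeriv (matDeriv (canonicalForm i).V) u =
      logDeriv (fun s => ((canonicalForm i).V s).det) u • matDeriv (canonicalForm i).V u +
        k • (canonicalForm i).V u := by
    intro u
    by_cases hu : u ∈ canonicalDomain i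
    · obtain ⟨k, hk⟩ := ode_of_pencil (canonicalCoord_spec hu).1 (canonicalCoord_spec hu).2.1
        (canonicalConst_ne_zero i) (by
          filter_upwards [eventually_canonicalForm_V hu] with w hw
          exact ⟨hw.1, by rw [hw.1]; exact hw.2⟩) (nondegenerate_canonicalForm i u hu)
      exact ⟨k, fun _ => hk⟩
    · exact ⟨0, fun h => absurd h hu⟩
  choose k hk using key
  exact ⟨k, hk⟩

theorem mem_canonicalDomain_zero_of_re_neg {u : ℂ} (hu : u.re < 0) : u ∈ canonicalDomain 0 := by
  refine Complex.mem_slitPlane_iff.2 (Or.inl ?_)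
  have h1 : ‖Complex.exp u‖ < 1 := by
    rw [Complex.norm_exp]; exact Real.exp_lt_one_iff.2 hu
  have h2 := (Complex.abs_re_le_norm _).trans_lt h1
  rw [abs_lt] at h2
  simp only [Complex.sub_re, Complex.one_re]
  linarith [h2.2]

theorem not_isLinearizable_canonicalForm (i : Fin 5) :
    ¬ (canonicalForm i).IsLinearizable (canonicalDomain i) := by
  rintro ⟨V₀, f, h⟩
  have key : ∀ u ∈ canonicalDomain i, ∀ v ∈ canonicalDomain i, ∀ a b c d,
      (canonicalForm i).V u a b * (canonicalForm i).V v c d =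
        (canonicalForm i).V v a b * (canonicalForm i).V u c d := by
    intro u hu v hv a b c d
    rw [h u hu, h v hv]
    simp only [Matrix.smul_apply, smul_eq_mul]
    ring
  have hu : (-1 : ℂ) ∈ canonicalDomain i := by
    fin_cases i
    · exact mem_canonicalDomain_zero_of_re_neg (by simp)
    all_goals exact Set.mem_univ _
  -- A shift by `πi` changes the sign of the exponential and stays in the left half-plane. Two
  -- values of `V` on one line have vanishing cross minors, and these are tested at `-1` and `v`.
  obtain ⟨v, hv, hne⟩ : ∃ v ∈ canonicalDomain i, Complex.exp v ≠ Complex.exp (-1) := by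
    refine ⟨-1 + Real.pi * Complex.I, ?_, ?_⟩
    · fin_cases i
      · exact mem_canonicalDomain_zero_of_re_neg (by simp)
      all_goals exact Set.mem_univ _
    · rw [Complex.exp_add, Complex.exp_pi_mul_I]
      intro h
      exact Complex.exp_ne_zero (-1) (by linear_combination (-1 / 2) * h)
  have hne' : v ≠ -1 := fun h => hne (by rw [h])
  have hk := key _ hu _ hv
  rw [canonicalForm_V hu, canonicalForm_V hv] at hk
  fin_cases i
  · have := hk 0 0 2 2
    have e1 := one_sub_exp_ne_zero hu
    have e2 := one_sub_exp_ne_zero hv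
    simp [canonicalCoord, pencilFst, pencilSnd] at this
    field_simp at this
    exact hne (by linear_combination this)
  · have := hk 0 0 2 2
    simp [canonicalCoord, pencilFst, pencilSnd] at this
    exact hne this
  · have := hk 0 1 2 2
    simp [canonicalCoord, pencilFst, pencilSnd] at this
    exact hne this
  · have := hk 0 2 0 0
    simp [canonicalCoord, pencilFst, pencilSnd] at this
    exact hne' (by linear_combination -2 * this)
  · have := hk 0 2 0 1
    simp [canonicalCoord, pencilFst, pencilSnd] at this
    exact hne' this

/-- For the first form, the left half-plane lies in the domain, and a horizontal segment to the left
joins any point to it: it multiplies `eᵘ` by factors in `(0, 1]`, which keeps it off `[1, ∞)`. -/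
theorem isConnected_canonicalDomain (i : Fin 5) : IsConnected (canonicalDomain i) := by
  fin_cases i
  swap; · exact isConnected_univ
  swap; · exact isConnected_univ
  swap; · exact isConnected_univ
  swap; · exact isConnected_univ
  refine ⟨⟨-1, mem_canonicalDomain_zero_of_re_neg (by simp)⟩,
    isPreconnected_of_forall (-1 : ℂ) fun y hy => ?_⟩
  refine ⟨{u | u.re < 0} ∪ segment ℝ y (y - (|y.re| + 1 : ℝ)), Set.union_subset
    (fun u hu => mem_canonicalDomain_zero_of_re_neg hu) ?_, Or.inl (by simp),
    Or.inr (left_mem_segment _ _ _), IsPreconnected.union (y - (|y.re| + 1 : ℝ)) ?_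
      (right_mem_segment _ _ _) (convex_halfSpace_re_lt 0).isPreconnected
      (convex_segment _ _).isPreconnected⟩
  · rintro z hz
    rw [segment_eq_image'] at hz
    obtain ⟨θ, hθ, rfl⟩ := hz
    obtain ⟨t, ht⟩ : ∃ t : ℝ, t = θ * (|y.re| + 1) := ⟨_, rfl⟩
    have ht0 : 0 ≤ t := by rw [ht]; exact mul_nonneg hθ.1 (by positivity)
    have hz : y + θ • (y - ((|y.re| + 1 : ℝ) : ℂ) - y) = y - (t : ℂ) := by
      rw [ht]; simp; ring
    change 1 - Complex.exp (y + θ • (y - ((|y.re| + 1 : ℝ) : ℂ) - y)) ∈ Complex.slitPlane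
    rw [hz, Complex.exp_sub, ← Complex.ofReal_exp]
    have hy' : 1 - Complex.exp y ∈ Complex.slitPlane := hy
    have ht1 : 1 ≤ Real.exp t := Real.one_le_exp ht0
    have hep := Real.exp_pos t
    rw [Complex.mem_slitPlane_iff] at hy' ⊢
    have e : Complex.exp y / (Real.exp t : ℂ) = ((Real.exp t)⁻¹ : ℝ) * Complex.exp y := by
      push_cast; field_simp
    rw [e]
    simp only [Complex.sub_re, Complex.sub_im, Complex.one_re, Complex.one_im, Complex.re_ofReal_mul,
      Complex.im_ofReal_mul] at hy' ⊢
    rcases hy' with h | h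
    · left
      have : (Real.exp t)⁻¹ * (Complex.exp y).re < 1 := by
        rw [inv_mul_lt_iff₀ hep]; linarith
      linarith
    · right
      intro h2
      apply h
      have : (Complex.exp y).im = 0 := by
        have h3 : (Real.exp t)⁻¹ * (Complex.exp y).im = 0 := by linarith
        exact (mul_eq_zero.1 h3).resolve_left (inv_ne_zero hep.ne')
      linarith
  · simp only [Set.mem_ofPred_eq, Complex.sub_re, Complex.ofReal_re]
    linarith [le_abs_self y.re]

end QuadPDE

/-! ### Reduction to the canonical forms -/

namespace QuadPDE

variable {E : QuadPDE} {u₀ : ℂ}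

/-- The ratio of the coordinates is `eʷ` for the first three forms and `w` for the last two. -/
theorem exists_canonicalCoord_ratio {i : Fin 5} {τ : ℂ} (hτ : i ≤ 2 → τ ≠ 0)
    (hs : i = 0 → 1 - τ ∈ Complex.slitPlane) :
    ∃ w ∈ canonicalDomain i, (canonicalCoord i).2 w / (canonicalCoord i).1 w = τ := by
  fin_cases i
  · have h := hτ (by simp)
    have hw : Complex.log τ ∈ canonicalDomain 0 := by
      change 1 - Complex.exp (Complex.log τ) ∈ Complex.slitPlane
      rw [Complex.exp_log h]; exact hs rfl
    refine ⟨Complex.log τ, hw, ?_⟩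
    have h0 := one_sub_exp_ne_zero hw
    simp only [canonicalCoord, Fin.zero_eta, Matrix.cons_val_zero]
    rw [Complex.exp_log h] at h0 ⊢
    field_simp
  · exact ⟨Complex.log τ, Set.mem_univ _, by simp [canonicalCoord, Complex.exp_log (hτ (by decide))]⟩
  · exact ⟨Complex.log τ, Set.mem_univ _, by simp [canonicalCoord, Complex.exp_log (hτ (by decide))]⟩
  · exact ⟨τ, Set.mem_univ _, by simp [canonicalCoord]⟩
  · exact ⟨τ, Set.mem_univ _, by simp [canonicalCoord]⟩

theorem ne_zero_of_det_pencil {i : Fin 5} {x y : ℂ}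
    (h : (x • pencilFst i + y • pencilSnd i).det ≠ 0) :
    x ≠ 0 ∧ (i ≤ 2 → y ≠ 0) ∧ (i = 0 → x ≠ y) := by
  rw [det_pencil] at h
  fin_cases i <;> simp_all [sub_eq_zero]

variable {S : Matrix (Fin 3) (Fin 3) ℂ} {α β : ℂ → ℂ} {c : ℂ}

theorem locallyEquivalent_canonicalForm_of_slitPlane {i : Fin 5} (hE : E.AnalyticCoeffAt u₀)
    (hS : S.det ≠ 0) (hα : AnalyticAt ℂ α u₀) (hβ : AnalyticAt ℂ β u₀) (hc : c ≠ 0)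
    (hEV : ∀ᶠ u in 𝓝 u₀, S * E.V u * S.transpose = α u • pencilFst i + β u • pencilSnd i ∧
      α u * deriv β u - β u * deriv α u = c * (α u • pencilFst i + β u • pencilSnd i).det)
    (hdet : (α u₀ • pencilFst i + β u₀ • pencilSnd i).det ≠ 0)
    (hs : i = 0 → 1 - β u₀ / α u₀ ∈ Complex.slitPlane) :
    E.LocallyEquivalent u₀ (canonicalForm i) (canonicalDomain i) := by
  obtain ⟨hα0, hβ0, -⟩ := ne_zero_of_det_pencil hdet
  obtain ⟨w₀, hw₀, hτ⟩ := exists_canonicalCoord_ratio (fun h => div_ne_zero (hβ0 h) hα0) hs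
  obtain ⟨hγ, hδ, hγ0, -, -⟩ := canonicalCoord_spec hw₀
  exact locallyEquivalent_of_pencil hw₀ hE ((holomorphic_canonicalForm i).analyticCoeffAt hw₀) hS
    hα hβ hγ hδ hc (canonicalConst_ne_zero i) hEV (eventually_canonicalForm_V hw₀) hα0 hγ0
    hτ.symm hdet

/-- Only the first form has a restricted domain. The ratios `β / α` it misses are real and at least
`1`, and a symmetry of its pencil replaces them by allowed ones. -/
theorem locallyEquivalent_canonicalForm {i : Fin 5} (hE : E.AnalyticCoeffAt u₀)
    (hS : S.det ≠ 0) (hα : AnalyticAt ℂ α u₀) (hβ : AnalyticAt ℂ β u₀) (hc : c ≠ 0)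
    (hEV : ∀ᶠ u in 𝓝 u₀, S * E.V u * S.transpose = α u • pencilFst i + β u • pencilSnd i ∧
      α u * deriv β u - β u * deriv α u = c * (α u • pencilFst i + β u • pencilSnd i).det)
    (hdet : (α u₀ • pencilFst i + β u₀ • pencilSnd i).det ≠ 0) :
    E.LocallyEquivalent u₀ (canonicalForm i) (canonicalDomain i) := by
  by_cases hs : i = 0 → 1 - β u₀ / α u₀ ∈ Complex.slitPlane
  · exact locallyEquivalent_canonicalForm_of_slitPlane hE hS hα hβ hc hEV hdet hs
  push Not at hs
  obtain ⟨rfl, hs⟩ := hs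
  set T : Matrix (Fin 3) (Fin 3) ℂ := !![0, 0, 1; 0, 1, 0; 1, 0, 0] with hT
  have hTdet : T.det = -1 := by simp [hT, Matrix.det_fin_three]
  have hα0 := (ne_zero_of_det_pencil hdet).1
  -- exchanging two of the three singular directions replaces `β / α` by `1 - β / α`
  have hswap : ∀ x y : ℂ, T * (x • pencilFst 0 + y • pencilSnd 0) * T.transpose =
      x • pencilFst 0 + (x - y) • pencilSnd 0 := by
    intro x y
    ext a b
    fin_cases a <;> fin_cases b <;>
      simp [hT, pencilFst, pencilSnd, Matrix.mul_apply, Fin.sum_univ_three, sub_eq_add_neg]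
  have hdet' : ∀ x y : ℂ, (x • pencilFst 0 + (x - y) • pencilSnd 0).det =
      (x • pencilFst 0 + y • pencilSnd 0).det := by
    intro x y
    rw [det_pencil, det_pencil]
    simp only [Matrix.cons_val_zero]
    ring
  refine locallyEquivalent_canonicalForm_of_slitPlane (S := T * S) (c := -c)
    (β := fun u => α u - β u) hE (by rw [Matrix.det_mul, hTdet]; simpa using hS) hα (hα.sub hβ)
    (neg_ne_zero.2 hc) ?_ (by rw [hdet']; exact hdet) ?_
  · filter_upwards [hEV, hα.eventually_analyticAt, hβ.eventually_analyticAt] with u h1 h2 h3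
    constructor
    · rw [← hswap, ← h1.1, Matrix.transpose_mul]
      simp only [Matrix.mul_assoc]
    · rw [hdet', deriv_fun_sub h2.differentiableAt h3.differentiableAt]
      linear_combination -h1.2
  · intro _
    have h1 : 1 - (α u₀ - β u₀) / α u₀ = β u₀ / α u₀ := by field_simp; ring
    rw [h1]
    rw [Complex.mem_slitPlane_iff] at hs ⊢
    push Not at hs
    simp only [Complex.sub_re, Complex.one_re] at hs
    left
    linarith [hs.1]

/-- Every nonlinear integrable equation is equivalent to one canonical form near all values. -/
theorem exists_locallyEquivalent_canonicalForm {D : Set ℂ} (hD : IsOpen D)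
    (hpre : IsPreconnected D) (hE : E.Holomorphic D) (hdet : E.Nondegenerate D)
    (hint : E.Integrable D) (hlin : ¬ E.IsLinearizable D) :
    ∃ i : Fin 5, ∀ u₀ ∈ D, E.LocallyEquivalent u₀ (canonicalForm i) (canonicalDomain i) := by
  rcases D.eq_empty_or_nonempty with rfl | ⟨u₁, hu₁⟩
  · exact ⟨0, fun u hu => absurd hu (Set.notMem_empty u)⟩
  obtain ⟨k, hk⟩ := (integrable_iff hD hE hdet).1 hint
  obtain ⟨G, α, β, c, hG, hα, hβ, hc, hV⟩ := exists_pencil hD hpre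
    (fun i j u hu => (hE.analyticCoeffAt hu).analyticAt_V i j) (fun u => V_isSymm u) hdet hk hlin hu₁
  obtain ⟨i, S, p, q, r, s, hS, h1, h2⟩ := exists_hasNormalForm (V_isSymm u₁) hG (hdet u₁ hu₁)
  have hSV : ∀ u ∈ D, S * E.V u * S.transpose =
      (α u * p + β u * r) • pencilFst i + (α u * q + β u * s) • pencilSnd i := by
    intro u hu
    rw [(hV u hu).1, Matrix.mul_add, Matrix.add_mul, Matrix.mul_smul, Matrix.mul_smul,
      Matrix.smul_mul, Matrix.smul_mul, h1, h2]
    module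
  have hdetS : ∀ u ∈ D, ((α u * p + β u * r) • pencilFst i +
      (α u * q + β u * s) • pencilSnd i).det = S.det ^ 2 * (E.V u).det := by
    intro u hu
    rw [← hSV u hu, Matrix.det_mul, Matrix.det_mul, Matrix.det_transpose]
    ring
  -- If the images of the two generators were proportional, the curve would lie on a line through
  -- the origin.
  have hps : p * s - q * r ≠ 0 := by
    intro h0
    refine hlin ?_
    obtain ⟨t, ht1, ht2⟩ : ∃ t : ℂ, r = t * p ∧ s = t * q := by
      have hdet1 : (p • pencilFst i + q • pencilSnd i).det ≠ 0 := by
        rw [← h1, Matrix.det_mul, Matrix.det_mul, Matrix.det_transpose]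
        exact mul_ne_zero (mul_ne_zero hS (hdet u₁ hu₁)) hS
      have hp := (ne_zero_of_det_pencil hdet1).1
      refine ⟨r / p, by field_simp, ?_⟩
      field_simp
      linear_combination h0
    refine ⟨S⁻¹ * (p • pencilFst i + q • pencilSnd i) * S⁻¹.transpose,
      fun u => α u + t * β u, fun u hu => ?_⟩
    have hu' : IsUnit S.det := isUnit_iff_ne_zero.2 hS
    have h3 : E.V u = S⁻¹ * (S * E.V u * S.transpose) * S⁻¹.transpose := by
      rw [Matrix.transpose_nonsing_inv, Matrix.mul_assoc S, Matrix.nonsing_inv_mul_cancel_left _ _ hu',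
        Matrix.mul_nonsing_inv_cancel_right _ _ (by rwa [Matrix.det_transpose])]
    rw [h3, hSV u hu, ht1, ht2, ← Matrix.smul_mul, ← Matrix.mul_smul]
    congr 2
    module
  -- The type `i` and the congruence `S` were found once, at `u₁`, and describe `V` on all of `D`,
  -- so one canonical form serves every `u₀`.
  refine ⟨i, fun u₀ hu₀ => locallyEquivalent_canonicalForm (S := S)
    (α := fun u => α u * p + β u * r) (β := fun u => α u * q + β u * s)
    (c := (p * s - q * r) * c / S.det ^ 2) (hE.analyticCoeffAt hu₀) hS
    (((hα u₀ hu₀).mul analyticAt_const).add ((hβ u₀ hu₀).mul analyticAt_const))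
    (((hα u₀ hu₀).mul analyticAt_const).add ((hβ u₀ hu₀).mul analyticAt_const))
    (div_ne_zero (mul_ne_zero hps hc) (pow_ne_zero _ hS)) ?_ ?_⟩
  · filter_upwards [hD.mem_nhds hu₀] with u hu
    refine ⟨hSV u hu, ?_⟩
    have hlc : ∀ x y : ℂ, deriv (fun u => α u * x + β u * y) u =
        deriv α u * x + deriv β u * y := fun x y =>
      (((hα u hu).differentiableAt.hasDerivAt.mul_const x).fun_add
        ((hβ u hu).differentiableAt.hasDerivAt.mul_const y)).deriv
    rw [hlc, hlc, hdetS u hu]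
    field_simp
    linear_combination (p * s - q * r) * (hV u hu).2
  · rw [hdetS u₀ hu₀]
    exact mul_ne_zero (pow_ne_zero _ hS) (hdet u₀ hu₀)

end QuadPDE

/-! ### Inequivalence of the canonical forms -/

namespace QuadPDE

theorem LocallyEquivalent.exists_V_eq {E F : QuadPDE} {u₀ : ℂ} {D' : Set ℂ}
    (h : E.LocallyEquivalent u₀ F D') (hE : E.AnalyticCoeffAt u₀) :
    ∃ (S : Matrix (Fin 3) (Fin 3) ℂ) (φ : ℂ → ℂ), ∃ w₀ ∈ D', S.det ≠ 0 ∧ ContinuousAt φ w₀ ∧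
      φ w₀ = u₀ ∧ ∀ᶠ w in 𝓝 w₀, F.V w = deriv φ w • (S * E.V (φ w) * S.transpose) := by
  obtain ⟨S, C, φ, w₀, hS, hw₀, hφ, rfl, -, hC⟩ := h
  refine ⟨S, φ, w₀, hw₀, hS, hφ.continuousAt, rfl, ?_⟩
  filter_upwards [hC.eventually_nhds, hφ.eventually_analyticAt,
    hφ.continuousAt.eventually hE.eventually] with w h1 h2 h3
  ext i j
  have hS' : ∀ (M : Matrix (Fin 3) (Fin 3) ℂ) i j, (S * M * S.transpose) i j =
      bil M (S i) (S j) := fun M i j => bil_eq_mul_transpose M S i j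
  have hb := (hasDerivAt_bil (M := E.coeffMatrix) h3.differentiableAt_coeffMatrix
    h2.differentiableAt.hasDerivAt (hasDerivAt_const w (S i))
    (hasDerivAt_const w (S j))).add_const (C i j)
  have h4 : deriv (fun s => F.coeffMatrix s i j) w =
      deriv (fun s => bil (E.coeffMatrix (φ s)) (S i) (S j) + C i j) w :=
    Filter.EventuallyEq.deriv_eq (h1.mono fun s hs => by
      change F.coeffMatrix s i j = _
      rw [hs, Matrix.add_apply, hS'])
  have h5 : deriv (fun s => F.coeffMatrix s i j) w = F.V w i j :=
    congrFun (congrFun (matDeriv_coeffMatrix w) i) j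
  rw [← h5, h4, hb.deriv, matDeriv_coeffMatrix, Matrix.smul_apply, hS', smul_eq_mul]
  simp [bil]

theorem pencil_eq_zero {i : Fin 5} {x y : ℂ} (h : x • pencilFst i + y • pencilSnd i = 0) :
    x = 0 ∧ y = 0 := by
  have h' := fun a b => congrFun (congrFun h a) b
  fin_cases i
  · have h1 := h' 1 1; have h2 := h' 2 2
    simp [pencilFst, pencilSnd] at h1 h2; exact ⟨h1, h2⟩
  · have h1 := h' 1 1; have h2 := h' 2 2
    simp [pencilFst, pencilSnd] at h1 h2; exact ⟨h1, h2⟩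
  · have h1 := h' 0 1; have h2 := h' 2 2
    simp [pencilFst, pencilSnd] at h1 h2; exact ⟨h1, h2⟩
  · have h1 := h' 1 1; have h2 := h' 0 0
    simp [pencilFst, pencilSnd] at h1 h2; exact ⟨h1, h2⟩
  · have h1 := h' 1 1; have h2 := h' 0 1
    simp [pencilFst, pencilSnd] at h1 h2; exact ⟨h1, h2⟩

/-- The pencils of two canonical forms are congruent. -/
def PencilCongruent (i j : Fin 5) : Prop :=
  ∃ (S : Matrix (Fin 3) (Fin 3) ℂ) (a b c d : ℂ), S.det ≠ 0 ∧ a * d - b * c ≠ 0 ∧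
    ∀ x y : ℂ, x • pencilFst j + y • pencilSnd j = S * ((x * a + y * c) • pencilFst i +
      (x * b + y * d) • pencilSnd i) * S.transpose

theorem PencilCongruent.symm {i j : Fin 5} (h : PencilCongruent i j) : PencilCongruent j i := by
  obtain ⟨S, a, b, c, d, hS, habcd, h⟩ := h
  have hu : IsUnit S.det := isUnit_iff_ne_zero.2 hS
  set e := a * d - b * c with he
  refine ⟨S⁻¹, d / e, -b / e, -c / e, a / e, ?_, ?_, fun x y => ?_⟩
  · exact (Matrix.isUnit_nonsing_inv_det _ hu).ne_zero
  · have : d / e * (a / e) - -b / e * (-c / e) = 1 / e := by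
      field_simp; rw [he]; ring
    rw [this]; exact one_div_ne_zero habcd
  · rw [h, Matrix.transpose_nonsing_inv, Matrix.mul_assoc S, Matrix.nonsing_inv_mul_cancel_left _ _ hu,
      Matrix.mul_nonsing_inv_cancel_right _ _ (by rwa [Matrix.det_transpose])]
    congr 2
    · field_simp; rw [he]; ring
    · field_simp; rw [he]; ring

/-- Differentiating an equivalence makes the two curves `V` congruent up to a scalar factor. Each
curve spans its pencil, so the congruence extends from the curve to the pencil. -/
theorem pencilCongruent_of_locallyEquivalent {i j : Fin 5} {u₀ : ℂ} (hu₀ : u₀ ∈ canonicalDomain i)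
    (h : (canonicalForm i).LocallyEquivalent u₀ (canonicalForm j) (canonicalDomain j)) :
    PencilCongruent i j := by
  obtain ⟨S, φ, w₀, hw₀, hS, hφ, rfl, hV⟩ :=
    h.exists_V_eq ((holomorphic_canonicalForm i).analyticCoeffAt hu₀)
  obtain ⟨hγ, hδ, -, hdet, hW⟩ := canonicalCoord_spec hw₀
  set γ := (canonicalCoord j).1 with hγd
  set δ := (canonicalCoord j).2 with hδd
  have hev : ∀ᶠ w in 𝓝 w₀, ∃ x y : ℂ, γ w • pencilFst j + δ w • pencilSnd j =
      S * (x • pencilFst i + y • pencilSnd i) * S.transpose := by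
    filter_upwards [hV, (isOpen_canonicalDomain j).mem_nhds hw₀,
      hφ.eventually ((isOpen_canonicalDomain i).mem_nhds hu₀)] with w h1 h2 h3
    refine ⟨deriv φ w * (canonicalCoord i).1 (φ w), deriv φ w * (canonicalCoord i).2 (φ w), ?_⟩
    rw [← canonicalForm_V h2, h1, canonicalForm_V h3, ← Matrix.smul_mul, ← Matrix.mul_smul]
    congr 2
    module
  -- The Wronskian at `w₀` is not zero, so the curve has a nearby point not proportional to the one
  -- at `w₀`; the two span the pencil.
  obtain ⟨w, ⟨x₂, y₂, hw⟩, hne⟩ : ∃ w, (∃ x y : ℂ, γ w • pencilFst j + δ w • pencilSnd j =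
      S * (x • pencilFst i + y • pencilSnd i) * S.transpose) ∧
      γ w₀ * δ w - δ w₀ * γ w ≠ 0 := by
    by_contra! hcon
    have h0 : (fun w => γ w₀ * δ w - δ w₀ * γ w) =ᶠ[𝓝 w₀] fun _ => 0 := by
      filter_upwards [hev] with w hw using hcon w hw
    have h1 := ((hδ.differentiableAt.hasDerivAt.const_mul (γ w₀)).fun_sub
      (hγ.differentiableAt.hasDerivAt.const_mul (δ w₀))).deriv
    rw [h0.deriv_eq, deriv_const, hW] at h1
    exact mul_ne_zero (canonicalConst_ne_zero j) hdet h1.symm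
  obtain ⟨x₁, y₁, hw1⟩ := hev.self_of_nhds
  set e := γ w₀ * δ w - δ w₀ * γ w with he
  have key : ∀ x y : ℂ, ∃ x' y' : ℂ, x • pencilFst j + y • pencilSnd j =
      S * (x' • pencilFst i + y' • pencilSnd i) * S.transpose := by
    intro x y
    refine ⟨(x * δ w - y * γ w) / e * x₁ + (y * γ w₀ - x * δ w₀) / e * x₂,
      (x * δ w - y * γ w) / e * y₁ + (y * γ w₀ - x * δ w₀) / e * y₂, ?_⟩
    have h1 : x • pencilFst j + y • pencilSnd j =
        ((x * δ w - y * γ w) / e) • (γ w₀ • pencilFst j + δ w₀ • pencilSnd j) +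
        ((y * γ w₀ - x * δ w₀) / e) • (γ w • pencilFst j + δ w • pencilSnd j) := by
      have hx : x = (x * δ w - y * γ w) / e * γ w₀ + (y * γ w₀ - x * δ w₀) / e * γ w := by
        field_simp; rw [he]; ring
      have hy : y = (x * δ w - y * γ w) / e * δ w₀ + (y * γ w₀ - x * δ w₀) / e * δ w := by
        field_simp; rw [he]; ring
      calc x • pencilFst j + y • pencilSnd j =
          ((x * δ w - y * γ w) / e * γ w₀ + (y * γ w₀ - x * δ w₀) / e * γ w) • pencilFst j +
          ((x * δ w - y * γ w) / e * δ w₀ + (y * γ w₀ - x * δ w₀) / e * δ w) • pencilSnd j := by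
            rw [← hx, ← hy]
        _ = _ := by module
    rw [h1, hw, hw1, ← Matrix.smul_mul, ← Matrix.mul_smul, ← Matrix.smul_mul, ← Matrix.mul_smul,
      ← Matrix.add_mul, ← Matrix.mul_add]
    congr 2
    module
  obtain ⟨a, b, hab⟩ := key 1 0
  obtain ⟨c, d, hcd⟩ := key 0 1
  simp only [one_smul, zero_smul, add_zero, zero_add] at hab hcd
  have hlin : ∀ x y : ℂ, x • pencilFst j + y • pencilSnd j = S * ((x * a + y * c) • pencilFst i +
      (x * b + y * d) • pencilSnd i) * S.transpose := by
    intro x y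
    rw [hab, hcd, ← Matrix.smul_mul, ← Matrix.mul_smul, ← Matrix.smul_mul, ← Matrix.mul_smul,
      ← Matrix.add_mul, ← Matrix.mul_add]
    congr 2
    module
  refine ⟨S, a, b, c, d, hS, fun h0 => ?_, hlin⟩
  have h1 := hlin c (-a)
  rw [show c * a + -a * c = 0 by ring, show c * b + -a * d = 0 by linear_combination -h0] at h1
  have h2 := hlin d (-b)
  rw [show d * a + -b * c = 0 by linear_combination h0, show d * b + -b * d = 0 by ring] at h2
  simp only [zero_smul, add_zero, Matrix.mul_zero, Matrix.zero_mul] at h1 h2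
  have ha : a = 0 := neg_eq_zero.1 (pencil_eq_zero h1).2
  have hb : b = 0 := neg_eq_zero.1 (pencil_eq_zero h2).2
  have h3 := hlin 1 0
  simp only [ha, hb, mul_zero, zero_mul, add_zero, zero_smul] at h3
  exact one_ne_zero (pencil_eq_zero (i := j) (x := 1) (y := 0) (by simpa using h3)).1

/-- The pencil contains a matrix of rank one. -/
def HasRankOne (i : Fin 5) : Prop :=
  ∃ x y : ℂ, ¬ (x = 0 ∧ y = 0) ∧ ∃ v w : Fin 3 → ℂ,
    x • pencilFst i + y • pencilSnd i = Matrix.vecMulVec v w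

/-- All singular elements of the pencil are proportional. -/
def HasOneRoot (i : Fin 5) : Prop :=
  ∀ x y x' y' : ℂ, (x • pencilFst i + y • pencilSnd i).det = 0 →
    (x' • pencilFst i + y' • pencilSnd i).det = 0 → x * y' - y * x' = 0

/-- The pencil contains three pairwise nonproportional singular elements. -/
def HasThreeRoots (i : Fin 5) : Prop :=
  ∃ x y x' y' x'' y'' : ℂ, (x • pencilFst i + y • pencilSnd i).det = 0 ∧
    (x' • pencilFst i + y' • pencilSnd i).det = 0 ∧
    (x'' • pencilFst i + y'' • pencilSnd i).det = 0 ∧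
    x * y' - y * x' ≠ 0 ∧ x * y'' - y * x'' ≠ 0 ∧ x' * y'' - y' * x'' ≠ 0

namespace PencilCongruent

variable {i j : Fin 5}

theorem hasRankOne (h : PencilCongruent i j) (hi : HasRankOne i) : HasRankOne j := by
  obtain ⟨S, a, b, c, d, hS, habcd, h⟩ := h.symm
  obtain ⟨x, y, hxy, v, w, hvw⟩ := hi
  rw [h] at hvw
  have hu : IsUnit S.det := isUnit_iff_ne_zero.2 hS
  refine ⟨x * a + y * c, x * b + y * d, fun h0 => hxy ?_, S⁻¹.mulVec v, S⁻¹.mulVec w, ?_⟩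
  · constructor
    · exact (mul_eq_zero.1 (show x * (a * d - b * c) = 0 by
        linear_combination d * h0.1 - c * h0.2)).resolve_right habcd
    · exact (mul_eq_zero.1 (show y * (a * d - b * c) = 0 by
        linear_combination a * h0.2 - b * h0.1)).resolve_right habcd
  · have h1 := congrArg (fun M => S⁻¹ * M * S⁻¹.transpose) hvw
    rw [Matrix.transpose_nonsing_inv, Matrix.mul_assoc S, Matrix.nonsing_inv_mul_cancel_left _ _ hu,
      Matrix.mul_nonsing_inv_cancel_right _ _ (by rwa [Matrix.det_transpose])] at h1
    rw [h1, Matrix.mul_vecMulVec, Matrix.vecMulVec_mul, ← Matrix.transpose_nonsing_inv,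
      Matrix.vecMul_transpose]

theorem hasOneRoot (h : PencilCongruent i j) (hi : HasOneRoot i) : HasOneRoot j := by
  obtain ⟨S, a, b, c, d, hS, habcd, h⟩ := h
  intro x y x' y' h1 h2
  rw [h, Matrix.det_mul, Matrix.det_mul, Matrix.det_transpose] at h1 h2
  simp only [mul_eq_zero, hS, false_or, or_false] at h1 h2
  refine (mul_eq_zero.1 ?_).resolve_left habcd
  linear_combination hi _ _ _ _ h1 h2

theorem hasThreeRoots (h : PencilCongruent i j) (hi : HasThreeRoots i) : HasThreeRoots j := by
  obtain ⟨S, a, b, c, d, hS, habcd, h⟩ := h.symm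
  obtain ⟨x, y, x', y', x'', y'', h1, h2, h3, h4, h5, h6⟩ := hi
  rw [h, Matrix.det_mul, Matrix.det_mul, Matrix.det_transpose] at h1 h2 h3
  simp only [mul_eq_zero, hS, false_or, or_false] at h1 h2 h3
  have key : ∀ x y x' y' : ℂ, x * y' - y * x' ≠ 0 →
      (x * a + y * c) * (x' * b + y' * d) - (x * b + y * d) * (x' * a + y' * c) ≠ 0 := by
    intro x y x' y' h0
    rw [show (x * a + y * c) * (x' * b + y' * d) - (x * b + y * d) * (x' * a + y' * c) =
      (a * d - b * c) * (x * y' - y * x') by ring]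
    exact mul_ne_zero habcd h0
  exact ⟨_, _, _, _, _, _, h1, h2, h3, key _ _ _ _ h4, key _ _ _ _ h5, key _ _ _ _ h6⟩

end PencilCongruent

/-- A matrix of rank one has vanishing `2 × 2` minors; in the other three pencils these force both
coefficients to vanish. -/
theorem hasRankOne_iff (i : Fin 5) : HasRankOne i ↔ i = 1 ∨ i = 3 := by
  constructor
  · rintro ⟨x, y, hxy, v, w, h⟩
    have key : ∀ a b c d, (x • pencilFst i + y • pencilSnd i) a b *
        (x • pencilFst i + y • pencilSnd i) c d = (x • pencilFst i + y • pencilSnd i) a d *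
        (x • pencilFst i + y • pencilSnd i) c b := by
      intro a b c d
      rw [h]
      simp only [Matrix.vecMulVec_apply]
      ring
    by_contra hi
    refine hxy ?_
    fin_cases i
    · have h1 := key 0 0 1 1; have h2 := key 1 1 2 2; have h3 := key 0 0 2 2
      simp [pencilFst, pencilSnd] at h1 h2 h3
      rcases h2 with h2 | h2 <;> simp_all
    · simp at hi
    · have h1 := key 0 1 1 0; have h2 := key 0 1 2 2; have h3 := key 0 0 2 2
      simp [pencilFst, pencilSnd] at h1 h2 h3
      simp_all
    · simp at hi
    · have h1 := key 0 1 1 0; have h2 := key 1 1 0 2; have h3 := key 0 2 2 0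
      simp [pencilFst, pencilSnd] at h1 h2 h3
      simp_all
  · rintro (rfl | rfl)
    · refine ⟨0, 1, by simp, ![0, 0, 1], ![0, 0, 1], ?_⟩
      ext a b; fin_cases a <;> fin_cases b <;> simp [pencilFst, pencilSnd, Matrix.vecMulVec_apply]
    · refine ⟨0, 1, by simp, ![-1, 0, 0], ![1, 0, 0], ?_⟩
      ext a b; fin_cases a <;> fin_cases b <;> simp [pencilFst, pencilSnd, Matrix.vecMulVec_apply]

theorem hasOneRoot_iff (i : Fin 5) : HasOneRoot i ↔ i = 3 ∨ i = 4 := by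
  constructor
  · intro h
    have h1 := h 1 0 0 1
    rw [det_pencil, det_pencil] at h1
    by_contra hi
    fin_cases i <;> simp_all
  · intro hi x y x' y' h1 h2
    rw [det_pencil] at h1 h2
    rcases hi with rfl | rfl <;> simp_all

theorem hasThreeRoots_iff (i : Fin 5) : HasThreeRoots i ↔ i = 0 := by
  constructor
  · rintro ⟨x, y, x', y', x'', y'', h1, h2, h3, h4, h5, h6⟩
    rw [det_pencil] at h1 h2 h3
    by_contra hi
    fin_cases i
    · simp at hi
    all_goals
      simp at h1 h2 h3
      simp_all
    all_goals
      rcases h1 with rfl | rfl <;> rcases h2 with rfl | rfl <;> rcases h3 with rfl | rfl <;>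
        simp_all
  · rintro rfl
    refine ⟨1, 0, 0, 1, 1, 1, ?_, ?_, ?_, by norm_num, by norm_num, by norm_num⟩ <;>
      rw [det_pencil] <;> simp

/-- Three congruence invariants separate the five pencils: an element of rank one occurs for `1` and
`3`, a single root for `3` and `4`, three roots only for `0`, and none of these for `2`. -/
theorem not_locallyEquivalent_canonicalForm {i j : Fin 5} (hij : i ≠ j) {u₀ : ℂ}
    (hu₀ : u₀ ∈ canonicalDomain i) :
    ¬ (canonicalForm i).LocallyEquivalent u₀ (canonicalForm j) (canonicalDomain j) := by
  intro h
  have hc := pencilCongruent_of_locallyEquivalent hu₀ h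
  have h1 : HasRankOne i ↔ HasRankOne j := ⟨hc.hasRankOne, hc.symm.hasRankOne⟩
  have h2 : HasOneRoot i ↔ HasOneRoot j := ⟨hc.hasOneRoot, hc.symm.hasOneRoot⟩
  have h3 : HasThreeRoots i ↔ HasThreeRoots j := ⟨hc.hasThreeRoots, hc.symm.hasThreeRoots⟩
  rw [hasRankOne_iff, hasRankOne_iff] at h1
  rw [hasOneRoot_iff, hasOneRoot_iff] at h2
  rw [hasThreeRoots_iff, hasThreeRoots_iff] at h3
  clear h hc hu₀
  revert i j
  decide

end QuadPDE

theorem theorem1 :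
    -- the integrability criterion
    (∀ (D : Set ℂ) (E : QuadPDE), IsOpen D → E.Holomorphic D → E.Nondegenerate D →
      (E.Integrable D ↔
        ∃ k : ℂ → ℂ, ∀ u ∈ D,
          matDeriv (matDeriv E.V) u =
            logDeriv (fun s => (E.V s).det) u • matDeriv E.V u + k u • E.V u)) ∧
    -- every nonlinear integrable equation reduces to one of the five canonical forms
    (∀ (D : Set ℂ) (E : QuadPDE), IsOpen D → IsPreconnected D → E.Holomorphic D →
      E.Nondegenerate D → E.Integrable D → ¬ E.IsLinearizable D →
      ∃ i : Fin 5, ∀ u₀ ∈ D,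
        E.LocallyEquivalent u₀ (QuadPDE.canonicalForm i) (QuadPDE.canonicalDomain i)) ∧
    -- the canonical forms are themselves nonlinear integrable equations
    (∀ i : Fin 5,
      IsOpen (QuadPDE.canonicalDomain i) ∧ IsConnected (QuadPDE.canonicalDomain i) ∧
      (QuadPDE.canonicalForm i).Holomorphic (QuadPDE.canonicalDomain i) ∧
      (QuadPDE.canonicalForm i).Nondegenerate (QuadPDE.canonicalDomain i) ∧
      (QuadPDE.canonicalForm i).Integrable (QuadPDE.canonicalDomain i) ∧
      ¬ (QuadPDE.canonicalForm i).IsLinearizable (QuadPDE.canonicalDomain i)) ∧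
    -- and they are pairwise inequivalent
    (∀ i j : Fin 5, i ≠ j → ∀ u₀ ∈ QuadPDE.canonicalDomain i,
      ¬ (QuadPDE.canonicalForm i).LocallyEquivalent u₀
        (QuadPDE.canonicalForm j) (QuadPDE.canonicalDomain j)) :=
  ⟨fun _ _ hD hE hdet => QuadPDE.integrable_iff hD hE hdet,
    fun _ _ hD hpre hE hdet hint hlin =>
      QuadPDE.exists_locallyEquivalent_canonicalForm hD hpre hE hdet hint hlin,
    fun i => ⟨QuadPDE.isOpen_canonicalDomain i, QuadPDE.isConnected_canonicalDomain i,
      QuadPDE.holomorphic_canonicalForm i, QuadPDE.nondegenerate_canonicalForm i,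
      QuadPDE.integrable_canonicalForm i, QuadPDE.not_isLinearizable_canonicalForm i⟩,
    fun _ _ hij _ hu₀ => QuadPDE.not_locallyEquivalent_canonicalForm hij hu₀⟩
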